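/- **Setting.** Let $q=3^r$ with $r\ge 1$, let $\mathbb F=\mathbb F_q$, $\varepsilon=q/3$ and $\Omega=\mathbb F^3$. Consider the following permutations of $\Omega$ ($u,v,w,e,t\in\mathbb F$, $\lambda,\mu\in\mathbb F^*$): $\alpha_{(u,v,w)}:(a,b,c)\mapsto(a+u,b+v,c+w)$; $\beta_{\lambda,\mu}:(a,b,c)\mapsto(\lambda a,\mu b,(\lambda\mu)^{2\varepsilon}c)$; $\gamma_e:(a,b,c)\mapsto(a+eb,b,c)$; $\delta:(a,b,c)\mapsto(b,-a,c)$; $\tau_t:(a,b,c)\mapsto(a+tb^2+t^{\varepsilon}c,b,c)$; $\sigma:(a,b,c)\mapsto(a^3,b^3,c^3)$. Put $A=\{\alpha_{(u,v,w)}\}$, $V=\{\alpha_{(u,v,0)}\}$, $F=\{\alpha_{(0,0,w)}\}$, $C=\{\gamma_e\}$, $\mathcal S=\{\beta_{\mu^2,\mu}\}$, $T=\{\beta_{\mu,\mu^{-1}}\}$, $E=\{\tau_t\}$, $\Sigma=\langle\sigma\rangle$, $M=\langle C,\delta,T\rangle$, $Q=\langle A,C\rangle$, $K_1=VM$, $K_2=VCET$,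 $G_1=AM\mathcal S\Sigma$, $G_2=Q\mathcal SET\Sigma$. For subgroups $X,Y$ of a group, the coset graph of $\langle X,Y\rangle$ on $X$ and $Y$ has the cosets of $X$ and of $Y$ as vertices, a coset of $X$ and a coset of $Y$ being adjacent iff they intersect. Let $\Delta$ be the coset graph of $\langle G_1,G_2\rangle$ on $G_1,G_2$. The group $C\mathcal S\Sigma$ is identified with $A\Gamma L_1(q)=\{x\mapsto a\theta(x)+b\mid a\in\mathbb F^*,\,b\in\mathbb F,\,\theta\in{\rm Aut}(\mathbb F)\}\le{\rm Sym}(\mathbb F)$ as follows: $C$ corresponds to the translations, and $h\in \mathcal S\Sigma$ corresponds to the permutation $g$ of $\mathbb F$ with $h\gamma_eh^{-1}=\gamma_{g(e)}$ for all $e$ (maps composed from right to left). Let $\widehat J\le A\Gamma L_1(q)$ be a subgroup that contains all translations and is 2-transitive on $\mathbb F$, and let $J\le \mathcal S\Sigma$ correspond to the stabilizer of $0$ in $\widehat J$. Put $G_1(\widehat J)=K_1FJ$, $G_2(\widehat J)=K_2FJ$, $G(\widehat J)=\langle G_1(\widehat J),G_2(\widehat J)\rangle$, and let $\Delta_J$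 be the coset graph of $G(\widehat J)$ on $G_1(\widehat J)$, $G_2(\widehat J)$. **Notation.** $E_{q^n}$ is an elementary abelian group of order $q^n$. $AGL_n(q)$ is the semidirect product of the natural module $\mathbb F^n$ with $GL_n(q)$, and $ASL_2(q)\le AGL_2(q)$ is the subgroup of elements with linear part of determinant $1$. For $S\in Syl_3(ASL_2(q))$ let $ASL_2(q,S)=N_{ASL_2(q)}(S)$, and let $K_2(q,S)$ be the kernel of the conjugation action of $N_{AGL_2(q)}(S)$ on the set of elementary abelian subgroups of $S$ of order $q^2$. For $d\mid q-1$ and $X$ one of $GL_1(q)$, $GL_2(q)$, $AGL_2(q)$, $K_2(q,S)$, let $X^{(d)}$ be the unique normal subgroup of $X$ of index $d$. $O_3(X)$ is the largest normal 3-subgroup of $X$. A $G$-graph is a finite connected graph with a group $G$ acting faithfully on it by automorphisms. It is locally $s$-arc transitive if, for each vertex $z$, the stabilizer of $z$ is transitive on the $s$-arcs starting at $z$, an $s$-arc being a path $(y_0,\dots,y_s)$ with $y_{i-1}\ne y_{i+1}$. A cover of a graph $\Delta$ is a graph with a surjective homomorphism to $\Delta$ that maps the neighbours of each vertex bijectively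 onto the neighbours of its image. **Theorem 1.2.** The graph $\Delta_J$ is a cover of $\Delta$ and a locally 5-arc transitive $G(\widehat J)$-graph, and it has 1-arcs $(x_1,x_2)$ such that $x_1$ has $q+1$ neighbours and $x_2$ has $q$ neighbours. Let $(x_1,x_2)$ be any such 1-arc. For a vertex $z$ let $H_z$ be its stabilizer in $G(\widehat J)$, let $H_z^{[1]}$ be the kernel of the action of $H_z$ on the set of neighbours of $z$, and put $Q_z=O_3(H_z^{[1]})$. Let $H_i=H_{x_i}$, $H_{1,2}=H_1\cap H_2$, and $L_1=\langle Q_u\mid u\text{ a neighbour of }x_1\rangle Q_{x_1}$. Let $T_i$ be the largest subgroup of $H_{1,2}$ that is normal in $H_i$. Let $B$ be the smallest subgroup of $H_{1,2}$ with $T_1T_2\le B$ and $B=H_{1,2}\cap\langle B^{H_i}\rangle$ for $i=1,2$, and let $H_i^*=\langle B^{H_i}\rangle$, so that $H_1^*\leftarrow B\rightarrow H_2^*$ is the core of the vertex stabilizer amalgam. Then there is a divisor $d$ of $q-1$ such that, for every $S\in Syl_3(ASL_2(q))$: 1. $L_1\cong E_q\times ASL_2(q)$, $Z(L_1)\cong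 E_q$ and $O_3(B)=O_3(L_1\cap B)=O_3(T_2)\in Syl_3(L_1)$; 2. $B=(L_1\cap B)T_2$, $L_1\cap B\cong E_q\times ASL_2(q,S)$, and $Z(L_1)$ is a normal subgroup of $T_2$ with $T_2/Z(L_1)\cong K_2(q,S)^{(d)}$; 3. $H_1^*\cong E_{q^3}\rtimes GL_2(q)^{(d)}$ for some action, and $C_{H_1^*}(Z(L_1))\cong E_q\times AGL_2(q)^{(\frac{q-1}2)}$; 4. $H_2^*=O_3(T_2)\rtimes Y$ with $Y\cong GL_1(q)^{(d)}\times AGL_1(q)$, and $C_{H_2^*}(Z(O_3(T_2)))\cong E_q\times K_2(q,S)^{(\frac{q-1}2)}$. Moreover, $L_1$ is normal in $H_1$ and $H_1/L_1$ is isomorphic to a point stabilizer in a 2-transitive subgroup of $A\Gamma L_1(q)$. -/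

import Mathlib

namespace LocArc

/-! ### Subgroups of an ambient group -/

section GroupNotions

variable {G : Type*} [Group G]

/-- `O_p(H)` for a subgroup `H` of `G`: the join of all normal `p`-subgroups of `H`,
regarded as a subgroup of `G`. -/
def pRadical (p : ℕ) (H : Subgroup G) : Subgroup G :=
  (sSup {N : Subgroup H | N.Normal ∧ IsPGroup p N}).map H.subtype

/-- The largest subgroup of `D ⊓ H` that is normal in `H`, as a subgroup of `G`. -/
def coreIn (H D : Subgroup G) : Subgroup G :=
  (D.subgroupOf H).normalCore.map H.subtype

/-- `⟨B ^ H⟩`: the subgroup generated by all `H`-conjugates of elements of `B`. -/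
def conjClosure (H B : Subgroup G) : Subgroup G :=
  Subgroup.closure {x | ∃ h ∈ H, ∃ b ∈ B, x = h * b * h⁻¹}

/-- The centre `Z(H)` as a subgroup of `G`. -/
def centreOf (H : Subgroup G) : Subgroup G :=
  (Subgroup.center H).map H.subtype

/-- The centralizer `C_H(X)`. -/
def centralizerIn (H X : Subgroup G) : Subgroup G :=
  H ⊓ Subgroup.centralizer (X : Set G)

/-- `P` is a Sylow `p`-subgroup of the subgroup `H`. -/
def IsSylowIn (p : ℕ) (P H : Subgroup G) : Prop :=
  ∃ S : Sylow p H, (S : Subgroup H).map H.subtype = P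

/-- `N` is a normal subgroup of `H` and `H / N ≅ X`. -/
def QuotientIso (H N : Subgroup G) (X : Type*) [Group X] : Prop :=
  N ≤ H ∧ ∃ _ : (N.subgroupOf H).Normal, Nonempty ((H ⧸ N.subgroupOf H) ≃* X)

/-- `X ≅ N ⋊ K` for some action of `K` on `N` by automorphisms. -/
def IsoSemidirect (X N K : Type*) [Group X] [Group N] [Group K] : Prop :=
  ∃ φ : K →* MulAut N, Nonempty (X ≃* N ⋊[φ] K)

/-- `H = N ⋊ C` for a complement `C ≅ K` of the normal subgroup `N` of `H`. -/
def IsSplitBy (H N : Subgroup G) (K : Type*) [Group K] : Prop :=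
  N ≤ H ∧ (N.subgroupOf H).Normal ∧
    ∃ C : Subgroup G, C ⊓ N = ⊥ ∧ C ⊔ N = H ∧ Nonempty (C ≃* K)

/-- `X^{(d)}`: the normal subgroup of index `d`. It is used only for groups `X` having exactly
one normal subgroup of index `d`, and then it is that subgroup. -/
def indexSub (X : Type*) [Group X] (d : ℕ) : Subgroup X :=
  sInf {N : Subgroup X | N.Normal ∧ N.index = d}

/-- The conditions on `B` in the definition of the core of the amalgam
`(H₁, H₂; H₁ ⊓ H₂)`. -/
def CoreCondition (H₁ H₂ B : Subgroup G) : Prop :=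
  B ≤ H₁ ⊓ H₂ ∧
    coreIn H₁ (H₁ ⊓ H₂) ⊔ coreIn H₂ (H₁ ⊓ H₂) ≤ B ∧
    B = (H₁ ⊓ H₂) ⊓ conjClosure H₁ B ∧ B = (H₁ ⊓ H₂) ⊓ conjClosure H₂ B

/-- The edge group `B` of the core of the amalgam `(H₁, H₂; H₁ ⊓ H₂)`: the smallest
subgroup satisfying `CoreCondition` (see `coreB_isLeast`). -/
def coreB (H₁ H₂ : Subgroup G) : Subgroup G :=
  sInf {B | CoreCondition H₁ H₂ B}

theorem conjClosure_mono (H : Subgroup G) {B C : Subgroup G} (h : B ≤ C) :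
    conjClosure H B ≤ conjClosure H C := by
  apply Subgroup.closure_mono
  rintro x ⟨a, ha, b, hb, rfl⟩
  exact ⟨a, ha, b, h hb, rfl⟩

theorem le_conjClosure (H B : Subgroup G) : B ≤ conjClosure H B := fun b hb =>
  Subgroup.subset_closure ⟨1, H.one_mem, b, hb, by simp⟩

theorem coreIn_le (H D : Subgroup G) : coreIn H D ≤ D := by
  rintro x ⟨y, hy, rfl⟩
  exact (Subgroup.normalCore_le (D.subgroupOf H) hy : y ∈ D.subgroupOf H)

theorem coreB_isLeast (H₁ H₂ : Subgroup G) :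
    IsLeast {B | CoreCondition H₁ H₂ B} (coreB H₁ H₂) := by
  have hD : CoreCondition H₁ H₂ (H₁ ⊓ H₂) :=
    ⟨le_rfl, sup_le (coreIn_le _ _) (coreIn_le _ _),
      (inf_eq_left.2 (le_conjClosure _ _)).symm, (inf_eq_left.2 (le_conjClosure _ _)).symm⟩
  refine ⟨?_, fun B hB => sInf_le hB⟩
  refine ⟨sInf_le hD, le_sInf fun B hB => hB.2.1, ?_, ?_⟩
  · refine le_antisymm (le_inf (sInf_le hD) (le_conjClosure _ _)) (le_sInf fun B hB => ?_)
    exact (inf_le_inf_left _ (conjClosure_mono _ (sInf_le hB))).trans hB.2.2.1.symm.le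
  · refine le_antisymm (le_inf (sInf_le hD) (le_conjClosure _ _)) (le_sInf fun B hB => ?_)
    exact (inf_le_inf_left _ (conjClosure_mono _ (sInf_le hB))).trans hB.2.2.2.symm.le

end GroupNotions

/-! ### `G`-graphs -/

section Graphs

variable {V : Type*} (Γ : SimpleGraph V) (G : Type*) [Group G] [MulAction G V]

/-- A `G`-graph: a finite connected graph with a faithful action of `G` by automorphisms. -/
structure IsGGraph : Prop where
  finite : Finite V
  connected : Γ.Connected
  adj_smul : ∀ (g : G) (x y : V), Γ.Adj x y → Γ.Adj (g • x) (g • y)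
  faithful : FaithfulSMul G V

/-- An arc of length `s`: a path `(x₀, …, x_s)` with `x_{i-1} ≠ x_{i+1}`. -/
def IsArc (s : ℕ) (x : Fin (s + 1) → V) : Prop :=
  (∀ i j : Fin (s + 1), (i : ℕ) + 1 = j → Γ.Adj (x i) (x j)) ∧
    ∀ i j : Fin (s + 1), (i : ℕ) + 2 = j → x i ≠ x j

/-- For each vertex `z`, the stabilizer of `z` is transitive on the `s`-arcs starting at `z`. -/
def IsLocallyArcTransitive (s : ℕ) : Prop :=
  ∀ (z : V) (x y : Fin (s + 1) → V), IsArc Γ s x → IsArc Γ s y → x 0 = z → y 0 = z →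
    ∃ g ∈ MulAction.stabilizer G z, ∀ i, g • x i = y i

/-- `G_z^{[1]}`: the kernel of the action of the stabilizer of `z` on the neighbours of `z`. -/
def localKernel (z : V) : Subgroup G :=
  MulAction.stabilizer G z ⊓ ⨅ y ∈ Γ.neighborSet z, MulAction.stabilizer G y

/-- `Q_z = O₃(G_z^{[1]})`. -/
def vertexQ (z : V) : Subgroup G := pRadical 3 (localKernel Γ G z)

/-- `L_z = ⟨Q_u ∣ u a neighbour of z⟩ Q_z`. -/
def vertexL (z : V) : Subgroup G :=
  (⨆ u ∈ Γ.neighborSet z, vertexQ Γ G u) ⊔ vertexQ Γ G z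

end Graphs

/-- The coset graph of a group on two subgroups: the vertices are the cosets of the two
subgroups, and a coset of `H` is adjacent to a coset of `K` iff they intersect. -/
def cosetGraph {G : Type*} [Group G] (H K : Subgroup G) : SimpleGraph ((G ⧸ H) ⊕ (G ⧸ K)) where
  Adj
    | Sum.inl x, Sum.inr y => ∃ g : G, (g : G ⧸ H) = x ∧ (g : G ⧸ K) = y
    | Sum.inr y, Sum.inl x => ∃ g : G, (g : G ⧸ H) = x ∧ (g : G ⧸ K) = y
    | _, _ => False
  symm := ⟨by
    rintro (x | x) (y | y) h
    · exact h
    · exact h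
    · exact h
    · exact h⟩
  loopless := ⟨by rintro (x | x) h <;> exact h⟩

/-- The coset graph of the subgroup `⟨H, K⟩` of an ambient group on its subgroups `H`, `K`. -/
abbrev joinCosetGraph {P : Type*} [Group P] (H K : Subgroup P) :
    SimpleGraph ((↥(H ⊔ K) ⧸ H.subgroupOf (H ⊔ K)) ⊕ (↥(H ⊔ K) ⧸ K.subgroupOf (H ⊔ K))) :=
  cosetGraph (H.subgroupOf (H ⊔ K)) (K.subgroupOf (H ⊔ K))

/-- `Γ'` is a cover of `Γ`: there is a surjective graph homomorphism `Γ' → Γ` mapping the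
neighbours of each vertex bijectively to the neighbours of its image. -/
def IsCoverOf {V' V : Type*} (Γ' : SimpleGraph V') (Γ : SimpleGraph V) : Prop :=
  ∃ π : Γ' →g Γ, Function.Surjective π ∧
    ∀ z, Set.BijOn π (Γ'.neighborSet z) (Γ.neighborSet (π z))

/-! ### Linear, affine and semilinear groups over a field -/

section Classical

variable (F : Type*) [Field F]

/-- The natural action of `GL_n(F)` on the additive group `F^n`. -/
def natAction (n : ℕ) :
    Matrix.GeneralLinearGroup (Fin n) F →* MulAut (Multiplicative (Fin n → F)) where
  toFun g :=
    AddEquiv.toMultiplicative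
      { toFun := fun v => (g : Matrix (Fin n) (Fin n) F).mulVec v
        invFun := fun v => ((g⁻¹ : Matrix.GeneralLinearGroup (Fin n) F) :
          Matrix (Fin n) (Fin n) F).mulVec v
        left_inv := fun v => by
          dsimp only
          rw [Matrix.mulVec_mulVec, ← Units.val_mul, inv_mul_cancel, Units.val_one,
            Matrix.one_mulVec]
        right_inv := fun v => by
          dsimp only
          rw [Matrix.mulVec_mulVec, ← Units.val_mul, mul_inv_cancel, Units.val_one,
            Matrix.one_mulVec]
        map_add' := fun v w => Matrix.mulVec_add _ v w }
  map_one' := by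
    refine MulEquiv.ext fun v => ?_
    exact Matrix.one_mulVec (Multiplicative.toAdd v)
  map_mul' g h := by
    refine MulEquiv.ext fun v => ?_
    exact (Matrix.mulVec_mulVec (Multiplicative.toAdd v) (g : Matrix (Fin n) (Fin n) F)
      (h : Matrix (Fin n) (Fin n) F)).symm

/-- `GL_n(F)`. -/
abbrev GLn (n : ℕ) := Matrix.GeneralLinearGroup (Fin n) F

/-- The additive group of `F^n`: for `F` of order `q`, a power of the prime `p`, it is the
elementary abelian `p`-group of order `q ^ n`. -/
abbrev Ele (n : ℕ) := Multiplicative (Fin n → F)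

/-- `AGL_n(F) = F^n ⋊ GL_n(F)`. -/
abbrev AGL (n : ℕ) := Ele F n ⋊[natAction F n] GLn F n

/-- `ASL_n(F)`, as the subgroup of `AGL_n(F)` of elements with linear part of determinant 1. -/
def ASL (n : ℕ) : Subgroup (AGL F n) :=
  (Matrix.GeneralLinearGroup.det.comp SemidirectProduct.rightHom).ker

variable {F}

/-- A Sylow 3-subgroup of `ASL₂(F)` as a subgroup of `AGL₂(F)`. -/
def sylowInAGL (S : Sylow 3 (ASL F 2)) : Subgroup (AGL F 2) :=
  (S : Subgroup (ASL F 2)).map (ASL F 2).subtype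

/-- `ASL₂(q, S) = N_{ASL₂(q)}(S)`. -/
def ASL2S (S : Sylow 3 (ASL F 2)) : Subgroup (ASL F 2) :=
  Subgroup.normalizer ((S : Subgroup (ASL F 2)) : Set (ASL F 2))

/-- The set of elementary abelian subgroups of order `q ^ 2` of `S`. -/
def elemAb (S : Sylow 3 (ASL F 2)) : Set (Subgroup (AGL F 2)) :=
  {A | A ≤ sylowInAGL S ∧ (∀ x ∈ A, ∀ y ∈ A, x * y = y * x) ∧ (∀ x ∈ A, x ^ 3 = 1) ∧
    Nat.card A = Nat.card F ^ 2}

/-- `K₂(q, S)`: the kernel of the conjugation action of `N_{AGL₂(q)}(S)` on the set of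
elementary abelian subgroups of order `q ^ 2` of `S`. -/
def K2S (S : Sylow 3 (ASL F 2)) : Subgroup (AGL F 2) :=
  Subgroup.normalizer (sylowInAGL S : Set (AGL F 2)) ⊓
    ⨅ A ∈ elemAb S, Subgroup.normalizer (A : Set (AGL F 2))

variable (F)

/-- `AΓL₁(F)` as a group of permutations of `F`: all `x ↦ a σ(x) + b` with `a ≠ 0` and `σ` a
field automorphism. -/
def AGammaL1 : Subgroup (Equiv.Perm F) where
  carrier := {g | ∃ (a : Fˣ) (σ : F ≃+* F) (b : F), ∀ x, g x = a * σ x + b}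
  one_mem' := ⟨1, RingEquiv.refl F, 0, fun x => by simp⟩
  mul_mem' := by
    rintro g h ⟨a, σ, b, hg⟩ ⟨a', σ', b', hh⟩
    refine ⟨a * Units.map (σ : F →* F) a', σ'.trans σ, a * σ b' + b, fun x => ?_⟩
    simp only [Equiv.Perm.mul_apply, hg, hh, map_add, map_mul, Units.val_mul, Units.coe_map,
      RingEquiv.trans_apply, MonoidHom.coe_coe]
    ring
  inv_mem' := by
    rintro g ⟨a, σ, b, hg⟩
    refine ⟨Units.map (σ.symm : F →* F) a⁻¹, σ.symm, σ.symm (-(a⁻¹ : Fˣ) * b), fun x => ?_⟩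
    rw [Equiv.Perm.inv_eq_iff_eq, hg]
    simp only [Units.coe_map, MonoidHom.coe_coe, map_add, map_mul, RingEquiv.apply_symm_apply,
      map_neg]
    rw [mul_add, ← mul_assoc, ← mul_assoc]
    simp

/-- `J` is a 2-transitive subgroup of `AΓL₁(F)`. -/
def IsTwoTransSub (J : Subgroup (Equiv.Perm F)) : Prop :=
  J ≤ AGammaL1 F ∧ MulAction.IsMultiplyPretransitive J F 2

end Classical

/-! ### The permutation groups on `Ω = F³` -/

section Construction

variable (F : Type*) [Field F]

/-- The set `Ω` of triples `(a, b, c)`. -/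
abbrev Om := F × F × F

variable {F}

/-- `α_{(u,v,w)}`. -/
def al (u v w : F) : Equiv.Perm (Om F) where
  toFun x := (x.1 + u, x.2.1 + v, x.2.2 + w)
  invFun x := (x.1 - u, x.2.1 - v, x.2.2 - w)
  left_inv x := by simp
  right_inv x := by simp

/-- `β_{l,m} : (a, b, c) ↦ (l a, m b, (l m)^{2ε} c)` with `ε = q / 3`. -/
noncomputable def be (l m : Fˣ) : Equiv.Perm (Om F) where
  toFun x := (l * x.1, m * x.2.1, ((l * m) ^ (2 * (Nat.card F / 3)) : Fˣ) * x.2.2)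
  invFun x := ((l⁻¹ : Fˣ) * x.1, (m⁻¹ : Fˣ) * x.2.1,
    (((l * m) ^ (2 * (Nat.card F / 3)))⁻¹ : Fˣ) * x.2.2)
  left_inv x := by simp only [Units.inv_mul_cancel_left]
  right_inv x := by simp only [Units.mul_inv_cancel_left]

/-- `γ_e : (a, b, c) ↦ (a + e b, b, c)`. -/
def ga (e : F) : Equiv.Perm (Om F) where
  toFun x := (x.1 + e * x.2.1, x.2.1, x.2.2)
  invFun x := (x.1 - e * x.2.1, x.2.1, x.2.2)
  left_inv x := by simp
  right_inv x := by simp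

variable (F) in
/-- `δ : (a, b, c) ↦ (b, -a, c)`. -/
def de : Equiv.Perm (Om F) where
  toFun x := (x.2.1, -x.1, x.2.2)
  invFun x := (-x.2.1, x.1, x.2.2)
  left_inv x := by simp
  right_inv x := by simp

/-- `τ_d : (a, b, c) ↦ (a + d b² + d^ε c, b, c)` with `ε = q / 3`. -/
noncomputable def ta (d : F) : Equiv.Perm (Om F) where
  toFun x := (x.1 + (d * x.2.1 ^ 2 + d ^ (Nat.card F / 3) * x.2.2), x.2.1, x.2.2)
  invFun x := (x.1 - (d * x.2.1 ^ 2 + d ^ (Nat.card F / 3) * x.2.2), x.2.1, x.2.2)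
  left_inv x := by simp
  right_inv x := by simp

variable (F)

/-- `σ : (a, b, c) ↦ (a³, b³, c³)`. -/
noncomputable def si [Finite F] [CharP F 3] : Equiv.Perm (Om F) :=
  Equiv.prodCongr (frobeniusEquiv F 3).toEquiv
    (Equiv.prodCongr (frobeniusEquiv F 3).toEquiv (frobeniusEquiv F 3).toEquiv)

def grpA : Subgroup (Equiv.Perm (Om F)) := Subgroup.closure {g | ∃ u v w : F, g = al u v w}
def grpV : Subgroup (Equiv.Perm (Om F)) := Subgroup.closure {g | ∃ u v : F, g = al u v 0}
def grpF : Subgroup (Equiv.Perm (Om F)) := Subgroup.closure {g | ∃ w : F, g = al 0 0 w}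
def grpC : Subgroup (Equiv.Perm (Om F)) := Subgroup.closure {g | ∃ e : F, g = ga e}
def grpS : Subgroup (Equiv.Perm (Om F)) := Subgroup.closure {g | ∃ m : Fˣ, g = be (m ^ 2) m}
def grpT : Subgroup (Equiv.Perm (Om F)) := Subgroup.closure {g | ∃ m : Fˣ, g = be m m⁻¹}
def grpD : Subgroup (Equiv.Perm (Om F)) := Subgroup.closure {de F}
def grpE : Subgroup (Equiv.Perm (Om F)) := Subgroup.closure {g | ∃ d : F, g = ta d}
def grpSigma [Finite F] [CharP F 3] : Subgroup (Equiv.Perm (Om F)) := Subgroup.closure {si F}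

/-- `M = ⟨C, D, T⟩`. -/
def grpM : Subgroup (Equiv.Perm (Om F)) := grpC F ⊔ grpD F ⊔ grpT F

/-- `Q = ⟨A, C⟩`. -/
def grpQ : Subgroup (Equiv.Perm (Om F)) := grpA F ⊔ grpC F

/-- `G₁ = A M S Σ`. -/
def G1 [Finite F] [CharP F 3] : Subgroup (Equiv.Perm (Om F)) :=
  grpA F ⊔ grpM F ⊔ grpS F ⊔ grpSigma F

/-- `G₂ = Q S E T Σ`. -/
def G2 [Finite F] [CharP F 3] : Subgroup (Equiv.Perm (Om F)) :=
  grpQ F ⊔ grpS F ⊔ grpE F ⊔ grpT F ⊔ grpSigma F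

/-- The graph `Δ`: the coset graph of `G = ⟨G₁, G₂⟩` on `G₁` and `G₂`. -/
abbrev graphDelta [Finite F] [CharP F 3] := joinCosetGraph (G1 F) (G2 F)

/-- `K₁ = V M`. -/
def K1 : Subgroup (Equiv.Perm (Om F)) := grpV F ⊔ grpM F

/-- `K₂ = V C E T`. -/
def K2 : Subgroup (Equiv.Perm (Om F)) := grpV F ⊔ grpC F ⊔ grpE F ⊔ grpT F

variable {F}
variable [Finite F] [CharP F 3]

/-- The group `C S Σ` is identified with `AΓL₁(F)`: the subgroup `C = {γ_e}` corresponds to the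
translations `x ↦ x + e` of `F`, and an element `h` of `S Σ` corresponds to the permutation
`g` of `F` with `h γ_e h⁻¹ = γ_{g e}`. For `Jh ≤ AΓL₁(F)` this is the subgroup `J` of `S Σ`
corresponding to the stabilizer of `0` in `Jh`. -/
def grpJ (Jh : Subgroup (Equiv.Perm F)) : Subgroup (Equiv.Perm (Om F)) where
  carrier := {h | h ∈ grpS F ⊔ grpSigma F ∧ ∃ g ∈ Jh, ∀ e, h * ga e * h⁻¹ = ga (g e)}
  one_mem' := ⟨one_mem _, 1, one_mem _, fun e => by simp⟩
  mul_mem' := by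
    rintro h h' ⟨hh, g, hg, H⟩ ⟨hh', g', hg', H'⟩
    refine ⟨mul_mem hh hh', g * g', mul_mem hg hg', fun e => ?_⟩
    rw [Equiv.Perm.mul_apply, ← H, ← H']
    group
  inv_mem' := by
    rintro h ⟨hh, g, hg, H⟩
    refine ⟨inv_mem hh, g⁻¹, inv_mem hg, fun e => ?_⟩
    have := H (g⁻¹ e)
    rw [show g (g⁻¹ e) = e from g.apply_symm_apply e] at this
    rw [← this]
    group

/-- `G₁(Ĵ) = K₁ F J`. -/
def G1J (Jh : Subgroup (Equiv.Perm F)) : Subgroup (Equiv.Perm (Om F)) := K1 F ⊔ grpF F ⊔ grpJ Jh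

/-- `G₂(Ĵ) = K₂ F J`. -/
def G2J (Jh : Subgroup (Equiv.Perm F)) : Subgroup (Equiv.Perm (Om F)) := K2 F ⊔ grpF F ⊔ grpJ Jh

/-- `G(Ĵ) = ⟨G₁(Ĵ), G₂(Ĵ)⟩`. -/
abbrev GJ (Jh : Subgroup (Equiv.Perm F)) : Subgroup (Equiv.Perm (Om F)) := G1J Jh ⊔ G2J Jh

/-- The vertex set of `Δ_J`. -/
abbrev VJ (Jh : Subgroup (Equiv.Perm F)) : Type _ :=
  (GJ Jh ⧸ (G1J Jh).subgroupOf (GJ Jh)) ⊕ (GJ Jh ⧸ (G2J Jh).subgroupOf (GJ Jh))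

/-- The graph `Δ_J`: the coset graph of `G(Ĵ)` on `G₁(Ĵ)` and `G₂(Ĵ)`. -/
abbrev graphDeltaJ (Jh : Subgroup (Equiv.Perm F)) : SimpleGraph (VJ Jh) :=
  joinCosetGraph (G1J Jh) (G2J Jh)

end Construction

end LocArc

/-!
The group `P` of all permutations of `F³` is the ambient group, and every subgroup that occurs gets
a normal form in it. Each element of `G₁(Ĵ)` is uniquely a translation times `lin M * fr θ`, where
`lin M` acts as `M ∈ GL₂(F)` on the first two coordinates and as `det(M) ^ (2ε)` on the third, `θ`
is a field automorphism, and the only condition is that `x ↦ κ θ(x)` lies in `Ĵ`, where `κ` is the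
cube root of `det M` (`mem_G1J`; note that `x ^ ε` is the cube root of `x`). Elements of `G₂(Ĵ)`
have an additional factor `ta t`, and `M` is upper triangular (`mem_G2J`). So the intersection of
the two groups is cut out by the vanishing of one matrix entry, or of one second difference.

*The graph.* The two vertex groups have transversals indexed by the projective line and by `F`,
which gives the valencies `q + 1` and `q`. A 5-arc has a middle edge, and the edge group can move
its four outer vertices to standard positions one after the other (`movesToStandardArc_of_steps`,
`movesToStandardArc`); 2-transitivity of `Ĵ` enters in the third step only. The covering map is
induced by the inclusion of `G(Ĵ)` in the group for `AΓL₁(F)` (`isCoverOf_joinCosetGraph`).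

*The core.* Write `linSub X` for the group of all `v ↦ M v + c` with `M ∈ X`, and `D` for the group
of scalars `m` such that `x ↦ m x` is in `Ĵ`. The kernel at the second vertex is `linSub (wt D)`,
where `wt D` consists of the matrices `(m², e; 0, m)` with `m ∈ D` (`coreIn_G2J`), and its 3-radical
is `linSub (wt ⊥)`. The conjugates of the latter under `G₁(Ĵ)` generate the group of all affine maps
of determinant 1 (`mem_of_det_eq_one`). Hence the edge group of the core is
`linSub (borel ⊓ detSub D)` (`coreB_G1J_G2J`), the vertex groups of the core are
`linSub (detSub D)` and `G2J (mulSub D)`, and `d` is the index of `D` in `Fˣ`. The centralizers turn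
out to be cut out by `det² = 1` inside these groups; that all solutions of `m² = 1` lie in `D` is
the arithmetic lemma `sqrtOne_le_scal`: for `q = 3ʳ`, transitivity on `Fˣ` makes `d` a divisor of
`r`, while `3ʳ - 1` is divisible by a higher power of 2 than `r` is.

*The abstract groups.* On affine maps with `det² = 1` the third coordinate splits off, which
identifies the groups in question with subgroups of `AGL₂(F)` (`nonempty_linSub_mulEquiv`). The
subgroup `X^{(d)}` is the preimage of the subgroup of index `d` of `Fˣ` under a determinant map,
because the kernel of that map is generated by elements of order 3 (`indexSub_eq_comap`). The
elementary abelian subgroups of order `q²` of a Sylow subgroup of `ASL₂(F)` are the preimages of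
the lines of a plane (`exists_eq_lineSet`), which yields `K₂(q, S)` (`K2S_stdSylow`).

The vertices of an arbitrary arc are translates of the base vertices by some `g`, and conjugation by
`g⁻¹` is an injective homomorphism to `P` carrying the amalgam of the arc to the standard one
(`core_structure`).
-/

namespace LocArc

/-! ### Radicals, cores and conjugate closures of subgroups -/

section Abstract

variable {G P : Type*} [Group G] [Group P]

theorem mem_coreIn {H D : Subgroup G} {g : G} :
    g ∈ coreIn H D ↔ g ∈ H ∧ ∀ h ∈ H, h * g * h⁻¹ ∈ D := by
  constructor
  · rintro ⟨y, hy, rfl⟩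
    exact ⟨y.2, fun h hh => hy ⟨h, hh⟩⟩
  · rintro ⟨hg, h⟩
    exact ⟨⟨g, hg⟩, fun k => h k k.2, rfl⟩

theorem le_coreIn {H D N : Subgroup G} (hH : N ≤ H) (hD : N ≤ D)
    (hn : H ≤ Subgroup.normalizer (N : Set G)) : N ≤ coreIn H D := fun g hg =>
  mem_coreIn.2 ⟨hH hg, fun h hh => hD (Subgroup.le_normalizer_iff.1 hn h hh g hg)⟩

theorem map_coreIn {f : G →* P} (hf : Function.Injective f) (H D : Subgroup G) :
    (coreIn H D).map f = coreIn (H.map f) (D.map f) := by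
  ext x
  rw [mem_coreIn]
  constructor
  · rintro ⟨g, hg, rfl⟩
    obtain ⟨h1, h2⟩ := mem_coreIn.1 hg
    refine ⟨⟨g, h1, rfl⟩, ?_⟩
    rintro _ ⟨h, hh, rfl⟩
    exact ⟨_, h2 h hh, by simp⟩
  · rintro ⟨⟨g, hg, rfl⟩, h2⟩
    refine ⟨g, mem_coreIn.2 ⟨hg, fun h hh => ?_⟩, rfl⟩
    obtain ⟨y, hy, e⟩ := h2 _ ⟨h, hh, rfl⟩
    rw [← map_inv, ← map_mul, ← map_mul] at e
    exact hf e ▸ hy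

theorem le_pRadical {p : ℕ} {H N : Subgroup G} (hN : N ≤ H)
    (hn : H ≤ Subgroup.normalizer (N : Set G)) (hp : IsPGroup p N) : N ≤ pRadical p H := by
  have h1 : N.subgroupOf H ∈ {N : Subgroup H | N.Normal ∧ IsPGroup p N} :=
    ⟨(Subgroup.normal_subgroupOf_iff_le_normalizer hN).2 hn,
      hp.of_equiv (Subgroup.subgroupOfEquivOfLe hN).symm⟩
  have h2 := Subgroup.map_mono (f := H.subtype) (le_sSup h1)
  rwa [Subgroup.subgroupOf_map_subtype, inf_eq_left.2 hN] at h2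

/-- A subgroup containing all elements of `p`-power order of `H` contains `O_p(H)`. -/
theorem pRadical_le {p : ℕ} {H K : Subgroup G}
    (h : ∀ g ∈ H, ∀ k : ℕ, g ^ p ^ k = 1 → g ∈ K) : pRadical p H ≤ K := by
  rw [pRadical, Subgroup.map_le_iff_le_comap]
  refine sSup_le fun N hN g hg => ?_
  obtain ⟨k, hk⟩ := hN.2 ⟨g, hg⟩
  refine h g g.2 k ?_
  simpa using congrArg (fun x : N => ((x : H) : G)) hk

theorem pRadical_eq {p : ℕ} {H K : Subgroup G} (hK : K ≤ H)
    (hn : H ≤ Subgroup.normalizer (K : Set G)) (hp : IsPGroup p K)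
    (h : ∀ g ∈ H, ∀ k : ℕ, g ^ p ^ k = 1 → g ∈ K) : pRadical p H = K :=
  le_antisymm (pRadical_le h) (le_pRadical hK hn hp)

theorem map_pRadical (p : ℕ) {f : G →* P} (hf : Function.Injective f) (H : Subgroup G) :
    (pRadical p H).map f = pRadical p (H.map f) := by
  let e : H ≃* H.map f := H.equivMapOfInjective f hf
  have key : {N : Subgroup (H.map f) | N.Normal ∧ IsPGroup p N} =
      (Subgroup.map e.toMonoidHom) '' {N : Subgroup H | N.Normal ∧ IsPGroup p N} := by
    ext N
    constructor
    · rintro ⟨h1, h2⟩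
      refine ⟨N.map e.symm.toMonoidHom, ⟨h1.map _ e.symm.surjective, h2.map _⟩, ?_⟩
      rw [Subgroup.map_map]
      convert Subgroup.map_id N
      ext x
      simp
    · rintro ⟨N, ⟨h1, h2⟩, rfl⟩
      exact ⟨h1.map _ e.surjective, h2.map _⟩
  rw [pRadical, pRadical, key, sSup_image, Subgroup.map_map, sSup_eq_iSup]
  simp only [Subgroup.map_iSup, Subgroup.map_map]
  rfl

theorem conjClosure_le {H B N : Subgroup G} (hB : B ≤ N)
    (hn : H ≤ Subgroup.normalizer (N : Set G)) : conjClosure H B ≤ N := by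
  rw [conjClosure, Subgroup.closure_le]
  rintro _ ⟨h, hh, b, hb, rfl⟩
  exact Subgroup.le_normalizer_iff.1 hn h hh b (hB hb)

theorem conj_mem_conjClosure {H B : Subgroup G} {h b : G} (hh : h ∈ H) (hb : b ∈ B) :
    h * b * h⁻¹ ∈ conjClosure H B := Subgroup.subset_closure ⟨h, hh, b, hb, rfl⟩

theorem map_conjClosure (f : G →* P) (H B : Subgroup G) :
    (conjClosure H B).map f = conjClosure (H.map f) (B.map f) := by
  rw [conjClosure, conjClosure, MonoidHom.map_closure]
  congr 1
  ext x
  constructor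
  · rintro ⟨_, ⟨h, hh, b, hb, rfl⟩, rfl⟩
    exact ⟨f h, ⟨h, hh, rfl⟩, f b, ⟨b, hb, rfl⟩, by simp⟩
  · rintro ⟨_, ⟨h, hh, rfl⟩, _, ⟨b, hb, rfl⟩, rfl⟩
    exact ⟨_, ⟨h, hh, b, hb, rfl⟩, by simp⟩

theorem map_centreOf {f : G →* P} (hf : Function.Injective f) (H : Subgroup G) :
    (centreOf H).map f = centreOf (H.map f) := by
  ext x
  constructor
  · rintro ⟨_, ⟨⟨g, hg⟩, hc, rfl⟩, rfl⟩
    refine ⟨⟨f g, g, hg, rfl⟩, Subgroup.mem_center_iff.2 ?_, rfl⟩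
    rintro ⟨_, k, hk, rfl⟩
    have := congrArg (fun x : H => f x) (Subgroup.mem_center_iff.1 hc ⟨k, hk⟩)
    exact Subtype.ext (by simpa using this)
  · rintro ⟨⟨_, g, hg, rfl⟩, hc, rfl⟩
    refine ⟨g, ⟨⟨g, hg⟩, Subgroup.mem_center_iff.2 ?_, rfl⟩, rfl⟩
    rintro ⟨k, hk⟩
    have := congrArg Subtype.val (Subgroup.mem_center_iff.1 hc ⟨f k, k, hk, rfl⟩)
    exact Subtype.ext (hf (by simpa using this))

theorem mem_centreOf {H : Subgroup G} {g : G} :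
    g ∈ centreOf H ↔ g ∈ H ∧ ∀ h ∈ H, h * g = g * h := by
  constructor
  · rintro ⟨⟨g, hg⟩, hc, rfl⟩
    exact ⟨hg, fun h hh => congrArg Subtype.val (Subgroup.mem_center_iff.1 hc ⟨h, hh⟩)⟩
  · rintro ⟨hg, h⟩
    exact ⟨⟨g, hg⟩, Subgroup.mem_center_iff.2 fun k => Subtype.ext (h k k.2), rfl⟩

theorem mem_centralizerIn {H X : Subgroup G} {g : G} :
    g ∈ centralizerIn H X ↔ g ∈ H ∧ ∀ x ∈ X, x * g = g * x := by
  rw [centralizerIn, Subgroup.mem_inf, Subgroup.mem_centralizer_iff]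
  rfl

theorem map_centralizerIn {f : G →* P} (hf : Function.Injective f) (H X : Subgroup G) :
    (centralizerIn H X).map f = centralizerIn (H.map f) (X.map f) := by
  ext x
  rw [mem_centralizerIn]
  constructor
  · rintro ⟨g, hg, rfl⟩
    obtain ⟨h1, h2⟩ := mem_centralizerIn.1 hg
    refine ⟨⟨g, h1, rfl⟩, ?_⟩
    rintro _ ⟨x, hx, rfl⟩
    rw [← map_mul, h2 x hx, map_mul]
  · rintro ⟨⟨g, hg, rfl⟩, h2⟩
    refine ⟨g, mem_centralizerIn.2 ⟨hg, fun x hx => hf ?_⟩, rfl⟩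
    rw [map_mul, map_mul, h2 _ ⟨x, hx, rfl⟩]

theorem coreCondition_map {f : G →* P} (hf : Function.Injective f) (H₁ H₂ B : Subgroup G) :
    CoreCondition (H₁.map f) (H₂.map f) (B.map f) ↔ CoreCondition H₁ H₂ B := by
  unfold CoreCondition
  rw [← Subgroup.map_inf _ _ _ hf, ← map_coreIn hf, ← map_coreIn hf, ← Subgroup.map_sup,
    ← map_conjClosure, ← map_conjClosure, ← Subgroup.map_inf _ _ _ hf,
    ← Subgroup.map_inf _ _ _ hf, Subgroup.map_le_map_iff_of_injective hf,
    Subgroup.map_le_map_iff_of_injective hf, (Subgroup.map_injective hf).eq_iff,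
    (Subgroup.map_injective hf).eq_iff]

theorem map_coreB {f : G →* P} (hf : Function.Injective f) (H₁ H₂ : Subgroup G) :
    (coreB H₁ H₂).map f = coreB (H₁.map f) (H₂.map f) := by
  refine le_antisymm ?_ ?_
  · have h := (coreB_isLeast (H₁.map f) (H₂.map f)).1
    have h3 : coreB (H₁.map f) (H₂.map f) ≤ f.range :=
      h.1.trans (inf_le_left.trans (Subgroup.map_le_range _ _))
    have h4 : ((coreB (H₁.map f) (H₂.map f)).comap f).map f = coreB (H₁.map f) (H₂.map f) := by
      rw [Subgroup.map_comap_eq, inf_eq_right.2 h3]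
    rw [← h4] at h ⊢
    exact Subgroup.map_mono ((coreB_isLeast H₁ H₂).2 ((coreCondition_map hf _ _ _).1 h))
  · exact (coreB_isLeast _ _).2 ((coreCondition_map hf _ _ _).2 (coreB_isLeast H₁ H₂).1)

/-- A `p`-subgroup of index prime to `p` is a Sylow subgroup. -/
theorem isSylowIn_of_not_dvd {p : ℕ} [Fact p.Prime] [Finite G] {R H : Subgroup G} (hR : R ≤ H)
    (hp : IsPGroup p R) (hi : ¬ p ∣ R.relIndex H) : IsSylowIn p R H := by
  have hp' : IsPGroup p (R.subgroupOf H) := hp.of_equiv (Subgroup.subgroupOfEquivOfLe hR).symm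
  refine ⟨hp'.toSylow hi, ?_⟩
  exact (Subgroup.subgroupOf_map_subtype _ _).trans (inf_eq_left.2 hR)

theorem isSylowIn_of_map {p : ℕ} [Fact p.Prime] [Finite P] {f : G →* P}
    (hf : Function.Injective f) {R H : Subgroup G} (h : IsSylowIn p (R.map f) (H.map f)) :
    IsSylowIn p R H := by
  obtain ⟨S, hS⟩ := h
  have : Finite G := Finite.of_injective f hf
  have hR : R ≤ H := by
    rw [← Subgroup.map_le_map_iff_of_injective hf, ← hS]
    exact Subgroup.map_subtype_le _
  have hp : IsPGroup p R := by
    have h1 : IsPGroup p (R.map f) := hS ▸ S.isPGroup'.map _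
    exact h1.of_equiv (R.equivMapOfInjective f hf).symm
  refine isSylowIn_of_not_dvd hR hp ?_
  rw [← Subgroup.relIndex_map_map_of_injective R H hf, ← hS]
  have := S.not_dvd_index
  rwa [Subgroup.relIndex, Subgroup.subgroupOf, Subgroup.comap_map_eq_self_of_injective
    (Subgroup.subtype_injective _)]

/-- `H / N ≅ X` whenever an injective homomorphism maps `X` onto a complement of `N` in `H`. -/
theorem quotientIso_of_complement {H N : Subgroup G} {X : Type*} [Group X] (hN : N ≤ H)
    (hn : H ≤ Subgroup.normalizer (N : Set G)) (f : X →* G) (h1 : ∀ x, f x ∈ H)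
    (h2 : ∀ x, f x ∈ N → x = 1) (h3 : ∀ h ∈ H, ∃ x, (f x)⁻¹ * h ∈ N) : QuotientIso H N X := by
  have hnor := (Subgroup.normal_subgroupOf_iff_le_normalizer hN).2 hn
  refine ⟨hN, hnor, ⟨(MulEquiv.ofBijective
    ((QuotientGroup.mk' (N.subgroupOf H)).comp (f.codRestrict H h1)) ⟨?_, ?_⟩).symm⟩⟩
  · rw [injective_iff_map_eq_one]
    intro x hx
    have : f.codRestrict H h1 x ∈ N.subgroupOf H := (QuotientGroup.eq_one_iff _).1 hx
    exact h2 x this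
  · intro y
    obtain ⟨⟨h, hh⟩, rfl⟩ := QuotientGroup.mk'_surjective _ y
    obtain ⟨x, hx⟩ := h3 h hh
    exact ⟨x, QuotientGroup.eq.2 hx⟩

theorem QuotientIso.of_map {f : G →* P} (hf : Function.Injective f) {H N : Subgroup G}
    {X : Type*} [Group X] (h : QuotientIso (H.map f) (N.map f) X) : QuotientIso H N X := by
  obtain ⟨h1, h2, ⟨e⟩⟩ := h
  have hle : N ≤ H := (Subgroup.map_le_map_iff_of_injective hf).1 h1
  have hk : (N.subgroupOf H).map (H.equivMapOfInjective f hf).toMonoidHom =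
      (N.map f).subgroupOf (H.map f) := by
    ext x
    rw [Subgroup.mem_subgroupOf]
    constructor
    · rintro ⟨y, hy, rfl⟩
      exact ⟨y, hy, rfl⟩
    · rintro ⟨y, hy, e⟩
      exact ⟨⟨y, hle hy⟩, hy, Subtype.ext e⟩
  have hn : (N.subgroupOf H).Normal := by
    have : N.subgroupOf H =
        ((N.map f).subgroupOf (H.map f)).comap (H.equivMapOfInjective f hf).toMonoidHom := by
      rw [← hk, Subgroup.comap_map_eq_self_of_injective (MulEquiv.injective _)]
    rw [this]
    exact h2.comap _
  exact ⟨hle, hn, ⟨(QuotientGroup.congr (N.subgroupOf H) ((N.map f).subgroupOf (H.map f))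
    (H.equivMapOfInjective f hf) hk).trans e⟩⟩

theorem QuotientIso.congr {H N : Subgroup G} {X Y : Type*} [Group X] [Group Y]
    (h : QuotientIso H N X) (e : X ≃* Y) : QuotientIso H N Y := by
  obtain ⟨h1, h2, ⟨e'⟩⟩ := h
  exact ⟨h1, h2, ⟨e'.trans e⟩⟩

theorem IsSplitBy.of_map {f : G →* P} (hf : Function.Injective f) {H N : Subgroup G}
    {X : Type*} [Group X] (h : IsSplitBy (H.map f) (N.map f) X) : IsSplitBy H N X := by
  obtain ⟨h1, h2, C, h3, h4, ⟨e⟩⟩ := h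
  have hle : N ≤ H := (Subgroup.map_le_map_iff_of_injective hf).1 h1
  have hC : (C.comap f).map f = C := by
    rw [Subgroup.map_comap_eq, inf_eq_right]
    exact (le_sup_left.trans h4.le).trans (Subgroup.map_le_range _ _)
  refine ⟨hle, (Subgroup.normal_subgroupOf_iff_le_normalizer hle).2 ?_, C.comap f, ?_, ?_, ⟨?_⟩⟩
  · rw [Subgroup.normal_subgroupOf_iff_le_normalizer h1] at h2
    rw [Subgroup.le_normalizer_iff] at h2 ⊢
    intro h hh n hn
    obtain ⟨y, hy, ey⟩ := h2 _ ⟨h, hh, rfl⟩ _ ⟨n, hn, rfl⟩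
    rw [← map_inv, ← map_mul, ← map_mul] at ey
    exact hf ey ▸ hy
  · apply Subgroup.map_injective hf
    rw [Subgroup.map_inf _ _ _ hf, hC, h3, Subgroup.map_bot]
  · apply Subgroup.map_injective hf
    rw [Subgroup.map_sup, hC, h4]
  · exact ((C.comap f).equivMapOfInjective f hf).trans ((MulEquiv.subgroupCongr hC).trans e)

/-- `X × Y ≅ K` when `K` is the product of commuting copies of `X` and `Y` that meet trivially. -/
theorem nonempty_mulEquiv_prod {X Y : Type*} [Group X] [Group Y] {K : Subgroup P}
    (f : X →* P) (g : Y →* P) (hc : ∀ x y, f x * g y = g y * f x)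
    (hi : ∀ x y, f x * g y = 1 → x = 1 ∧ y = 1)
    (hK : ∀ k, k ∈ K ↔ ∃ x y, k = f x * g y) : Nonempty (K ≃* X × Y) := by
  let φ : X × Y →* P := f.noncommCoprod g hc
  have hv : ∀ x y, φ (x, y) = f x * g y := fun x y => rfl
  have hφ : Function.Injective φ := by
    rw [injective_iff_map_eq_one]
    rintro ⟨x, y⟩ h
    obtain ⟨h1, h2⟩ := hi x y (by rwa [hv] at h)
    rw [h1, h2]; rfl
  have hr : φ.range = K := by
    ext k
    rw [hK]
    constructor
    · rintro ⟨⟨x, y⟩, rfl⟩; exact ⟨x, y, hv x y⟩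
    · rintro ⟨x, y, rfl⟩; exact ⟨(x, y), hv x y⟩
  exact ⟨((MonoidHom.ofInjective hφ).trans (MulEquiv.subgroupCongr hr)).symm⟩

/-- `indexSub` is invariant under isomorphisms. -/
theorem map_indexSub {X Y : Type*} [Group X] [Group Y] (e : X ≃* Y) (d : ℕ) :
    (indexSub X d).map e.toMonoidHom = indexSub Y d := by
  refine le_antisymm (le_sInf fun N hN => ?_) fun y hy => ?_
  · rw [Subgroup.map_le_iff_le_comap]
    refine sInf_le ⟨hN.1.comap _, ?_⟩
    rw [Subgroup.index_comap_of_surjective _ e.surjective, hN.2]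
  · refine ⟨e.symm y, ?_, by simp⟩
    refine Subgroup.mem_sInf.2 fun N hN => ?_
    have : y ∈ N.map e.toMonoidHom := by
      refine Subgroup.mem_sInf.1 hy _ ⟨hN.1.map _ e.surjective, ?_⟩
      rw [Subgroup.index_map_of_bijective e.bijective, hN.2]
    obtain ⟨x, hx, rfl⟩ := this
    simpa using hx

theorem indexSub_congr {X Y : Type*} [Group X] [Group Y] (e : X ≃* Y) (d : ℕ) :
    Nonempty (indexSub X d ≃* indexSub Y d) :=
  ⟨(e.subgroupMap _).trans (MulEquiv.subgroupCongr (map_indexSub e d))⟩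

/-- In a finite cyclic group a subgroup is determined by its index. -/
theorem eq_of_index_eq_of_isCyclic {A : Type*} [CommGroup A] [IsCyclic A] [Finite A]
    {D E : Subgroup A} (h : D.index = E.index) : D = E := by
  have hc : Nat.card D = Nat.card E := by
    have h1 := D.card_mul_index
    rw [h, ← E.card_mul_index] at h1
    exact Nat.eq_of_mul_eq_mul_right (Nat.pos_of_ne_zero E.index_ne_zero_of_finite) h1
  have key : ∀ D : Subgroup A, D = (powMonoidHom (Nat.card D) : A →* A).ker := by
    intro D
    refine Subgroup.eq_of_le_of_card_ge (fun x hx => ?_) ?_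
    · have := pow_card_eq_one' (x := (⟨x, hx⟩ : D))
      exact congrArg Subtype.val this
    · rw [IsCyclic.card_powMonoidHom_ker]
      exact Nat.gcd_le_right _ Nat.card_pos
  rw [key D, key E, hc]

/-- If `χ` maps `X` onto a finite cyclic group and its kernel lies in every normal subgroup of
index prime to `p`, then the normal subgroups of such an index are the preimages of the subgroups
of the cyclic group. -/
theorem indexSub_eq_comap {X A : Type*} [Group X] [CommGroup A] [IsCyclic A] [Finite A]
    (χ : X →* A) (hχ : Function.Surjective χ) {p : ℕ} (hp : ¬ p ∣ Nat.card A)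
    (hker : ∀ N : Subgroup X, N.Normal → ¬ p ∣ N.index → χ.ker ≤ N) (D : Subgroup A) :
    indexSub X D.index = D.comap χ := by
  refine le_antisymm (sInf_le ⟨inferInstance, D.index_comap_of_surjective hχ⟩)
    (le_sInf fun N hN => ?_)
  have hk : χ.ker ≤ N := hker N hN.1 fun h => hp (h.trans (hN.2 ▸ D.index_dvd_card))
  have h1 : (N.map χ).comap χ = N := by rw [Subgroup.comap_map_eq, sup_eq_left.2 hk]
  have h2 : (N.map χ).index = D.index := by
    rw [← hN.2, ← h1, Subgroup.index_comap_of_surjective _ hχ, h1]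
  rw [← h1, eq_of_index_eq_of_isCyclic h2]

/-- An element of order `p` lies in every normal subgroup of index prime to `p`. -/
theorem mem_of_pow_eq_one {X : Type*} [Group X] {p : ℕ} (hp : p.Prime) {N : Subgroup X}
    (hn : N.Normal) (hi : ¬ p ∣ N.index) {x : X} (hx : x ^ p = 1) : x ∈ N := by
  rw [← QuotientGroup.eq_one_iff, ← orderOf_eq_one_iff]
  have h1 : orderOf (x : X ⧸ N) ∣ p := orderOf_dvd_of_pow_eq_one (by
    rw [← QuotientGroup.mk_pow, hx, QuotientGroup.mk_one])
  have h2 : orderOf (x : X ⧸ N) ∣ N.index := orderOf_dvd_natCard _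
  exact ((Nat.dvd_prime hp).1 h1).resolve_right fun h => hi (h ▸ h2)

end Abstract

/-! ### Coset graphs -/

section Graphs

variable {V : Type*} {Γ : SimpleGraph V} {G : Type*} [Group G] [MulAction G V]

theorem mem_localKernel {z : V} {g : G} :
    g ∈ localKernel Γ G z ↔ g • z = z ∧ ∀ u, Γ.Adj z u → g • u = u := by
  simp [localKernel, Subgroup.mem_iInf, MulAction.mem_stabilizer_iff]

theorem localKernel_eq_coreIn
    (hΓ : ∀ (g : G) (x y : V), Γ.Adj x y → Γ.Adj (g • x) (g • y)) {x u : V} (hu : Γ.Adj x u)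
    (ht : ∀ v, Γ.Adj x v → ∃ h : G, h • x = x ∧ h • u = v) :
    localKernel Γ G x = coreIn (MulAction.stabilizer G x)
      (MulAction.stabilizer G x ⊓ MulAction.stabilizer G u) := by
  ext g
  rw [mem_localKernel, mem_coreIn]
  simp only [Subgroup.mem_inf, MulAction.mem_stabilizer_iff]
  refine and_congr_right fun hg => ⟨fun h k hk => ?_, fun h v hv => ?_⟩
  · have hk' : k⁻¹ • x = x := by rw [inv_smul_eq_iff, hk]
    refine ⟨by rw [mul_smul, mul_smul, hk', hg, hk], ?_⟩
    rw [mul_smul, mul_smul, h, smul_inv_smul]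
    have := hΓ k⁻¹ _ _ hu
    rwa [hk'] at this
  · obtain ⟨k, hk, rfl⟩ := ht v hv
    have hk' : k⁻¹ • x = x := by rw [inv_smul_eq_iff, hk]
    have := (h k⁻¹ hk').2
    rw [inv_inv, mul_smul, mul_smul, inv_smul_eq_iff] at this
    exact this

theorem map_conj_localKernel
    (hΓ : ∀ (g : G) (x y : V), Γ.Adj x y → Γ.Adj (g • x) (g • y)) (h : G) (z : V) :
    (localKernel Γ G z).map (MulAut.conj h).toMonoidHom = localKernel Γ G (h • z) := by
  ext g
  constructor
  · rintro ⟨k, hk, rfl⟩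
    obtain ⟨h1, h2⟩ := mem_localKernel.1 hk
    refine mem_localKernel.2 ⟨by simp [mul_smul, h1], fun u hu => ?_⟩
    have := h2 (h⁻¹ • u) (by simpa using hΓ h⁻¹ _ _ hu)
    simp [mul_smul, this]
  · intro hg
    obtain ⟨h1, h2⟩ := mem_localKernel.1 hg
    refine ⟨h⁻¹ * g * h, mem_localKernel.2 ⟨by simp [mul_smul, h1], fun u hu => ?_⟩,
      by simp [mul_assoc]⟩
    simp [mul_smul, h2 _ (hΓ h _ _ hu)]

theorem map_conj_vertexQ
    (hΓ : ∀ (g : G) (x y : V), Γ.Adj x y → Γ.Adj (g • x) (g • y)) (h : G) (z : V) :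
    (vertexQ Γ G z).map (MulAut.conj h).toMonoidHom = vertexQ Γ G (h • z) := by
  rw [vertexQ, vertexQ, ← map_conj_localKernel hΓ, map_pRadical 3 (MulAut.conj h).injective]

/-- If the stabilizer of `x` is transitive on the neighbours of `x`, then `L_x` is generated by
`Q_x` and the conjugates of `Q_u` for a single neighbour `u`. -/
theorem vertexL_eq
    (hΓ : ∀ (g : G) (x y : V), Γ.Adj x y → Γ.Adj (g • x) (g • y)) {x u : V} (hu : Γ.Adj x u)
    (ht : ∀ v, Γ.Adj x v → ∃ h : G, h • x = x ∧ h • u = v) :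
    vertexL Γ G x = conjClosure (MulAction.stabilizer G x) (vertexQ Γ G u) ⊔ vertexQ Γ G x := by
  rw [vertexL]
  congr 1
  refine le_antisymm (iSup₂_le fun v hv => ?_) ?_
  · obtain ⟨h, hh, rfl⟩ := ht v hv
    rw [← map_conj_vertexQ hΓ]
    rintro _ ⟨q, hq, rfl⟩
    exact conj_mem_conjClosure (MulAction.mem_stabilizer_iff.2 hh) hq
  · rw [conjClosure, Subgroup.closure_le]
    rintro _ ⟨h, hh, q, hq, rfl⟩
    have hh' : h • x = x := hh
    have hv : Γ.Adj x (h • u) := by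
      have := hΓ h _ _ hu
      rwa [hh'] at this
    have h1 : h * q * h⁻¹ ∈ vertexQ Γ G (h • u) := by
      rw [← map_conj_vertexQ hΓ]
      exact ⟨q, hq, rfl⟩
    exact (le_iSup₂_of_le (f := fun u (_ : u ∈ Γ.neighborSet x) => vertexQ Γ G u)
      (h • u) hv le_rfl) h1

theorem IsArc.rev {s : ℕ} {x : Fin (s + 1) → V} (h : IsArc Γ s x) : IsArc Γ s (x ∘ Fin.rev) := by
  refine ⟨fun i j hij => (h.1 _ _ ?_).symm, fun i j hij => (h.2 _ _ ?_).symm⟩ <;>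
  · simp only [Fin.val_rev]
    omega

end Graphs

section CosetGraph

variable {G : Type*} [Group G] {H K : Subgroup G}

theorem cosetGraph_adj_smul (g : G) (x y : (G ⧸ H) ⊕ (G ⧸ K))
    (h : (cosetGraph H K).Adj x y) : (cosetGraph H K).Adj (g • x) (g • y) := by
  rcases x with x | x <;> rcases y with y | y
  · exact h.elim
  · obtain ⟨a, rfl, rfl⟩ := h
    exact ⟨g * a, rfl, rfl⟩
  · obtain ⟨a, rfl, rfl⟩ := h
    exact ⟨g * a, rfl, rfl⟩
  · exact h.elim

theorem cosetGraph_adj_inl {a : G} {z : (G ⧸ H) ⊕ (G ⧸ K)} :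
    (cosetGraph H K).Adj (Sum.inl a) z ↔ ∃ h ∈ H, z = Sum.inr ((a * h : G) : G ⧸ K) := by
  rcases z with z | z
  · exact ⟨fun h => h.elim, fun ⟨_, _, h⟩ => by cases h⟩
  · constructor
    · rintro ⟨g, h1, rfl⟩
      exact ⟨a⁻¹ * g, QuotientGroup.eq.1 h1.symm, by simp⟩
    · rintro ⟨h, hh, e⟩
      exact ⟨a * h, by simp [hh], (Sum.inr_injective e).symm⟩

theorem cosetGraph_adj_inr {a : G} {z : (G ⧸ H) ⊕ (G ⧸ K)} :
    (cosetGraph H K).Adj (Sum.inr a) z ↔ ∃ k ∈ K, z = Sum.inl ((a * k : G) : G ⧸ H) := by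
  rcases z with z | z
  · constructor
    · rintro ⟨g, rfl, h1⟩
      exact ⟨a⁻¹ * g, QuotientGroup.eq.1 h1.symm, by simp⟩
    · rintro ⟨h, hh, e⟩
      exact ⟨a * h, (Sum.inl_injective e).symm, by simp [hh]⟩
  · exact ⟨fun h => h.elim, fun ⟨_, _, h⟩ => by cases h⟩

theorem cosetGraph_connected (hg : H ⊔ K = ⊤) : (cosetGraph H K).Connected := by
  have key : ∀ g ∈ H ⊔ K, (cosetGraph H K).Reachable (Sum.inl ((1 : G) : G ⧸ H))
      (Sum.inl (g : G ⧸ H)) := by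
    intro g hg
    rw [Subgroup.sup_eq_closure] at hg
    induction hg using Subgroup.closure_induction_right with
    | one => exact SimpleGraph.Reachable.refl _
    | mul_right x hx y hy ih =>
      rcases hy with hy | hy
      · rwa [show ((x * y : G) : G ⧸ H) = x from
          QuotientGroup.mk_mul_of_mem _ (by simpa using hy)]
      · exact ih.trans ((cosetGraph_adj_inl.2 ⟨1, one_mem _, rfl⟩).reachable.trans
          (cosetGraph_adj_inr.2 ⟨y, hy, by simp⟩).reachable)
    | mul_inv_cancel x hx y hy ih =>
      rcases hy with hy | hy
      · rwa [show ((x * y⁻¹ : G) : G ⧸ H) = x from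
          QuotientGroup.mk_mul_of_mem _ (by simpa using hy)]
      · exact ih.trans ((cosetGraph_adj_inl.2 ⟨1, one_mem _, rfl⟩).reachable.trans
          (cosetGraph_adj_inr.2 ⟨y⁻¹, inv_mem hy, by simp⟩).reachable)
  have key2 : ∀ z, (cosetGraph H K).Reachable (Sum.inl ((1 : G) : G ⧸ H)) z := by
    rintro (z | z) <;> induction z using QuotientGroup.induction_on with | H z => ?_
    · exact key z (hg ▸ Subgroup.mem_top z)
    · exact (key z (hg ▸ Subgroup.mem_top z)).trans
        (cosetGraph_adj_inl.2 ⟨1, one_mem _, by simp⟩).reachable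
  exact { preconnected := fun x y => (key2 x).symm.trans (key2 y), nonempty := ⟨Sum.inl (1 : G)⟩ }

theorem isGGraph_cosetGraph [Finite G] (hg : H ⊔ K = ⊤)
    (hf : ∀ x : G, (∀ a : G, a⁻¹ * x * a ∈ H ⊓ K) → x = 1) : IsGGraph (cosetGraph H K) G where
  finite := inferInstance
  connected := cosetGraph_connected hg
  adj_smul := cosetGraph_adj_smul
  faithful := ⟨fun {x y} h => by
    rw [← inv_mul_eq_one]
    refine hf _ fun a => ⟨?_, ?_⟩
    · have h1 : ((x * a : G) : G ⧸ H) = (y * a : G) := Sum.inl_injective (h (Sum.inl (a : G ⧸ H)))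
      simpa [mul_assoc] using QuotientGroup.eq.1 h1
    · have h1 : ((x * a : G) : G ⧸ K) = (y * a : G) := Sum.inr_injective (h (Sum.inr (a : G ⧸ K)))
      simpa [mul_assoc] using QuotientGroup.eq.1 h1⟩

/-- Every edge of a coset graph is a translate of the base edge. -/
theorem exists_smul_of_adj {x : G ⧸ H} {y : G ⧸ K}
    (h : (cosetGraph H K).Adj (Sum.inl x) (Sum.inr y)) :
    ∃ g : G, (Sum.inl x : (G ⧸ H) ⊕ (G ⧸ K)) = g • Sum.inl ((1 : G) : G ⧸ H) ∧
      (Sum.inr y : (G ⧸ H) ⊕ (G ⧸ K)) = g • Sum.inr ((1 : G) : G ⧸ K) := by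
  obtain ⟨g, rfl, rfl⟩ := h
  refine ⟨g, ?_, ?_⟩
  · rw [Sum.smul_inl, MulAction.Quotient.smul_coe, smul_eq_mul, mul_one]
  · rw [Sum.smul_inr, MulAction.Quotient.smul_coe, smul_eq_mul, mul_one]

theorem mem_stabilizer_inl {g y : G} :
    y ∈ MulAction.stabilizer G (g • Sum.inl ((1 : G) : G ⧸ H) : (G ⧸ H) ⊕ (G ⧸ K)) ↔
      g⁻¹ * y * g ∈ H := by
  rw [MulAction.mem_stabilizer_iff, ← inv_smul_eq_iff, smul_smul, smul_smul, Sum.smul_inl,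
    Sum.inl_injective.eq_iff, MulAction.Quotient.smul_coe, eq_comm, QuotientGroup.eq]
  simp [mul_assoc]

theorem mem_stabilizer_inr {g y : G} :
    y ∈ MulAction.stabilizer G (g • Sum.inr ((1 : G) : G ⧸ K) : (G ⧸ H) ⊕ (G ⧸ K)) ↔
      g⁻¹ * y * g ∈ K := by
  rw [MulAction.mem_stabilizer_iff, ← inv_smul_eq_iff, smul_smul, smul_smul, Sum.smul_inr,
    Sum.inr_injective.eq_iff, MulAction.Quotient.smul_coe, eq_comm, QuotientGroup.eq]
  simp [mul_assoc]

/-- A transversal of `H ⊓ K` in `H` counts the neighbours of a coset of `H`. -/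
theorem ncard_neighborSet_inl {ι : Type*} (a : G) (f : ι → G) (hf : ∀ i, f i ∈ H)
    (hs : ∀ h ∈ H, ∃ i, (f i)⁻¹ * h ∈ K) (hi : ∀ i j, (f i)⁻¹ * f j ∈ K → i = j) :
    ((cosetGraph H K).neighborSet (Sum.inl (a : G ⧸ H))).ncard = Nat.card ι := by
  rw [← Nat.card_coe_set_eq]
  refine (Nat.card_congr (Equiv.ofBijective (fun i => ⟨Sum.inr ((a * f i : G) : G ⧸ K),
    cosetGraph_adj_inl.2 ⟨f i, hf i, rfl⟩⟩) ⟨fun i j h => ?_, ?_⟩)).symm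
  · have h1 := QuotientGroup.eq.1 (Sum.inr_injective (congrArg Subtype.val h))
    refine hi i j ?_
    simpa [mul_assoc] using h1
  · rintro ⟨z, hz⟩
    obtain ⟨h, hh, rfl⟩ := cosetGraph_adj_inl.1 hz
    obtain ⟨i, hi'⟩ := hs h hh
    refine ⟨i, Subtype.ext (congrArg Sum.inr (QuotientGroup.eq.2 ?_))⟩
    simpa [mul_assoc] using hi'

theorem ncard_neighborSet_inr {ι : Type*} (a : G) (f : ι → G) (hf : ∀ i, f i ∈ K)
    (hs : ∀ k ∈ K, ∃ i, (f i)⁻¹ * k ∈ H) (hi : ∀ i j, (f i)⁻¹ * f j ∈ H → i = j) :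
    ((cosetGraph H K).neighborSet (Sum.inr (a : G ⧸ K))).ncard = Nat.card ι := by
  rw [← Nat.card_coe_set_eq]
  refine (Nat.card_congr (Equiv.ofBijective (fun i => ⟨Sum.inl ((a * f i : G) : G ⧸ H),
    cosetGraph_adj_inr.2 ⟨f i, hf i, rfl⟩⟩) ⟨fun i j h => ?_, ?_⟩)).symm
  · have h1 := QuotientGroup.eq.1 (Sum.inl_injective (congrArg Subtype.val h))
    refine hi i j ?_
    simpa [mul_assoc] using h1
  · rintro ⟨z, hz⟩
    obtain ⟨h, hh, rfl⟩ := cosetGraph_adj_inr.1 hz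
    obtain ⟨i, hi'⟩ := hs h hh
    refine ⟨i, Subtype.ext (congrArg Sum.inl (QuotientGroup.eq.2 ?_))⟩
    simpa [mul_assoc] using hi'

/-- The 5-arc `(n e H, n K, H, K, e H, e n K)`. -/
def standardArc (H K : Subgroup G) (n e : G) : Fin 6 → (G ⧸ H) ⊕ (G ⧸ K) :=
  ![Sum.inl ((n * e : G) : G ⧸ H), Sum.inr (n : G ⧸ K), Sum.inl ((1 : G) : G ⧸ H),
    Sum.inr ((1 : G) : G ⧸ K), Sum.inl (e : G ⧸ H), Sum.inr ((e * n : G) : G ⧸ K)]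

/-- `H ⊓ K` moves every 5-arc whose middle edge is the base edge to the standard one. -/
def MovesToStandardArc (H K : Subgroup G) (n e : G) : Prop :=
  ∀ h ∈ H, h ∉ K → ∀ k ∈ K, k ∉ H → ∀ k' ∈ K, k' ∉ H → ∀ h' ∈ H, h' ∉ K →
    ∃ g ∈ H ⊓ K, n⁻¹ * (g * h) ∈ K ∧ (n * e)⁻¹ * (g * (h * k)) ∈ H ∧ e⁻¹ * (g * k') ∈ H ∧
      (e * n)⁻¹ * (g * (k' * h')) ∈ K

/-- A criterion for `MovesToStandardArc`, moving the four outer vertices one after the other. -/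
theorem movesToStandardArc_of_steps {n e : G} (hn : n ∈ H) (he : e ∈ K)
    (s1 : ∀ h ∈ H, h ∉ K → ∃ b ∈ H ⊓ K, n⁻¹ * (b * h) ∈ K)
    (s2 : ∀ k ∈ K, k ∉ H → ∃ b ∈ H ⊓ K, n⁻¹ * b * n ∈ K ∧ e⁻¹ * (b * k) ∈ H)
    (s3 : ∀ k ∈ K, k ∉ H → ∃ b ∈ H ⊓ K, n⁻¹ * b * n ∈ K ∧ e⁻¹ * b * e ∈ H ∧
      (n * e)⁻¹ * (b * (n * k)) ∈ H)
    (s4 : ∀ h ∈ H, h ∉ K → ∃ b ∈ H ⊓ K, n⁻¹ * b * n ∈ K ∧ e⁻¹ * b * e ∈ H ∧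
      (n * e)⁻¹ * b * (n * e) ∈ H ∧ (e * n)⁻¹ * (b * (e * h)) ∈ K) :
    MovesToStandardArc H K n e := by
  intro h hh hhK k hk hkH k' hk' hkH' h' hh' hhK'
  obtain ⟨b₁, ⟨b₁H, b₁K⟩, p1⟩ := s1 h hh hhK
  obtain ⟨b₂, ⟨b₂H, b₂K⟩, p2, q2⟩ := s2 (b₁ * k') (mul_mem b₁K hk')
    (by rwa [Subgroup.mul_mem_cancel_left _ b₁H])
  have p2' : n⁻¹ * (b₂ * b₁ * h) ∈ K := by simpa [mul_assoc] using mul_mem p2 p1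
  have p2H : n⁻¹ * (b₂ * b₁ * h) ∈ H := mul_mem (inv_mem hn) (mul_mem (mul_mem b₂H b₁H) hh)
  obtain ⟨b₃, ⟨b₃H, b₃K⟩, p3, q3, r3⟩ := s3 (n⁻¹ * (b₂ * b₁ * h) * k) (mul_mem p2' hk)
    (by rwa [Subgroup.mul_mem_cancel_left _ p2H])
  have q3' : e⁻¹ * (b₃ * b₂ * b₁ * k') ∈ H := by simpa [mul_assoc] using mul_mem q3 q2
  have q3K : e⁻¹ * (b₃ * b₂ * b₁ * k') ∈ K :=
    mul_mem (inv_mem he) (mul_mem (mul_mem (mul_mem b₃K b₂K) b₁K) hk')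
  obtain ⟨b₄, ⟨b₄H, b₄K⟩, p4, q4, r4, t4⟩ := s4 (e⁻¹ * (b₃ * b₂ * b₁ * k') * h')
    (mul_mem q3' hh') (by rwa [Subgroup.mul_mem_cancel_left _ q3K])
  refine ⟨b₄ * b₃ * b₂ * b₁, ⟨mul_mem (mul_mem (mul_mem b₄H b₃H) b₂H) b₁H,
    mul_mem (mul_mem (mul_mem b₄K b₃K) b₂K) b₁K⟩, ?_, ?_, ?_, ?_⟩
  · simpa [mul_assoc] using mul_mem p4 (mul_mem p3 p2')
  · simpa [mul_assoc] using mul_mem r4 r3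
  · simpa [mul_assoc] using mul_mem q4 q3'
  · simpa [mul_assoc] using t4

theorem MovesToStandardArc.subgroupOf {L : Subgroup G} (hH : H ≤ L) {n e : G}
    (hn : n ∈ L) (he : e ∈ L) (h : MovesToStandardArc H K n e) :
    MovesToStandardArc (H.subgroupOf L) (K.subgroupOf L) ⟨n, hn⟩ ⟨e, he⟩ := by
  intro h1 hh1 n1 k hk nk k' hk' nk' h' hh' nh'
  obtain ⟨g, hg, h2⟩ := h h1 hh1 n1 k hk nk k' hk' nk' h' hh' nh'
  exact ⟨⟨g, hH hg.1⟩, hg, h2⟩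

theorem exists_smul_eq_standardArc {n e : G} (hm : MovesToStandardArc H K n e)
    {y : Fin 6 → (G ⧸ H) ⊕ (G ⧸ K)} (hy : IsArc (cosetGraph H K) 5 y)
    {x : G ⧸ H} (h0 : y 0 = Sum.inl x) : ∃ g : G, ∀ i, g • y i = standardArc H K n e i := by
  have a01 := hy.1 0 1 rfl
  have a12 := hy.1 1 2 rfl
  have a23 := hy.1 2 3 rfl
  have a34 := hy.1 3 4 rfl
  have a45 := hy.1 4 5 rfl
  have d02 := hy.2 0 2 rfl
  have d13 := hy.2 1 3 rfl
  have d24 := hy.2 2 4 rfl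
  have d35 := hy.2 3 5 rfl
  have e2 : ∃ z, y 2 = Sum.inl z := by
    induction x using QuotientGroup.induction_on with | H x => ?_
    rw [h0, cosetGraph_adj_inl] at a01
    obtain ⟨h, -, e1⟩ := a01
    rw [e1, cosetGraph_adj_inr] at a12
    obtain ⟨k, -, e2⟩ := a12
    exact ⟨_, e2⟩
  obtain ⟨z, e2⟩ := e2
  rcases e3 : y 3 with w | w
  · rw [e2, e3] at a23
    exact a23.elim
  rw [e2, e3] at a23
  obtain ⟨a, rfl, rfl⟩ := a23
  have a21 := a12.symm
  rw [e2, cosetGraph_adj_inl] at a21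
  obtain ⟨h, hh, e1⟩ := a21
  have a10 := a01.symm
  rw [e1, cosetGraph_adj_inr] at a10
  obtain ⟨k, hk, e0⟩ := a10
  rw [e3, cosetGraph_adj_inr] at a34
  obtain ⟨k', hk', e4⟩ := a34
  rw [e4, cosetGraph_adj_inl] at a45
  obtain ⟨h', hh', e5⟩ := a45
  rw [e0, e2] at d02
  rw [e1, e3] at d13
  rw [e2, e4] at d24
  rw [e3, e5] at d35
  have n1 : h ∉ K := fun hK => d13 (by simp [hK])
  have n0 : k ∉ H := fun hH => d02 (by
    rw [QuotientGroup.mk_mul_of_mem _ hH, QuotientGroup.mk_mul_of_mem _ hh])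
  have n4 : k' ∉ H := fun hH => d24 (by simp [hH])
  have n5 : h' ∉ K := fun hK => d35 (by
    rw [QuotientGroup.mk_mul_of_mem _ hK, QuotientGroup.mk_mul_of_mem _ hk'])
  obtain ⟨g, ⟨hgH, hgK⟩, g1, g0, g4, g5⟩ := hm h hh n1 k hk n0 k' hk' n4 h' hh' n5
  refine ⟨g * a⁻¹, fun i => ?_⟩
  fin_cases i
  · change (g * a⁻¹) • y 0 = Sum.inl _
    rw [e0, Sum.smul_inl, MulAction.Quotient.smul_coe]
    refine congrArg Sum.inl (QuotientGroup.eq.2 ?_).symm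
    simpa [mul_assoc] using g0
  · change (g * a⁻¹) • y 1 = Sum.inr _
    rw [e1, Sum.smul_inr, MulAction.Quotient.smul_coe]
    refine congrArg Sum.inr (QuotientGroup.eq.2 ?_).symm
    simpa [mul_assoc] using g1
  · change (g * a⁻¹) • y 2 = Sum.inl _
    rw [e2, Sum.smul_inl, MulAction.Quotient.smul_coe]
    refine congrArg Sum.inl (QuotientGroup.eq.2 ?_).symm
    simpa [mul_assoc] using hgH
  · change (g * a⁻¹) • y 3 = Sum.inr _
    rw [e3, Sum.smul_inr, MulAction.Quotient.smul_coe]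
    refine congrArg Sum.inr (QuotientGroup.eq.2 ?_).symm
    simpa [mul_assoc] using hgK
  · change (g * a⁻¹) • y 4 = Sum.inl _
    rw [e4, Sum.smul_inl, MulAction.Quotient.smul_coe]
    refine congrArg Sum.inl (QuotientGroup.eq.2 ?_).symm
    simpa [mul_assoc] using g4
  · change (g * a⁻¹) • y 5 = Sum.inr _
    rw [e5, Sum.smul_inr, MulAction.Quotient.smul_coe]
    refine congrArg Sum.inr (QuotientGroup.eq.2 ?_).symm
    simpa [mul_assoc] using g5

/-- The reversal of a 5-arc starting at a coset of `K` starts at a coset of `H`, so that the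
5-arcs of both types are governed by their middle edges. -/
theorem isLocallyArcTransitive_cosetGraph {n e : G} (hm : MovesToStandardArc H K n e) :
    IsLocallyArcTransitive (cosetGraph H K) G 5 := by
  have key : ∀ x y : Fin 6 → (G ⧸ H) ⊕ (G ⧸ K), IsArc (cosetGraph H K) 5 x →
      IsArc (cosetGraph H K) 5 y → ∀ u v, x 0 = Sum.inl u → y 0 = Sum.inl v →
      ∃ g : G, ∀ i, g • x i = y i := by
    intro x y hx hy u v hu hv
    obtain ⟨g, hg⟩ := exists_smul_eq_standardArc hm hx hu
    obtain ⟨g', hg'⟩ := exists_smul_eq_standardArc hm hy hv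
    exact ⟨g'⁻¹ * g, fun i => by rw [mul_smul, hg, ← hg', inv_smul_smul]⟩
  have alt : ∀ x : Fin 6 → (G ⧸ H) ⊕ (G ⧸ K), IsArc (cosetGraph H K) 5 x →
      ∀ u, x 0 = Sum.inr u → ∃ v, x 5 = Sum.inl v := by
    intro x hx u hu
    have step : ∀ i j : Fin 6, (i : ℕ) + 1 = j → (x i).isLeft = !(x j).isLeft := by
      intro i j hij
      have := hx.1 i j hij
      rcases hi : x i with a | a <;> rcases hj : x j with b | b <;> rw [hi, hj] at this
      · exact this.elim
      · rfl
      · rfl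
      · exact this.elim
    have h5 : (x 5).isLeft = true := by
      have := step 0 1 rfl
      have := step 1 2 rfl
      have := step 2 3 rfl
      have := step 3 4 rfl
      have := step 4 5 rfl
      have h0 : (x 0).isLeft = false := by rw [hu]; rfl
      simp_all
    exact Sum.isLeft_iff.1 h5
  intro z x y hx hy hxz hyz
  have main : ∃ g : G, ∀ i, g • x i = y i := by
    rcases hz : z with u | u
    · exact key x y hx hy u u (hxz.trans hz) (hyz.trans hz)
    · obtain ⟨v, hv⟩ := alt x hx u (hxz.trans hz)
      obtain ⟨w, hw⟩ := alt y hy u (hyz.trans hz)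
      obtain ⟨g, hg⟩ := key _ _ hx.rev hy.rev v w hv hw
      exact ⟨g, fun i => by simpa using hg i.rev⟩
  obtain ⟨g, hg⟩ := main
  exact ⟨g, MulAction.mem_stabilizer_iff.2 (by rw [← hxz, hg 0, hyz, hxz]), hg⟩

end CosetGraph

section Cover

variable {P : Type*} [Group P]

/-- If `H = H' (H ⊓ K)`, `K = K' (H ⊓ K)`, `H' ⊓ K ≤ K'` and `K' ⊓ H ≤ H'`, then the coset graph
of `⟨H', K'⟩` covers that of `⟨H, K⟩`. -/
theorem isCoverOf_joinCosetGraph {H K H' K' : Subgroup P} (hH : H' ≤ H) (hK : K' ≤ K)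
    (h1 : ∀ h ∈ H, ∃ a ∈ H', a⁻¹ * h ∈ K) (h2 : ∀ k ∈ K, ∃ a ∈ K', a⁻¹ * k ∈ H)
    (h3 : H' ⊓ K ≤ K') (h4 : K' ⊓ H ≤ H') :
    IsCoverOf (joinCosetGraph H' K') (joinCosetGraph H K) := by
  have hle : H' ⊔ K' ≤ H ⊔ K := sup_le_sup hH hK
  have key : ∀ g ∈ H ⊔ K, ∃ a ∈ H' ⊔ K', a⁻¹ * g ∈ H ⊓ K := by
    have step : ∀ x y : P, y ∈ (H : Set P) ∪ K → (∃ a ∈ H' ⊔ K', a⁻¹ * x ∈ H ⊓ K) →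
        ∃ a ∈ H' ⊔ K', a⁻¹ * (x * y) ∈ H ⊓ K := by
      rintro x y (hy | hy) ⟨a, ha, hax⟩
      · obtain ⟨b, hb, hby⟩ := h1 _ (mul_mem hax.1 hy)
        have := mul_mem (inv_mem (hH hb)) (mul_mem hax.1 hy)
        exact ⟨a * b, mul_mem ha (Subgroup.mem_sup_left hb),
          by simpa [mul_assoc] using this, by simpa [mul_assoc] using hby⟩
      · obtain ⟨b, hb, hby⟩ := h2 _ (mul_mem hax.2 hy)
        have := mul_mem (inv_mem (hK hb)) (mul_mem hax.2 hy)
        exact ⟨a * b, mul_mem ha (Subgroup.mem_sup_right hb),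
          by simpa [mul_assoc] using hby, by simpa [mul_assoc] using this⟩
    intro g hg
    rw [Subgroup.sup_eq_closure] at hg
    induction hg using Subgroup.closure_induction_right with
    | one => exact ⟨1, one_mem _, by simp⟩
    | mul_right x hx y hy ih => exact step x y hy ih
    | mul_inv_cancel x hx y hy ih =>
      exact step x _ (hy.imp (fun h => inv_mem h) fun h => inv_mem h) ih
  let ι : ↥(H' ⊔ K') →* ↥(H ⊔ K) := Subgroup.inclusion hle
  let πH : ↥(H' ⊔ K') ⧸ H'.subgroupOf (H' ⊔ K') → ↥(H ⊔ K) ⧸ H.subgroupOf (H ⊔ K) :=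
    Quotient.map' ι fun a b h => by
      rw [QuotientGroup.leftRel_apply] at h ⊢
      exact hH h
  let πK : ↥(H' ⊔ K') ⧸ K'.subgroupOf (H' ⊔ K') → ↥(H ⊔ K) ⧸ K.subgroupOf (H ⊔ K) :=
    Quotient.map' ι fun a b h => by
      rw [QuotientGroup.leftRel_apply] at h ⊢
      exact hK h
  have eH : ∀ a : ↥(H' ⊔ K'), πH (a : _ ⧸ _) = ((ι a : ↥(H ⊔ K)) : _ ⧸ _) := fun a => rfl
  have eK : ∀ a : ↥(H' ⊔ K'), πK (a : _ ⧸ _) = ((ι a : ↥(H ⊔ K)) : _ ⧸ _) := fun a => rfl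
  refine ⟨⟨Sum.map πH πK, ?_⟩, ?_, ?_⟩
  · rintro (x | x) (y | y) h
    · exact h.elim
    · obtain ⟨a, rfl, rfl⟩ := h
      exact ⟨ι a, rfl, rfl⟩
    · obtain ⟨a, rfl, rfl⟩ := h
      exact ⟨ι a, rfl, rfl⟩
    · exact h.elim
  · rintro (x | x) <;> induction x using QuotientGroup.induction_on with | H x => ?_
    · obtain ⟨a, ha, hax⟩ := key x x.2
      exact ⟨Sum.inl ((⟨a, ha⟩ : ↥(H' ⊔ K')) : _ ⧸ _),
        congrArg Sum.inl ((eH _).trans (QuotientGroup.eq (a := ι ⟨a, ha⟩) (b := x) |>.2 hax.1))⟩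
    · obtain ⟨a, ha, hax⟩ := key x x.2
      exact ⟨Sum.inr ((⟨a, ha⟩ : ↥(H' ⊔ K')) : _ ⧸ _),
        congrArg Sum.inr ((eK _).trans (QuotientGroup.eq (a := ι ⟨a, ha⟩) (b := x) |>.2 hax.2))⟩
  · rintro (x | x) <;> induction x using QuotientGroup.induction_on with | H x => ?_
    · refine ⟨fun z hz => ?_, fun y hy z hz e => ?_, fun z hz => ?_⟩
      · obtain ⟨h, hh, rfl⟩ := cosetGraph_adj_inl.1 hz
        exact (cosetGraph_adj_inl (H := H.subgroupOf (H ⊔ K))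
          (K := K.subgroupOf (H ⊔ K)) (a := ι x)).2 ⟨ι h, hH hh, rfl⟩
      · obtain ⟨h, hh, rfl⟩ := cosetGraph_adj_inl.1 hy
        obtain ⟨k, hk, rfl⟩ := cosetGraph_adj_inl.1 hz
        have h5 : ((ι (x * h))⁻¹ * ι (x * k)) ∈ K.subgroupOf (H ⊔ K) :=
          QuotientGroup.eq.1 (Sum.inr_injective e)
        refine congrArg Sum.inr (QuotientGroup.eq.2 ?_)
        refine Subgroup.mem_subgroupOf.2 (h3 ⟨?_, h5⟩)
        have : ((h⁻¹ * k : ↥(H' ⊔ K')) : P) ∈ H' := mul_mem (inv_mem hh) hk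
        simpa [mul_assoc] using this
      · obtain ⟨h, hh, rfl⟩ := cosetGraph_adj_inl.1 hz
        obtain ⟨a, ha, hah⟩ := h1 h hh
        let y : ↥(H' ⊔ K') := ⟨a, Subgroup.mem_sup_left ha⟩
        refine ⟨Sum.inr (QuotientGroup.mk (x * y)),
          (cosetGraph_adj_inl (H := H'.subgroupOf (H' ⊔ K'))
            (K := K'.subgroupOf (H' ⊔ K')) (a := x)).2 ⟨y, ha, rfl⟩, ?_⟩
        refine congrArg Sum.inr (QuotientGroup.eq.2 (Subgroup.mem_subgroupOf.2 ?_))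
        simpa [ι, y, mul_assoc] using hah
    · refine ⟨fun z hz => ?_, fun y hy z hz e => ?_, fun z hz => ?_⟩
      · obtain ⟨h, hh, rfl⟩ := cosetGraph_adj_inr.1 hz
        exact (cosetGraph_adj_inr (H := H.subgroupOf (H ⊔ K))
          (K := K.subgroupOf (H ⊔ K)) (a := ι x)).2 ⟨ι h, hK hh, rfl⟩
      · obtain ⟨h, hh, rfl⟩ := cosetGraph_adj_inr.1 hy
        obtain ⟨k, hk, rfl⟩ := cosetGraph_adj_inr.1 hz
        have h5 : ((ι (x * h))⁻¹ * ι (x * k)) ∈ H.subgroupOf (H ⊔ K) :=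
          QuotientGroup.eq.1 (Sum.inl_injective e)
        refine congrArg Sum.inl (QuotientGroup.eq.2 ?_)
        refine Subgroup.mem_subgroupOf.2 (h4 ⟨?_, h5⟩)
        have : ((h⁻¹ * k : ↥(H' ⊔ K')) : P) ∈ K' := mul_mem (inv_mem hh) hk
        simpa [mul_assoc] using this
      · obtain ⟨h, hh, rfl⟩ := cosetGraph_adj_inr.1 hz
        obtain ⟨a, ha, hah⟩ := h2 h hh
        let y : ↥(H' ⊔ K') := ⟨a, Subgroup.mem_sup_right ha⟩
        refine ⟨Sum.inl (QuotientGroup.mk (x * y)),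
          (cosetGraph_adj_inr (H := H'.subgroupOf (H' ⊔ K'))
            (K := K'.subgroupOf (H' ⊔ K')) (a := x)).2 ⟨y, ha, rfl⟩, ?_⟩
        refine congrArg Sum.inl (QuotientGroup.eq.2 (Subgroup.mem_subgroupOf.2 ?_))
        simpa [ι, y, mul_assoc] using hah

end Cover

/-! ### The permutations of `F³` as semilinear maps -/

theorem three_eq_zero {F : Type*} [Field F] [CharP F 3] : (3 : F) = 0 :=
  mod_cast CharP.cast_eq_zero F 3

theorem two_ne_zero_of_char_three {F : Type*} [Field F] [CharP F 3] : (2 : F) ≠ 0 := fun h =>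
  one_ne_zero (α := F) (by linear_combination three_eq_zero (F := F) - h)

section Field

variable (F : Type*) [Field F] [Finite F] [CharP F 3]

theorem three_dvd_card : 3 ∣ Nat.card F := by
  have := Fintype.ofFinite F
  rw [Nat.card_eq_fintype_card, ← CharP.cast_eq_zero_iff F 3, Nat.cast_card_eq_zero]

theorem three_not_dvd_card_units : ¬ 3 ∣ Nat.card Fˣ := by
  have := Fintype.ofFinite F
  have h := three_dvd_card F
  rw [Nat.card_units]
  have : 0 < Nat.card F := Nat.card_pos
  omega

variable {F}

theorem pow_eps_cube (x : F) : (x ^ (Nat.card F / 3)) ^ 3 = x := by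
  have := Fintype.ofFinite F
  rw [← pow_mul, Nat.div_mul_cancel (three_dvd_card F), Nat.card_eq_fintype_card,
    FiniteField.pow_card]

theorem cube_pow_eps (x : F) : (x ^ 3) ^ (Nat.card F / 3) = x := by
  rw [← pow_mul, mul_comm, pow_mul, pow_eps_cube]

theorem cube_injective : Function.Injective fun x : F => x ^ 3 := fun x y h => by
  rw [← cube_pow_eps x, ← cube_pow_eps y]
  exact congrArg (· ^ (Nat.card F / 3)) h

theorem add_pow_eps (x y : F) :
    (x + y) ^ (Nat.card F / 3) = x ^ (Nat.card F / 3) + y ^ (Nat.card F / 3) := by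
  apply cube_injective
  have : Fact (Nat.Prime 3) := ⟨Nat.prime_three⟩
  simp only [add_pow_char, pow_eps_cube]

theorem eps_ne_zero : Nat.card F / 3 ≠ 0 := by
  have h := three_dvd_card F
  have : 0 < Nat.card F := Nat.card_pos
  omega

theorem neg_pow_eps (x : F) : (-x) ^ (Nat.card F / 3) = -x ^ (Nat.card F / 3) := by
  have h := add_pow_eps x (-x)
  rw [add_neg_cancel, zero_pow eps_ne_zero] at h
  linear_combination -h

theorem eq_one_of_pow_three_pow {x : F} {k : ℕ} (h : x ^ 3 ^ k = 1) : x = 1 := by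
  induction k with
  | zero => simpa using h
  | succ k ih =>
    rw [pow_succ, pow_mul] at h
    exact ih (cube_injective (by simpa using h))

theorem units_pow_eps_cube (x : Fˣ) : (x ^ (Nat.card F / 3)) ^ 3 = x :=
  Units.ext (by push_cast; exact pow_eps_cube _)

theorem units_cube_pow_eps (x : Fˣ) : (x ^ 3) ^ (Nat.card F / 3) = x :=
  Units.ext (by push_cast; exact cube_pow_eps _)

variable (F) in
/-- The field automorphisms are the powers of the Frobenius automorphism. -/
theorem exists_frobenius_pow (θ : F ≃+* F) : ∃ n : ℕ, θ = (frobeniusEquiv F 3) ^ n := by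
  have : Fact (Nat.Prime 3) := ⟨Nat.prime_three⟩
  let _ : Algebra (ZMod 3) F := ZMod.algebra F 3
  let f : F ≃ₐ[ZMod 3] F := AlgEquiv.ofRingEquiv (f := θ) fun r => by
    have h : (θ : F →+* F).comp (algebraMap (ZMod 3) F) = algebraMap (ZMod 3) F :=
      Subsingleton.elim _ _
    exact congrArg (fun g : ZMod 3 →+* F => g r) h
  obtain ⟨n, hn⟩ := (FiniteField.bijective_frobeniusAlgEquivOfAlgebraic_pow (ZMod 3) F).2 f
  refine ⟨n, RingEquiv.ext fun x => ?_⟩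
  have h1 : f x = (FiniteField.frobeniusAlgEquivOfAlgebraic (ZMod 3) F ^ n.1) x := by rw [← hn]
  have h2 : ∀ (m : ℕ) (x : F), (FiniteField.frobeniusAlgEquivOfAlgebraic (ZMod 3) F ^ m) x =
      ((frobeniusEquiv F 3) ^ m) x := by
    intro m
    induction m with
    | zero => intro x; rfl
    | succ m ih =>
      intro x
      rw [pow_succ, pow_succ, AlgEquiv.mul_apply, RingAut.mul_apply, ih]
      congr 1
  exact h1.trans (h2 _ x)

theorem frobeniusEquiv_pow_apply (n : ℕ) (x : F) :
    ((frobeniusEquiv F 3 : F ≃+* F) ^ n) x = x ^ 3 ^ n := by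
  induction n generalizing x with
  | zero => simp
  | succ n ih =>
    rw [pow_succ, RingAut.mul_apply, ih, frobeniusEquiv_apply, frobenius_def, ← pow_mul,
      pow_succ' 3]

end Field

section Perms

variable {F : Type*} [Field F]

/-- The semilinear map `x ↦ k θ(x)` of `F`. -/
def semi (k : Fˣ) (θ : F ≃+* F) : Equiv.Perm F where
  toFun x := k * θ x
  invFun x := θ.symm ((k⁻¹ : Fˣ) * x)
  left_inv x := by simp
  right_inv x := by simp

@[simp] theorem semi_apply (k : Fˣ) (θ : F ≃+* F) (x : F) : semi k θ x = k * θ x := rfl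

/-- The linear map of `F³` acting as `M` on the first two coordinates and as `det(M) ^ (2ε)` on
the third. -/
noncomputable def lin : GLn F 2 →* Equiv.Perm (Om F) :=
  MonoidHom.toHomPerm
    { toFun := fun M x => (M 0 0 * x.1 + M 0 1 * x.2.1, M 1 0 * x.1 + M 1 1 * x.2.1,
        M.val.det ^ (2 * (Nat.card F / 3)) * x.2.2)
      map_one' := by
        funext x
        simp
        rfl
      map_mul' := fun M N => by
        funext x
        simp only [Matrix.GeneralLinearGroup.coe_mul, Matrix.mul_apply, Fin.sum_univ_two,
          Matrix.det_mul, mul_pow]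
        refine Prod.ext ?_ (Prod.ext ?_ ?_)
        · change _ = M 0 0 * _ + M 0 1 * _
          ring
        · change _ = M 1 0 * _ + M 1 1 * _
          ring
        · exact mul_assoc _ _ _ }

/-- A field automorphism acting on the three coordinates. -/
def fr : (F ≃+* F) →* Equiv.Perm (Om F) :=
  MonoidHom.toHomPerm
    { toFun := fun θ x => (θ x.1, θ x.2.1, θ x.2.2)
      map_one' := rfl
      map_mul' := fun _ _ => rfl }

/-- The upper triangular matrix `(l, e; 0, m)`. -/
def ut (l : Fˣ) (e : F) (m : Fˣ) : GLn F 2 :=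
  Matrix.GeneralLinearGroup.mkOfDetNeZero !![(l : F), e; 0, m] (by simp)

/-- The matrix `(0, 1; -1, 0)`. -/
def wy : GLn F 2 := Matrix.GeneralLinearGroup.mkOfDetNeZero !![(0 : F), 1; -1, 0] (by simp)

@[simp] theorem coe_ut (l : Fˣ) (e : F) (m : Fˣ) : (ut l e m).val = !![(l : F), e; 0, m] := rfl
@[simp] theorem coe_wy : (wy : GLn F 2).val = !![(0 : F), 1; -1, 0] := rfl

@[simp] theorem al_apply (u v w a b c : F) : al u v w (a, b, c) = (a + u, b + v, c + w) := rfl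

@[simp] theorem al_inv (u v w : F) : (al u v w)⁻¹ = al (-u) (-v) (-w) := by
  rw [inv_eq_iff_mul_eq_one]
  ext ⟨a, b, c⟩ <;> simp

theorem al_mul (u v w u' v' w' : F) :
    al u v w * al u' v' w' = al (u + u') (v + v') (w + w') := by
  ext ⟨a, b, c⟩ <;> simp <;> ring

theorem al_zero : al (0 : F) 0 0 = 1 := by ext ⟨a, b, c⟩ <;> simp

@[simp] theorem lin_apply (M : GLn F 2) (a b c : F) : lin M (a, b, c) =
    (M.val 0 0 * a + M.val 0 1 * b, M.val 1 0 * a + M.val 1 1 * b,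
      (M.val 0 0 * M.val 1 1 - M.val 0 1 * M.val 1 0) ^ (2 * (Nat.card F / 3)) * c) := by
  rw [← Matrix.det_fin_two]; rfl

@[simp] theorem fr_apply (θ : F ≃+* F) (a b c : F) : fr θ (a, b, c) = (θ a, θ b, θ c) := rfl

@[simp] theorem ga_apply (e a b c : F) : ga e (a, b, c) = (a + e * b, b, c) := rfl

@[simp] theorem ta_apply (t a b c : F) :
    ta t (a, b, c) = (a + (t * b ^ 2 + t ^ (Nat.card F / 3) * c), b, c) := rfl

theorem lin_ut (l m : Fˣ) : lin (ut l 0 m) = be l m := by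
  ext ⟨a, b, c⟩
  · simp [be]
  · simp [be]
  · simp [be]

theorem lin_ga (e : F) : lin (ut 1 e 1) = ga e := by
  ext ⟨a, b, c⟩ <;> simp [ga]

theorem lin_wy : lin wy = de F := by
  ext ⟨a, b, c⟩ <;> simp [de]

theorem ut_mul (l l' : Fˣ) (e e' : F) (m m' : Fˣ) :
    ut l e m * ut l' e' m' = ut (l * l') (l * e' + e * m') (m * m') := by
  ext i j
  fin_cases i <;> fin_cases j <;> simp [Matrix.mul_apply, Fin.sum_univ_two]

theorem eq_ut {M : GLn F 2} (h : M.val 1 0 = 0) : ∃ l e m, M = ut l e m := by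
  have hd : M.val.det ≠ 0 := M.det_ne_zero
  rw [Matrix.det_fin_two, h, mul_zero, sub_zero, mul_ne_zero_iff] at hd
  refine ⟨Units.mk0 _ hd.1, M.val 0 1, Units.mk0 _ hd.2, ?_⟩
  ext i j
  fin_cases i <;> fin_cases j <;> simp [h]

theorem lin_mul_al (M : GLn F 2) (u v w : F) : lin M * al u v w =
    al (M.val 0 0 * u + M.val 0 1 * v) (M.val 1 0 * u + M.val 1 1 * v)
      (M.val.det ^ (2 * (Nat.card F / 3)) * w) * lin M := by
  ext ⟨a, b, c⟩ <;> simp [Matrix.det_fin_two] <;> ring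

/-- Field automorphisms act on `GL_n(F)` entrywise. -/
abbrev frGL (θ : F ≃+* F) : GLn F 2 →* GLn F 2 := Matrix.GeneralLinearGroup.map (θ : F →+* F)

theorem fr_mul_al (θ : F ≃+* F) (u v w : F) :
    fr θ * al u v w = al (θ u) (θ v) (θ w) * fr θ := by
  ext ⟨a, b, c⟩ <;> simp

theorem fr_mul_lin (θ : F ≃+* F) (M : GLn F 2) : fr θ * lin M = lin (frGL θ M) * fr θ := by
  ext ⟨a, b, c⟩ <;> simp [Matrix.GeneralLinearGroup.map_apply]

theorem fr_mul_ta (θ : F ≃+* F) (t : F) : fr θ * ta t = ta (θ t) * fr θ := by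
  ext ⟨a, b, c⟩ <;> simp

theorem ga_mul_ta (e t : F) : ga e * ta t = ta t * ga e := by
  ext ⟨a, b, c⟩ <;> simp; ring

theorem ta_mul_al (t u v w : F) : ta t * al u v w =
    al (u + t * v ^ 2 + t ^ (Nat.card F / 3) * w) v w * ga (2 * t * v) * ta t := by
  ext ⟨a, b, c⟩ <;> simp; ring

variable [Finite F] [CharP F 3]

theorem ta_zero : ta (0 : F) = 1 := by
  ext ⟨a, b, c⟩ <;> simp [zero_pow eps_ne_zero]

theorem ta_mul (s t : F) : ta s * ta t = ta (s + t) := by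
  ext ⟨a, b, c⟩ <;> simp [add_pow_eps]; ring

theorem ta_inv (t : F) : (ta t)⁻¹ = ta (-t) := by
  rw [inv_eq_iff_mul_eq_one, ta_mul, add_neg_cancel, ta_zero]

theorem lin_mul_ta {M : GLn F 2} (h : M.val 1 0 = 0) {s t : F}
    (hs : M.val 0 0 * t = s * M.val 1 1 ^ 2) : lin M * ta t = ta s * lin M := by
  have h1 : M.val 0 0 * t ^ (Nat.card F / 3) = s ^ (Nat.card F / 3) *
      (M.val 0 0 * M.val 1 1) ^ (2 * (Nat.card F / 3)) := by
    rw [pow_mul, ← mul_pow, show s * (M.val 0 0 * M.val 1 1) ^ 2 = M.val 0 0 ^ 3 * t by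
      linear_combination -(M.val 0 0) ^ 2 * hs, mul_pow, cube_pow_eps]
  ext ⟨a, b, c⟩
  · simp [h]
    linear_combination b ^ 2 * hs + c * h1
  · simp [h]
  · simp [h]

end Perms

/-! ### Normal forms for the two vertex groups -/

theorem inv_mem_of_finite {G : Type*} [Group G] [Finite G] (S : Submonoid G) {x : G}
    (hx : x ∈ S) : x⁻¹ ∈ S := by
  have h : x⁻¹ ∈ Submonoid.powers x := by
    rw [mem_powers_iff_mem_zpowers]
    exact inv_mem (Subgroup.mem_zpowers x)
  exact (Submonoid.powers_le.2 hx) h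

section SpecialLinear

variable {F : Type*} [Field F]

theorem wy_ut_wy (e : F) : (wy * ut 1 e 1 * wy⁻¹ : GLn F 2).val = !![(1 : F), 0; -e, 1] := by
  have h : (wy⁻¹ : GLn F 2) = Matrix.GeneralLinearGroup.mkOfDetNeZero !![(0 : F), -1; 1, 0]
      (by simp) := by
    rw [inv_eq_iff_mul_eq_one]
    ext i j
    fin_cases i <;> fin_cases j <;>
      simp [Matrix.mul_apply, Fin.sum_univ_two, Matrix.GeneralLinearGroup.mkOfDetNeZero]
  rw [h]
  ext i j
  fin_cases i <;> fin_cases j <;>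
    simp [Matrix.mul_apply, Fin.sum_univ_two, Matrix.GeneralLinearGroup.mkOfDetNeZero]

/-- The upper and the lower transvections generate `SL₂(F)`. -/
theorem mem_of_det_eq_one {K : Subgroup (GLn F 2)} (h1 : ∀ e, ut 1 e 1 ∈ K)
    (h2 : ∀ e, wy * ut 1 e 1 * wy⁻¹ ∈ K) {N : GLn F 2} (hN : N.val.det = 1) : N ∈ K := by
  have key : ∀ N : GLn F 2, N.val.det = 1 → N.val 1 0 ≠ 0 → N ∈ K := by
    intro N hd hc
    rw [Matrix.det_fin_two] at hd
    have : N = ut 1 ((N.val 0 0 - 1) / N.val 1 0) 1 * (wy * ut 1 (-N.val 1 0) 1 * wy⁻¹) *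
        ut 1 ((N.val 1 1 - 1) / N.val 1 0) 1 := by
      apply Units.ext
      rw [Units.val_mul, Units.val_mul, wy_ut_wy]
      ext i j
      fin_cases i <;> fin_cases j <;>
        simp [Matrix.mul_apply, Fin.sum_univ_two] <;> field_simp
      · ring
      · linear_combination -hd
      · ring
    rw [this]
    exact mul_mem (mul_mem (h1 _) (h2 _)) (h1 _)
  by_cases hc : N.val 1 0 = 0
  · have h3 : (wy * ut 1 (-1) 1 * wy⁻¹) * N ∈ K := by
      apply key
      · rw [Units.val_mul, wy_ut_wy, Matrix.det_mul, hN, Matrix.det_fin_two]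
        simp
      · rw [Units.val_mul, wy_ut_wy]
        rw [Matrix.det_fin_two, hc] at hN
        simp only [Matrix.mul_apply, Fin.sum_univ_two]
        simp [hc]
        rintro h
        simp [h] at hN
    exact (Subgroup.mul_mem_cancel_left _ (h2 _)).1 h3
  · exact key N hN hc

end SpecialLinear

section NormalForms

variable {F : Type*} [Field F]

theorem semi_mul (k k' : Fˣ) (θ θ' : F ≃+* F) :
    semi k θ * semi k' θ' = semi (k * Units.map (θ : F →* F) k') (θ * θ') := by
  ext x
  simp [mul_assoc]

theorem semi_one : semi 1 1 = (1 : Equiv.Perm F) := by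
  ext x
  simp

theorem semi_injective {k k' : Fˣ} {θ θ' : F ≃+* F} (h : semi k θ = semi k' θ') :
    k = k' ∧ θ = θ' := by
  have h1 : k = k' := Units.ext (by simpa using congrArg (fun g : Equiv.Perm F => g 1) h)
  refine ⟨h1, RingEquiv.ext fun x => ?_⟩
  have := congrArg (fun g : Equiv.Perm F => g x) h
  simpa [h1] using this

theorem exists_semi {g : Equiv.Perm F} (h : g ∈ AGammaL1 F) (h0 : g 0 = 0) :
    ∃ k θ, g = semi k θ := by
  obtain ⟨k, θ, b, hg⟩ := h
  have hb : b = 0 := by simpa [h0] using (hg 0).symm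
  exact ⟨k, θ, Equiv.ext fun x => by simp [hg, hb]⟩

theorem semi_mem_AGammaL1 (k : Fˣ) (θ : F ≃+* F) : semi k θ ∈ AGammaL1 F :=
  ⟨k, θ, 0, fun x => by simp⟩

/-- The cube root `det(M) ^ ε` of the determinant. -/
noncomputable def kap : GLn F 2 →* Fˣ :=
  (powMonoidHom (Nat.card F / 3)).comp Matrix.GeneralLinearGroup.det

theorem kap_eq_of_det_eq {M N : GLn F 2} (h : M.val.det = N.val.det) : kap M = kap N := by
  have : Matrix.GeneralLinearGroup.det M = Matrix.GeneralLinearGroup.det N := Units.ext h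
  simp [kap, this]

theorem kap_frGL (θ : F ≃+* F) (M : GLn F 2) :
    kap (frGL θ M) = Units.map (θ : F →* F) (kap M) := by
  ext
  simp [kap, Matrix.det_fin_two]

theorem frGL_val (θ : F ≃+* F) (M : GLn F 2) (i j : Fin 2) :
    (frGL θ M).val i j = θ (M.val i j) := rfl

theorem kap_one_of_det {M : GLn F 2} (h : M.val.det = 1) : kap M = 1 := by
  rw [← map_one kap]
  exact kap_eq_of_det_eq (by simpa using h)

theorem val_det_mul (M N : GLn F 2) : (M * N).val.det = M.val.det * N.val.det := by
  rw [Units.val_mul, Matrix.det_mul]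

theorem mul_val_one_zero (M N : GLn F 2) : (M * N).val 1 0 =
    M.val 1 0 * N.val 0 0 + M.val 1 1 * N.val 1 0 := by
  simp [Matrix.mul_apply, Fin.sum_univ_two]

theorem conj_ga (k : Fˣ) (θ : F ≃+* F) (e : F) :
    lin (ut (k ^ 2) 0 k) * fr θ * ga e * (lin (ut (k ^ 2) 0 k) * fr θ)⁻¹ =
      ga (semi k θ e) := by
  rw [mul_inv_eq_iff_eq_mul]
  ext ⟨a, b, c⟩ <;> simp
  ring

theorem ga_injective : Function.Injective (ga : F → Equiv.Perm (Om F)) := fun e e' h => by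
  simpa using congrArg (fun g : Equiv.Perm (Om F) => g (0, 1, 0)) h

/-- The condition on the semilinear part of an element of `G₁(Ĵ)` or `G₂(Ĵ)`. -/
def InJ (Jh : Subgroup (Equiv.Perm F)) (M : GLn F 2) (θ : F ≃+* F) : Prop :=
  semi (kap M) θ ∈ Jh

variable {Jh : Subgroup (Equiv.Perm F)}

theorem InJ.mul {M M' : GLn F 2} {θ θ' : F ≃+* F} (h : InJ Jh M θ) (h' : InJ Jh M' θ') :
    InJ Jh (M * frGL θ M') (θ * θ') := by
  have := mul_mem h h'
  rwa [semi_mul, ← kap_frGL, ← map_mul] at this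

theorem inJ_of_det {M : GLn F 2} (h : M.val.det = 1) : InJ Jh M 1 := by
  rw [InJ, kap_one_of_det h, semi_one]
  exact one_mem _

theorem InJ.of_det_eq {M N : GLn F 2} {θ : F ≃+* F} (hM : InJ Jh M θ)
    (h : N.val.det = M.val.det) : InJ Jh N θ := by
  rwa [InJ, kap_eq_of_det_eq h]

theorem lin_fr_mul (M M' : GLn F 2) (θ θ' : F ≃+* F) :
    lin M * fr θ * (lin M' * fr θ') = lin (M * frGL θ M') * fr (θ * θ') := by
  rw [mul_assoc, ← mul_assoc (fr θ), fr_mul_lin, map_mul, map_mul]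
  simp only [mul_assoc]

theorem lin_fr_mul_al (M : GLn F 2) (θ : F ≃+* F) (u v w : F) :
    ∃ u' v' w', lin M * fr θ * al u v w = al u' v' w' * (lin M * fr θ) := by
  rw [mul_assoc, fr_mul_al, ← mul_assoc, lin_mul_al, mul_assoc]
  exact ⟨_, _, _, rfl⟩

theorem grpA_eq : grpA F = grpV F ⊔ grpF F := by
  apply le_antisymm
  · refine (Subgroup.closure_le _).2 ?_
    rintro _ ⟨u, v, w, rfl⟩
    have h1 : al u v w = al u v 0 * al 0 0 w := by rw [al_mul]; simp
    rw [h1]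
    exact mul_mem (Subgroup.mem_sup_left (Subgroup.subset_closure ⟨u, v, rfl⟩))
      (Subgroup.mem_sup_right (Subgroup.subset_closure ⟨w, rfl⟩))
  · refine sup_le (Subgroup.closure_mono ?_) (Subgroup.closure_mono ?_)
    · rintro _ ⟨u, v, rfl⟩
      exact ⟨u, v, 0, rfl⟩
    · rintro _ ⟨w, rfl⟩
      exact ⟨0, 0, w, rfl⟩

variable [Finite F] [CharP F 3]

theorem kap_cube (M : GLn F 2) : kap M ^ 3 = Matrix.GeneralLinearGroup.det M :=
  units_pow_eps_cube _

theorem kap_ut_sq (k : Fˣ) : kap (ut (k ^ 2) 0 k) = k := by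
  have : Matrix.GeneralLinearGroup.det (ut (k ^ 2) 0 k) = k ^ 3 :=
    Units.ext (by simp [Matrix.det_fin_two]; ring)
  rw [kap, MonoidHom.comp_apply, this]
  exact units_cube_pow_eps k

/-- Every matrix is the product of a matrix of determinant 1 and a matrix `diag(k², k)`. -/
theorem exists_eq_mul_ut (M : GLn F 2) :
    ∃ N : GLn F 2, N.val.det = 1 ∧ M = N * ut (kap M ^ 2) 0 (kap M) := by
  refine ⟨M * (ut (kap M ^ 2) 0 (kap M))⁻¹, ?_, by simp⟩
  have h : Matrix.GeneralLinearGroup.det (ut (kap M ^ 2) 0 (kap M)) =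
      Matrix.GeneralLinearGroup.det M := by
    refine Eq.trans (Units.ext ?_) (kap_cube M)
    simp
    ring
  have : Matrix.GeneralLinearGroup.det (M * (ut (kap M ^ 2) 0 (kap M))⁻¹) = 1 := by
    rw [map_mul, map_inv, h, mul_inv_cancel]
  exact congrArg Units.val this

theorem fr_frobenius : fr (frobeniusEquiv F 3) = si F := rfl

theorem fr_mem_grpSigma (θ : F ≃+* F) : fr θ ∈ grpSigma F := by
  obtain ⟨n, rfl⟩ := exists_frobenius_pow F θ
  rw [map_pow]
  exact pow_mem (Subgroup.subset_closure (Set.mem_singleton _)) n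

/-- The subgroup `{lin diag(k², k) ∘ θ}` of `SΣ`. -/
theorem mem_grpS_sup_grpSigma {h : Equiv.Perm (Om F)} :
    h ∈ grpS F ⊔ grpSigma F ↔ ∃ k θ, h = lin (ut (k ^ 2) 0 k) * fr θ := by
  constructor
  · let S : Submonoid (Equiv.Perm (Om F)) :=
      { carrier := {h | ∃ k θ, h = lin (ut (k ^ 2) 0 k) * fr θ}
        one_mem' := ⟨1, 1, by rw [lin_ut]; ext ⟨a, b, c⟩ <;> simp [be]⟩
        mul_mem' := by
          rintro _ _ ⟨k, θ, rfl⟩ ⟨k', θ', rfl⟩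
          refine ⟨k * Units.map (θ : F →* F) k', θ * θ', ?_⟩
          have h1 : frGL θ (ut (k' ^ 2) 0 k') = ut (Units.map (θ : F →* F) k' ^ 2) 0
              (Units.map (θ : F →* F) k') := by
            ext i j
            rw [frGL_val]
            fin_cases i <;> fin_cases j <;> simp
          rw [mul_assoc, ← mul_assoc (fr θ), fr_mul_lin, h1, mul_assoc, ← mul_assoc, ← map_mul,
            ← map_mul, ut_mul, mul_zero, zero_mul, zero_add, mul_pow] }
    let S' : Subgroup (Equiv.Perm (Om F)) := { S with inv_mem' := inv_mem_of_finite S }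
    suffices grpS F ⊔ grpSigma F ≤ S' from fun hh => this hh
    refine sup_le ((Subgroup.closure_le _).2 ?_) ((Subgroup.closure_le _).2 ?_)
    · rintro _ ⟨m, rfl⟩
      exact ⟨m, 1, by rw [lin_ut, map_one, mul_one]⟩
    · rintro _ rfl
      refine ⟨1, frobeniusEquiv F 3, ?_⟩
      rw [fr_frobenius, lin_ut]
      ext ⟨a, b, c⟩ <;> simp [be]
  · rintro ⟨k, θ, rfl⟩
    refine mul_mem (Subgroup.mem_sup_left ?_) (Subgroup.mem_sup_right (fr_mem_grpSigma θ))
    rw [lin_ut]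
    exact Subgroup.subset_closure ⟨k, rfl⟩

theorem mem_grpJ {Jh : Subgroup (Equiv.Perm F)} {h : Equiv.Perm (Om F)} :
    h ∈ grpJ Jh ↔ ∃ k θ, semi k θ ∈ Jh ∧ h = lin (ut (k ^ 2) 0 k) * fr θ := by
  constructor
  · rintro ⟨h1, g, hg, h2⟩
    obtain ⟨k, θ, rfl⟩ := mem_grpS_sup_grpSigma.1 h1
    refine ⟨k, θ, ?_, rfl⟩
    rwa [show semi k θ = g from Equiv.ext fun e => ga_injective (by rw [← h2, conj_ga])]
  · rintro ⟨k, θ, hk, rfl⟩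
    exact ⟨mem_grpS_sup_grpSigma.2 ⟨k, θ, rfl⟩, _, hk, fun e => conj_ga k θ e⟩

theorem lin_fr_mul_ta {M : GLn F 2} (h : M.val 1 0 = 0) (θ : F ≃+* F) (t : F) :
    lin M * fr θ * ta t = ta (M.val 0 0 * θ t / M.val 1 1 ^ 2) * (lin M * fr θ) := by
  have h1 : M.val 1 1 ≠ 0 := by
    obtain ⟨l, e, m, rfl⟩ := eq_ut h
    simp
  rw [mul_assoc, fr_mul_ta, ← mul_assoc, lin_mul_ta h (t := θ t)
    (s := M.val 0 0 * θ t / M.val 1 1 ^ 2) (by field_simp), mul_assoc]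

/-- The normal form of the elements of `G₁(Ĵ)`: affine semilinear maps. -/
theorem mem_G1J {g : Equiv.Perm (Om F)} : g ∈ G1J Jh ↔
    ∃ u v w M θ, InJ Jh M θ ∧ g = al u v w * (lin M * fr θ) := by
  constructor
  · let S : Submonoid (Equiv.Perm (Om F)) :=
      { carrier := {g | ∃ u v w M θ, InJ Jh M θ ∧ g = al u v w * (lin M * fr θ)}
        one_mem' := ⟨0, 0, 0, 1, 1, inJ_of_det (by simp), by simp [al_zero]⟩
        mul_mem' := by
          rintro _ _ ⟨u, v, w, M, θ, hM, rfl⟩ ⟨u', v', w', M', θ', hM', rfl⟩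
          obtain ⟨x, y, z, h⟩ := lin_fr_mul_al M θ u' v' w'
          refine ⟨u + x, v + y, w + z, M * frGL θ M', θ * θ', hM.mul hM', ?_⟩
          rw [← al_mul, ← lin_fr_mul, mul_assoc, ← mul_assoc (lin M * fr θ), h]
          simp only [mul_assoc] }
    let S' : Subgroup (Equiv.Perm (Om F)) := { S with inv_mem' := inv_mem_of_finite S }
    have hlin : ∀ M : GLn F 2, M.val.det = 1 → lin M ∈ S' := fun M hM =>
      ⟨0, 0, 0, M, 1, inJ_of_det hM, by simp [al_zero]⟩
    have hal : ∀ u v w : F, al u v w ∈ S' := fun u v w =>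
      ⟨u, v, w, 1, 1, inJ_of_det (by simp), by simp⟩
    suffices G1J Jh ≤ S' from fun hh => this hh
    refine sup_le (sup_le (sup_le ?_ (sup_le (sup_le ?_ ?_) ?_)) ?_) ?_
    · refine (Subgroup.closure_le _).2 ?_
      rintro _ ⟨u, v, rfl⟩
      exact hal u v 0
    · refine (Subgroup.closure_le _).2 ?_
      rintro _ ⟨e, rfl⟩
      rw [← lin_ga]
      exact hlin _ (by simp)
    · refine (Subgroup.closure_le _).2 ?_
      rintro _ rfl
      rw [← lin_wy]
      exact hlin _ (by simp)
    · refine (Subgroup.closure_le _).2 ?_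
      rintro _ ⟨m, rfl⟩
      rw [← lin_ut]
      exact hlin _ (by simp)
    · refine (Subgroup.closure_le _).2 ?_
      rintro _ ⟨w, rfl⟩
      exact hal 0 0 w
    · rintro _ hh
      obtain ⟨k, θ, hk, rfl⟩ := mem_grpJ.1 hh
      exact ⟨0, 0, 0, _, θ, by rwa [InJ, kap_ut_sq], by simp [al_zero]⟩
  · rintro ⟨u, v, w, M, θ, hM, rfl⟩
    have hV : ∀ u v : F, al u v 0 ∈ G1J Jh := fun u v => Subgroup.mem_sup_left
      (Subgroup.mem_sup_left (Subgroup.mem_sup_left (Subgroup.subset_closure ⟨u, v, rfl⟩)))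
    have hF : ∀ w : F, al 0 0 w ∈ G1J Jh := fun w => Subgroup.mem_sup_left
      (Subgroup.mem_sup_right (Subgroup.subset_closure ⟨w, rfl⟩))
    have hM' : grpM F ≤ G1J Jh := le_sup_right.trans (le_sup_left.trans le_sup_left)
    have hC : ∀ e : F, ga e ∈ G1J Jh := fun e => hM' (Subgroup.mem_sup_left
      (Subgroup.mem_sup_left (Subgroup.subset_closure ⟨e, rfl⟩)))
    have hD : de F ∈ G1J Jh := hM' (Subgroup.mem_sup_left
      (Subgroup.mem_sup_right (Subgroup.subset_closure rfl)))
    have hS : ∀ N : GLn F 2, N.val.det = 1 → lin N ∈ G1J Jh := fun N hN => by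
      refine mem_of_det_eq_one (K := (G1J Jh).comap lin) (fun e => ?_) (fun e => ?_) hN
      · rw [Subgroup.mem_comap, lin_ga]
        exact hC e
      · rw [Subgroup.mem_comap, map_mul, map_mul, map_inv, lin_ga, lin_wy]
        exact mul_mem (mul_mem hD (hC e)) (inv_mem hD)
    obtain ⟨N, hN, e⟩ := exists_eq_mul_ut M
    have h1 : al u v w = al u v 0 * al 0 0 w := by rw [al_mul]; simp
    rw [h1, e, map_mul, mul_assoc (lin N)]
    exact mul_mem (mul_mem (hV u v) (hF w)) (mul_mem (hS N hN)
      (Subgroup.mem_sup_right (mem_grpJ.2 ⟨_, _, hM, rfl⟩)))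

/-- The normal form of the elements of `G₂(Ĵ)`; the set of all products of this form is closed under
multiplication because `ta t` normalizes the translations modulo the maps `ga e`. -/
theorem mem_G2J {g : Equiv.Perm (Om F)} : g ∈ G2J Jh ↔
    ∃ u v w t M θ, M.val 1 0 = 0 ∧ InJ Jh M θ ∧ g = al u v w * ta t * (lin M * fr θ) := by
  constructor
  · let S : Set (Equiv.Perm (Om F)) :=
      {g | ∃ u v w t M θ, M.val 1 0 = 0 ∧ InJ Jh M θ ∧ g = al u v w * ta t * (lin M * fr θ)}
    have hal : ∀ u v w, ∀ g ∈ S, al u v w * g ∈ S := by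
      rintro u v w _ ⟨u', v', w', t, M, θ, h, hM, rfl⟩
      exact ⟨u + u', v + v', w + w', t, M, θ, h, hM, by rw [← al_mul]; simp only [mul_assoc]⟩
    have hta : ∀ t, ∀ g ∈ S, ta t * g ∈ S := by
      rintro t _ ⟨u, v, w, s, M, θ, h, hM, rfl⟩
      refine ⟨u + t * v ^ 2 + t ^ (Nat.card F / 3) * w, v, w, t + s, ut 1 (2 * t * v) 1 * M, θ,
        by simp [mul_val_one_zero, h], hM.of_det_eq (by rw [val_det_mul]; simp), ?_⟩
      calc ta t * (al u v w * ta s * (lin M * fr θ))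
          = ta t * al u v w * ta s * (lin M * fr θ) := by simp only [mul_assoc]
        _ = al (u + t * v ^ 2 + t ^ (Nat.card F / 3) * w) v w * (ga (2 * t * v) * (ta t * ta s)) *
            (lin M * fr θ) := by rw [ta_mul_al]; simp only [mul_assoc]
        _ = _ := by rw [ta_mul, ga_mul_ta, map_mul, lin_ga]; simp only [mul_assoc]
    have hlf : ∀ (M : GLn F 2) (θ : F ≃+* F), M.val 1 0 = 0 → InJ Jh M θ →
        ∀ g ∈ S, lin M * fr θ * g ∈ S := by
      rintro M θ h hM _ ⟨u, v, w, t, M', θ', h', hM', rfl⟩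
      obtain ⟨x, y, z, e⟩ := lin_fr_mul_al M θ u v w
      refine ⟨x, y, z, M.val 0 0 * θ t / M.val 1 1 ^ 2, M * frGL θ M', θ * θ',
        by rw [mul_val_one_zero, frGL_val, frGL_val, h, h', map_zero]; ring, hM.mul hM', ?_⟩
      calc lin M * fr θ * (al u v w * ta t * (lin M' * fr θ'))
          = lin M * fr θ * al u v w * ta t * (lin M' * fr θ') := by simp only [mul_assoc]
        _ = al x y z * (lin M * fr θ * ta t) * (lin M' * fr θ') := by rw [e]; simp only [mul_assoc]
        _ = _ := by rw [lin_fr_mul_ta h, ← lin_fr_mul]; simp only [mul_assoc]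
    let S' : Submonoid (Equiv.Perm (Om F)) :=
      { carrier := S
        one_mem' := ⟨0, 0, 0, 0, 1, 1, by simp, inJ_of_det (by simp), by simp [al_zero, ta_zero]⟩
        mul_mem' := by
          rintro _ g ⟨u, v, w, t, M, θ, h, hM, rfl⟩ hg
          rw [mul_assoc, mul_assoc]
          exact hal _ _ _ _ (hta _ _ (hlf _ _ h hM _ hg)) }
    let S'' : Subgroup (Equiv.Perm (Om F)) := { S' with inv_mem' := inv_mem_of_finite S' }
    have hlin : ∀ M : GLn F 2, M.val 1 0 = 0 → M.val.det = 1 → lin M ∈ S'' := fun M h hM =>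
      ⟨0, 0, 0, 0, M, 1, h, inJ_of_det hM, by simp [al_zero, ta_zero]⟩
    have hal' : ∀ u v w : F, al u v w ∈ S'' := fun u v w =>
      (mul_one (al u v w)) ▸ hal u v w 1 S'.one_mem
    suffices G2J Jh ≤ S'' from fun hh => this hh
    refine sup_le (sup_le (sup_le (sup_le (sup_le ?_ ?_) ?_) ?_) ?_) ?_
    · refine (Subgroup.closure_le _).2 ?_
      rintro _ ⟨u, v, rfl⟩
      exact hal' u v 0
    · refine (Subgroup.closure_le _).2 ?_
      rintro _ ⟨e, rfl⟩
      rw [← lin_ga]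
      exact hlin _ (by simp) (by simp)
    · refine (Subgroup.closure_le _).2 ?_
      rintro _ ⟨t, rfl⟩
      exact (mul_one (ta t)) ▸ hta t 1 S'.one_mem
    · refine (Subgroup.closure_le _).2 ?_
      rintro _ ⟨m, rfl⟩
      rw [← lin_ut]
      exact hlin _ (by simp) (by simp)
    · refine (Subgroup.closure_le _).2 ?_
      rintro _ ⟨w, rfl⟩
      exact hal' 0 0 w
    · rintro _ hh
      obtain ⟨k, θ, hk, rfl⟩ := mem_grpJ.1 hh
      exact ⟨0, 0, 0, 0, ut (k ^ 2) 0 k, θ, by simp, by rwa [InJ, kap_ut_sq],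
        by simp [al_zero, ta_zero]⟩
  · rintro ⟨u, v, w, t, M, θ, h, hM, rfl⟩
    have hK : K2 F ≤ G2J Jh := le_sup_left.trans le_sup_left
    have hV : ∀ u v : F, al u v 0 ∈ G2J Jh := fun u v => hK (Subgroup.mem_sup_left
      (Subgroup.mem_sup_left (Subgroup.mem_sup_left (Subgroup.subset_closure ⟨u, v, rfl⟩))))
    have hC : ∀ e : F, ga e ∈ G2J Jh := fun e => hK (Subgroup.mem_sup_left
      (Subgroup.mem_sup_left (Subgroup.mem_sup_right (Subgroup.subset_closure ⟨e, rfl⟩))))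
    have hE : ta t ∈ G2J Jh := hK (Subgroup.mem_sup_left
      (Subgroup.mem_sup_right (Subgroup.subset_closure ⟨t, rfl⟩)))
    have hT : ∀ m : Fˣ, be m m⁻¹ ∈ G2J Jh := fun m => hK
      (Subgroup.mem_sup_right (Subgroup.subset_closure ⟨m, rfl⟩))
    have hF : ∀ w : F, al 0 0 w ∈ G2J Jh := fun w => Subgroup.mem_sup_left
      (Subgroup.mem_sup_right (Subgroup.subset_closure ⟨w, rfl⟩))
    have hS : ∀ N : GLn F 2, N.val 1 0 = 0 → N.val.det = 1 → lin N ∈ G2J Jh := fun N h hN => by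
      obtain ⟨l, e, m, rfl⟩ := eq_ut h
      have hm : l * m = 1 := Units.ext (by simpa using hN)
      obtain rfl : m = l⁻¹ := eq_inv_of_mul_eq_one_right hm
      have : ut l e l⁻¹ = ut 1 (e * l) 1 * ut l 0 l⁻¹ := by
        rw [ut_mul]
        simp
      rw [this, map_mul, lin_ga, lin_ut]
      exact mul_mem (hC _) (hT _)
    obtain ⟨N, hN, e⟩ := exists_eq_mul_ut M
    have h1 : al u v w = al u v 0 * al 0 0 w := by rw [al_mul]; simp
    have h2 : N.val 1 0 = 0 := by
      rw [e, mul_val_one_zero] at h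
      simpa using h
    rw [h1, e, map_mul, mul_assoc (lin N)]
    exact mul_mem (mul_mem (mul_mem (hV u v) (hF w)) hE) (mul_mem (hS N h2 hN)
      (Subgroup.mem_sup_right (mem_grpJ.2 ⟨_, _, hM, rfl⟩)))

theorem grpJ_AGammaL1 : grpJ (AGammaL1 F) = grpS F ⊔ grpSigma F := by
  ext h
  rw [mem_grpJ, mem_grpS_sup_grpSigma]
  exact ⟨fun ⟨k, θ, _, h⟩ => ⟨k, θ, h⟩, fun ⟨k, θ, h⟩ => ⟨k, θ, semi_mem_AGammaL1 k θ, h⟩⟩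

theorem G1_eq : G1 F = G1J (AGammaL1 F) := by
  rw [G1, G1J, K1, grpJ_AGammaL1, grpA_eq]
  ac_rfl

theorem G2_eq : G2 F = G2J (AGammaL1 F) := by
  rw [G2, G2J, K2, grpQ, grpJ_AGammaL1, grpA_eq]
  ac_rfl

end NormalForms

/-! ### Arcs, neighbours and covers of the coset graphs -/

section Graph

variable {F : Type*} [Field F]

/-- The entry below the diagonal of the linear part of an element of `G₁(Ĵ)`. -/
def lowEntry (g : Equiv.Perm (Om F)) : F := (g (1, 0, 0)).2.1 - (g (0, 0, 0)).2.1

/-- A second difference: the coefficient of `b²` in the first coordinate of an element of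
`G₂(Ĵ)`. -/
def quadCoeff (g : Equiv.Perm (Om F)) : F :=
  (g (0, 0, 0)).1 + (g (0, 0, 0)).1 - (g (0, 1, 0)).1 - (g (0, -1, 0)).1

@[simp] theorem de_apply (a b c : F) : de F (a, b, c) = (b, -a, c) := rfl
@[simp] theorem de_symm_apply (a b c : F) : (de F).symm (a, b, c) = (-b, a, c) := rfl

theorem ga_inv (e : F) : (ga e)⁻¹ = ga (-e) := by
  rw [inv_eq_iff_mul_eq_one]
  ext ⟨a, b, c⟩ <;> simp

theorem quadCoeff_eq [CharP F 3] (u v w t : F) (M : GLn F 2) (θ : F ≃+* F) (h0 : M.val 1 0 = 0) :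
    quadCoeff (al u v w * ta t * (lin M * fr θ)) = t * M.val 1 1 ^ 2 := by
  simp [quadCoeff, h0]
  linear_combination -t * M.val 1 1 ^ 2 * three_eq_zero (F := F)

theorem exists_semi_apply_eq_one {Jh : Subgroup (Equiv.Perm F)}
    (hJh : IsTwoTransSub F Jh) {x : F} (hx : x ≠ 0) :
    ∃ k θ, semi k θ ∈ Jh ∧ k * θ x = 1 := by
  obtain ⟨hle, htr⟩ := hJh
  obtain ⟨g, h0, h1⟩ := MulAction.is_two_pretransitive_iff.1 htr hx.symm (zero_ne_one (α := F))
  obtain ⟨k, θ, e⟩ := exists_semi (hle g.2) h0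
  refine ⟨k, θ, e ▸ g.2, ?_⟩
  rw [← semi_apply, ← e]
  exact h1

variable [Finite F] [CharP F 3] {Jh : Subgroup (Equiv.Perm F)}

theorem al_mem_G1J (u v w : F) : al u v w ∈ G1J Jh :=
  mem_G1J.2 ⟨u, v, w, 1, 1, inJ_of_det (by simp), by simp⟩

theorem al_mem_G2J (u v w : F) : al u v w ∈ G2J Jh :=
  mem_G2J.2 ⟨u, v, w, 0, 1, 1, by simp, inJ_of_det (by simp), by simp [ta_zero]⟩

theorem lin_fr_mem_G1J {M : GLn F 2} {θ : F ≃+* F} (h : InJ Jh M θ) : lin M * fr θ ∈ G1J Jh :=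
  mem_G1J.2 ⟨0, 0, 0, M, θ, h, by simp [al_zero]⟩

theorem lin_fr_mem_G2J {M : GLn F 2} {θ : F ≃+* F} (h0 : M.val 1 0 = 0) (h : InJ Jh M θ) :
    lin M * fr θ ∈ G2J Jh :=
  mem_G2J.2 ⟨0, 0, 0, 0, M, θ, h0, h, by simp [al_zero, ta_zero]⟩

theorem lin_mem_G1J {M : GLn F 2} (h : InJ Jh M 1) : lin M ∈ G1J Jh := by
  simpa using lin_fr_mem_G1J h

theorem lin_mem_G2J {M : GLn F 2} (h0 : M.val 1 0 = 0) (h : InJ Jh M 1) : lin M ∈ G2J Jh := by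
  simpa using lin_fr_mem_G2J h0 h

theorem ga_mem_G1J (e : F) : ga e ∈ G1J Jh := by
  rw [← lin_ga]
  exact lin_mem_G1J (inJ_of_det (by simp))

theorem ga_mem_G2J (e : F) : ga e ∈ G2J Jh := by
  rw [← lin_ga]
  exact lin_mem_G2J (by simp) (inJ_of_det (by simp))

theorem de_mem_G1J : de F ∈ G1J Jh := by
  rw [← lin_wy]
  exact lin_mem_G1J (inJ_of_det (by simp))

theorem ta_mem_G2J (t : F) : ta t ∈ G2J Jh :=
  mem_G2J.2 ⟨0, 0, 0, t, 1, 1, by simp, inJ_of_det (by simp), by simp [al_zero]⟩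

theorem mem_G1J_inf_G2J {g : Equiv.Perm (Om F)} : g ∈ G1J Jh ⊓ G2J Jh ↔
    ∃ u v w M θ, M.val 1 0 = 0 ∧ InJ Jh M θ ∧ g = al u v w * (lin M * fr θ) := by
  constructor
  · rintro ⟨h1, h2⟩
    obtain ⟨u, v, w, M, θ, hM, e⟩ := mem_G1J.1 h1
    refine ⟨u, v, w, M, θ, ?_, hM, e⟩
    obtain ⟨u', v', w', t, M', θ', h0, -, rfl⟩ := mem_G2J.1 h2
    have := congrArg lowEntry e
    simpa [lowEntry, h0] using this.symm
  · rintro ⟨u, v, w, M, θ, h0, hM, rfl⟩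
    exact ⟨mul_mem (al_mem_G1J _ _ _) (lin_fr_mem_G1J hM),
      mul_mem (al_mem_G2J _ _ _) (lin_fr_mem_G2J h0 hM)⟩

theorem mem_G2J_iff_lowEntry {g : Equiv.Perm (Om F)} (hg : g ∈ G1J Jh) :
    g ∈ G2J Jh ↔ lowEntry g = 0 := by
  constructor
  · intro h
    obtain ⟨u, v, w, M, θ, h0, -, rfl⟩ := mem_G1J_inf_G2J.1 ⟨hg, h⟩
    simp [lowEntry, h0]
  · intro h
    obtain ⟨u, v, w, M, θ, hM, rfl⟩ := mem_G1J.1 hg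
    exact (mem_G1J_inf_G2J.2 ⟨u, v, w, M, θ, by simpa [lowEntry] using h, hM, rfl⟩).2

theorem mem_G1J_iff_quadCoeff {g : Equiv.Perm (Om F)} (hg : g ∈ G2J Jh) :
    g ∈ G1J Jh ↔ quadCoeff g = 0 := by
  constructor
  · intro h
    obtain ⟨u, v, w, M, θ, h0, -, rfl⟩ := mem_G1J_inf_G2J.1 ⟨h, hg⟩
    have := quadCoeff_eq u v w 0 M θ h0
    rwa [ta_zero, mul_one, zero_mul] at this
  · intro h
    obtain ⟨u, v, w, t, M, θ, h0, hM, rfl⟩ := mem_G2J.1 hg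
    rw [quadCoeff_eq _ _ _ _ _ _ h0] at h
    have h1 : M.val 1 1 ≠ 0 := by
      obtain ⟨l, e, m, rfl⟩ := eq_ut h0
      simp
    obtain rfl : t = 0 := by simpa [h1] using h
    exact (mem_G1J_inf_G2J.2 ⟨u, v, w, M, θ, h0, hM, by rw [ta_zero, mul_one]⟩).1

/-- The edge group `G₁(Ĵ) ⊓ G₂(Ĵ)` is transitive on the 5-arcs having the base edge in the middle: the
four outer vertices are moved by `C`, `T`, `J` and the translations in turn. -/
theorem movesToStandardArc (hJh : IsTwoTransSub F Jh) :
    MovesToStandardArc (G1J Jh) (G2J Jh) (de F) (ta 1) := by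
  have three := three_eq_zero (F := F)
  refine movesToStandardArc_of_steps de_mem_G1J (ta_mem_G2J 1) ?_ ?_ ?_ ?_
  -- a transvection moves any other point of the projective line to the one opposite to the fixed
  -- point
  · intro h hh hhK
    refine ⟨ga (-(((h (1, 0, 0)).1 - (h (0, 0, 0)).1) / lowEntry h)),
      ⟨ga_mem_G1J _, ga_mem_G2J _⟩, ?_⟩
    rw [mem_G2J_iff_lowEntry hh] at hhK
    rw [mem_G2J_iff_lowEntry (mul_mem (inv_mem de_mem_G1J) (mul_mem (ga_mem_G1J _) hh))]
    obtain ⟨u, v, w, M, θ, hM, rfl⟩ := mem_G1J.1 hh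
    simp [lowEntry] at hhK
    simp [lowEntry]
    field_simp
    ring
  · intro k hk hkH
    have hb0 : ∀ m : Fˣ, InJ Jh (ut m 0 m⁻¹) 1 := fun m => inJ_of_det (by simp)
    have hb : ∀ m : Fˣ, lin (ut m 0 m⁻¹) ∈ G1J Jh ⊓ G2J Jh := fun m =>
      ⟨lin_mem_G1J (hb0 m), lin_mem_G2J (by simp) (hb0 m)⟩
    rw [mem_G1J_iff_quadCoeff hk] at hkH
    obtain ⟨u, v, w, t, M, θ, h0, hM, rfl⟩ := mem_G2J.1 hk
    rw [quadCoeff_eq _ _ _ _ _ _ h0] at hkH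
    have ht : t ≠ 0 := left_ne_zero_of_mul hkH
    -- the torus element `diag(m, m⁻¹)` maps `τ_t` to `τ_{m³ t}`
    let m : Fˣ := Units.mk0 (t⁻¹ ^ (Nat.card F / 3)) (pow_ne_zero _ (inv_ne_zero ht))
    have hm : (m : F) ^ 3 * t = 1 := by
      simp only [m, Units.val_mk0, pow_eps_cube]
      exact inv_mul_cancel₀ ht
    refine ⟨lin (ut m 0 m⁻¹), hb m, ?_, ?_⟩
    · rw [mem_G2J_iff_lowEntry (mul_mem (mul_mem (inv_mem de_mem_G1J) (hb m).1) de_mem_G1J)]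
      simp [lowEntry]
    · rw [mem_G1J_iff_quadCoeff (mul_mem (inv_mem (ta_mem_G2J 1)) (mul_mem (hb m).2 hk))]
      rw [ta_inv]
      simp [quadCoeff, h0, neg_pow_eps]
      have hm0 : (m : F) ≠ 0 := m.ne_zero
      field_simp
      linear_combination (-2 * M.val 1 1 ^ 2) * hm
  · intro k hk hkH
    rw [mem_G1J_iff_quadCoeff hk] at hkH
    obtain ⟨u, v, w, t, M, θ, h0, hM, rfl⟩ := mem_G2J.1 hk
    rw [quadCoeff_eq _ _ _ _ _ _ h0] at hkH
    have ht : t ≠ 0 := left_ne_zero_of_mul hkH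
    -- an element of `J` commuting with `ta 1` is prescribed by its value at one point; this is where
    -- 2-transitivity of `Ĵ` is needed
    obtain ⟨c, φ, hc, hx⟩ := exists_semi_apply_eq_one hJh
      (x := (t ^ (Nat.card F / 3))⁻¹) (inv_ne_zero (pow_ne_zero _ ht))
    have ht' : φ t = c ^ 3 := by
      have h1 : φ (t ^ (Nat.card F / 3)) = c := by
        rw [map_inv₀] at hx
        exact (eq_of_mul_inv_eq_one hx).symm
      rw [← h1, ← map_pow, pow_eps_cube]
    have hb0 : InJ Jh (ut (c ^ 2) 0 c) φ := by rwa [InJ, kap_ut_sq]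
    have hb1 := lin_fr_mem_G1J hb0
    have hb2 := lin_fr_mem_G2J (by simp) hb0
    have hn : (de F)⁻¹ * (lin (ut (c ^ 2) 0 c) * fr φ) * de F ∈ G2J Jh := by
      rw [mem_G2J_iff_lowEntry (mul_mem (mul_mem (inv_mem de_mem_G1J) hb1) de_mem_G1J)]
      simp [lowEntry]
    refine ⟨lin (ut (c ^ 2) 0 c) * fr φ, ⟨hb1, hb2⟩, hn, ?_, ?_⟩
    · rw [mem_G1J_iff_quadCoeff (mul_mem (mul_mem (inv_mem (ta_mem_G2J 1)) hb2) (ta_mem_G2J 1)),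
        ta_inv]
      simp [quadCoeff, neg_pow_eps]
    · have e : (de F * ta 1)⁻¹ * (lin (ut (c ^ 2) 0 c) * fr φ *
          (de F * (al u v w * ta t * (lin M * fr θ)))) = (ta 1)⁻¹ *
          ((de F)⁻¹ * (lin (ut (c ^ 2) 0 c) * fr φ) * de F) *
          (al u v w * ta t * (lin M * fr θ)) := by group
      rw [e, mem_G1J_iff_quadCoeff (mul_mem (mul_mem (inv_mem (ta_mem_G2J 1)) hn) hk), ta_inv]
      simp [quadCoeff, neg_pow_eps, h0, ht']
      ring
  · intro h hh hhK
    rw [mem_G2J_iff_lowEntry hh] at hhK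
    obtain ⟨u, v, w, M, θ, hM, rfl⟩ := mem_G1J.1 hh
    have hM0 : M.val 1 0 ≠ 0 := by simpa [lowEntry] using hhK
    -- conjugation by `ta 1` turns the translation `al 0 v 0` into one times the transvection
    -- `ga (2 v)` or its inverse, so `v` adjusts the last vertex
    have hn : (de F)⁻¹ * al 0 (-M.val 0 0 / M.val 1 0) 0 * de F ∈ G2J Jh := by
      rw [mem_G2J_iff_lowEntry (mul_mem (mul_mem (inv_mem de_mem_G1J) (al_mem_G1J _ _ _))
        de_mem_G1J)]
      simp [lowEntry]
    have he : (ta 1)⁻¹ * al 0 (-M.val 0 0 / M.val 1 0) 0 * ta 1 ∈ G1J Jh := by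
      rw [mem_G1J_iff_quadCoeff (mul_mem (mul_mem (inv_mem (ta_mem_G2J 1)) (al_mem_G2J _ _ _))
        (ta_mem_G2J 1)), ta_inv]
      simp [quadCoeff, neg_pow_eps]
      ring
    refine ⟨al 0 (-M.val 0 0 / M.val 1 0) 0, ⟨al_mem_G1J _ _ _, al_mem_G2J _ _ _⟩, hn, he, ?_, ?_⟩
    · have e : (de F * ta 1)⁻¹ * al 0 (-M.val 0 0 / M.val 1 0) 0 * (de F * ta 1) = (ta 1)⁻¹ *
          ((de F)⁻¹ * al 0 (-M.val 0 0 / M.val 1 0) 0 * de F) * ta 1 := by group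
      rw [e, mem_G1J_iff_quadCoeff (mul_mem (mul_mem (inv_mem (ta_mem_G2J 1)) hn)
        (ta_mem_G2J 1)), ta_inv]
      simp [quadCoeff, neg_pow_eps]
    · have e : (ta 1 * de F)⁻¹ * (al 0 (-M.val 0 0 / M.val 1 0) 0 *
          (ta 1 * (al u v w * (lin M * fr θ)))) = (de F)⁻¹ *
          ((ta 1)⁻¹ * al 0 (-M.val 0 0 / M.val 1 0) 0 * ta 1) *
            (al u v w * (lin M * fr θ)) := by group
      rw [e, mem_G2J_iff_lowEntry (mul_mem (mul_mem (inv_mem de_mem_G1J) he) hh), ta_inv]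
      simp [lowEntry, neg_pow_eps]
      field_simp
      linear_combination M.val 0 0 * M.val 1 0 ^ 2 * three

/-- A transversal of the edge stabilizer in `G₁(Ĵ)`, indexed by the projective line. -/
def transversal₁ : Option F → Equiv.Perm (Om F)
  | none => 1
  | some e => ga e * de F

theorem transversal₁_mem (i : Option F) : transversal₁ i ∈ G1J Jh := by
  cases i with
  | none => exact one_mem _
  | some e => exact mul_mem (ga_mem_G1J e) de_mem_G1J

theorem exists_transversal₁ {h : Equiv.Perm (Om F)} (hh : h ∈ G1J Jh) :
    ∃ i, (transversal₁ i)⁻¹ * h ∈ G2J Jh := by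
  by_cases hK : h ∈ G2J Jh
  · exact ⟨none, by simpa [transversal₁] using hK⟩
  · refine ⟨some (((h (1, 0, 0)).1 - (h (0, 0, 0)).1) / lowEntry h), ?_⟩
    rw [mem_G2J_iff_lowEntry hh] at hK
    rw [mem_G2J_iff_lowEntry (mul_mem (inv_mem (transversal₁_mem _)) hh)]
    obtain ⟨u, v, w, M, θ, hM, rfl⟩ := mem_G1J.1 hh
    simp [lowEntry] at hK
    simp [lowEntry, transversal₁, ga_inv]
    field_simp
    ring

theorem transversal₁_inj {i j : Option F} (h : (transversal₁ i)⁻¹ * transversal₁ j ∈ G2J Jh) :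
    i = j := by
  rw [mem_G2J_iff_lowEntry (mul_mem (inv_mem (transversal₁_mem _)) (transversal₁_mem _))] at h
  rcases i with - | e <;> rcases j with - | e' <;> simp [lowEntry, transversal₁, ga_inv] at h ⊢
  linear_combination h

theorem exists_transversal₂ {h : Equiv.Perm (Om F)} (hh : h ∈ G2J Jh) :
    ∃ t : F, (ta t)⁻¹ * h ∈ G1J Jh := by
  obtain ⟨u, v, w, t, M, θ, h0, hM, rfl⟩ := mem_G2J.1 hh
  refine ⟨t, ?_⟩
  rw [mem_G1J_iff_quadCoeff (mul_mem (inv_mem (ta_mem_G2J _)) hh), ta_inv]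
  simp [quadCoeff, h0, neg_pow_eps]
  ring

theorem transversal₂_inj {s t : F} (h : (ta s)⁻¹ * ta t ∈ G1J Jh) : s = t := by
  rw [mem_G1J_iff_quadCoeff (mul_mem (inv_mem (ta_mem_G2J _)) (ta_mem_G2J _)), ta_inv, ta_mul] at h
  have := quadCoeff_eq 0 0 0 (-s + t) 1 1 (by simp)
  rw [al_zero, map_one, map_one, one_mul, mul_one, mul_one, h] at this
  simp at this
  linear_combination this

/-- The transversals of the edge stabilizer serve both `G(Ĵ)` and `G`, so that the two graphs look
the same around each vertex. -/
theorem isCoverOf_graphDelta (Jh : Subgroup (Equiv.Perm F)) :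
    IsCoverOf (graphDeltaJ Jh) (graphDelta F) := by
  have hmono : ∀ {M : GLn F 2} {θ : F ≃+* F}, InJ Jh M θ → InJ (AGammaL1 F) M θ :=
    fun _ => semi_mem_AGammaL1 _ _
  have hH : G1J Jh ≤ G1J (AGammaL1 F) := by
    intro g hg
    obtain ⟨u, v, w, M, θ, hM, rfl⟩ := mem_G1J.1 hg
    exact mem_G1J.2 ⟨u, v, w, M, θ, hmono hM, rfl⟩
  have hK : G2J Jh ≤ G2J (AGammaL1 F) := by
    intro g hg
    obtain ⟨u, v, w, t, M, θ, h0, hM, rfl⟩ := mem_G2J.1 hg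
    exact mem_G2J.2 ⟨u, v, w, t, M, θ, h0, hmono hM, rfl⟩
  rw [graphDelta, graphDeltaJ, G1_eq, G2_eq]
  refine isCoverOf_joinCosetGraph hH hK (fun h hh => ?_) (fun k hk => ?_) ?_ ?_
  · obtain ⟨i, hi⟩ := exists_transversal₁ hh
    exact ⟨_, transversal₁_mem i, hi⟩
  · obtain ⟨t, ht⟩ := exists_transversal₂ hk
    exact ⟨_, ta_mem_G2J t, ht⟩
  · rintro g ⟨h1, h2⟩
    rw [mem_G2J_iff_lowEntry h1]
    exact (mem_G2J_iff_lowEntry (hH h1)).1 h2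
  · rintro g ⟨h1, h2⟩
    rw [mem_G1J_iff_quadCoeff h1]
    exact (mem_G1J_iff_quadCoeff (hK h1)).1 h2

end Graph

/-! ### Affine subgroups and the kernels of the local actions -/

section Linear

variable {F : Type*} [Field F]

theorem al_mul_lin_inj {u v w u' v' w' : F} {M M' : GLn F 2}
    (h : al u v w * lin M = al u' v' w' * lin M') :
    u = u' ∧ v = v' ∧ w = w' ∧ M = M' := by
  have h0 := congrArg (fun g : Equiv.Perm (Om F) => g (0, 0, 0)) h
  have h1 := congrArg (fun g : Equiv.Perm (Om F) => g (1, 0, 0)) h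
  have h2 := congrArg (fun g : Equiv.Perm (Om F) => g (0, 1, 0)) h
  simp at h0 h1 h2
  obtain ⟨rfl, rfl, rfl⟩ := h0
  refine ⟨rfl, rfl, rfl, ?_⟩
  ext i j
  fin_cases i <;> fin_cases j
  · simpa using h1.1
  · simpa using h2.1
  · simpa using h1.2
  · simpa using h2.2

/-- The group of all maps `x ↦ M x + c` with `M` in `X`, where `M` acts on `F³` through `lin`. -/
noncomputable def linSub (X : Subgroup (GLn F 2)) : Subgroup (Equiv.Perm (Om F)) where
  carrier := {g | ∃ u v w, ∃ M ∈ X, g = al u v w * lin M}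
  one_mem' := ⟨0, 0, 0, 1, one_mem _, by simp [al_zero]⟩
  mul_mem' := by
    rintro _ _ ⟨u, v, w, M, hM, rfl⟩ ⟨u', v', w', M', hM', rfl⟩
    rw [mul_assoc, ← mul_assoc (lin M), lin_mul_al, mul_assoc, ← map_mul, ← mul_assoc, al_mul]
    exact ⟨_, _, _, M * M', mul_mem hM hM', rfl⟩
  inv_mem' := by
    rintro _ ⟨u, v, w, M, hM, rfl⟩
    exact ⟨_, _, _, M⁻¹, inv_mem hM, by rw [mul_inv_rev, al_inv, ← map_inv, lin_mul_al]⟩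

theorem al_mul_lin_mem_linSub {X : Subgroup (GLn F 2)} {u v w : F} {M : GLn F 2} :
    al u v w * lin M ∈ linSub X ↔ M ∈ X := by
  constructor
  · rintro ⟨u', v', w', M', hM', h⟩
    rwa [(al_mul_lin_inj h).2.2.2]
  · exact fun h => ⟨u, v, w, M, h, rfl⟩

theorem al_mem_linSub {X : Subgroup (GLn F 2)} (u v w : F) : al u v w ∈ linSub X :=
  ⟨u, v, w, 1, one_mem _, by simp⟩

theorem lin_mem_linSub {X : Subgroup (GLn F 2)} {M : GLn F 2} (h : M ∈ X) : lin M ∈ linSub X :=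
  ⟨0, 0, 0, M, h, by simp [al_zero]⟩

theorem linSub_mono {X Y : Subgroup (GLn F 2)} (h : X ≤ Y) : linSub X ≤ linSub Y := by
  rintro _ ⟨u, v, w, M, hM, rfl⟩
  exact ⟨u, v, w, M, h hM, rfl⟩

theorem linSub_inf (X Y : Subgroup (GLn F 2)) : linSub X ⊓ linSub Y = linSub (X ⊓ Y) := by
  ext g
  constructor
  · rintro ⟨⟨u, v, w, M, hM, rfl⟩, h⟩
    exact ⟨u, v, w, M, ⟨hM, al_mul_lin_mem_linSub.1 h⟩, rfl⟩
  · rintro ⟨u, v, w, M, hM, rfl⟩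
    exact ⟨⟨u, v, w, M, hM.1, rfl⟩, ⟨u, v, w, M, hM.2, rfl⟩⟩

/-- A subgroup containing the translations and `lin M` for all `M ∈ X` contains `linSub X`. -/
theorem linSub_le {X : Subgroup (GLn F 2)} {K : Subgroup (Equiv.Perm (Om F))}
    (h1 : ∀ u v w, al u v w ∈ K) (h2 : X ≤ K.comap lin) : linSub X ≤ K := by
  rintro _ ⟨u, v, w, M, hM, rfl⟩
  exact mul_mem (h1 u v w) (h2 hM)

theorem conj_al (M : GLn F 2) (θ : F ≃+* F) (u v w : F) : ∃ u' v' w',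
    lin M * fr θ * al u v w * (lin M * fr θ)⁻¹ = al u' v' w' := by
  obtain ⟨u', v', w', h⟩ := lin_fr_mul_al M θ u v w
  exact ⟨u', v', w', by rw [h, mul_inv_cancel_right]⟩

theorem conj_lin (M N : GLn F 2) (θ : F ≃+* F) :
    lin M * fr θ * lin N * (lin M * fr θ)⁻¹ = lin (M * frGL θ N * M⁻¹) := by
  rw [mul_inv_rev, mul_assoc (lin M), fr_mul_lin, map_mul, map_mul, map_inv]
  group

theorem conj_mul_left {G : Type*} [Group G] (a b n : G) :
    a * b * n * (a * b)⁻¹ = a * (b * n * b⁻¹) * a⁻¹ := by group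

theorem conj_mem_linSub {X : Subgroup (GLn F 2)} {M : GLn F 2} {θ : F ≃+* F}
    (hX : ∀ N ∈ X, M * frGL θ N * M⁻¹ ∈ X) {g : Equiv.Perm (Om F)} (hg : g ∈ linSub X) :
    lin M * fr θ * g * (lin M * fr θ)⁻¹ ∈ linSub X := by
  obtain ⟨u, v, w, N, hN, rfl⟩ := hg
  obtain ⟨u', v', w', h⟩ := conj_al M θ u v w
  rw [← conj_mul, h, conj_lin]
  exact ⟨_, _, _, _, hX N hN, rfl⟩

/-- The matrices with determinant in `D`. -/
noncomputable def detSub (D : Subgroup Fˣ) : Subgroup (GLn F 2) :=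
  D.comap Matrix.GeneralLinearGroup.det

theorem mem_detSub {D : Subgroup Fˣ} {M : GLn F 2} :
    M ∈ detSub D ↔ Matrix.GeneralLinearGroup.det M ∈ D := Iff.rfl

theorem mem_detSub_bot {M : GLn F 2} : M ∈ detSub ⊥ ↔ M.val.det = 1 := by
  rw [mem_detSub, Subgroup.mem_bot, Units.ext_iff]
  rfl

theorem detSub_mono {D E : Subgroup Fˣ} (h : D ≤ E) : detSub D ≤ detSub E :=
  Subgroup.comap_mono h

theorem ut_inv (l m : Fˣ) (e : F) :
    (ut l e m)⁻¹ = ut l⁻¹ (-((l⁻¹ : Fˣ) * e * (m⁻¹ : Fˣ))) m⁻¹ := by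
  rw [inv_eq_iff_mul_eq_one, ut_mul]
  ext i j
  fin_cases i <;> fin_cases j <;> simp [mul_assoc]

theorem ut_one : ut 1 0 1 = (1 : GLn F 2) := by
  ext i j
  fin_cases i <;> fin_cases j <;> simp

theorem ut_inj {l l' m m' : Fˣ} {e e' : F} (h : ut l e m = ut l' e' m') :
    l = l' ∧ e = e' ∧ m = m' := by
  have h' : ∀ i j, (ut l e m).val i j = (ut l' e' m').val i j := by rw [h]; simp
  have h1 := h' 0 0
  have h2 := h' 0 1
  have h3 := h' 1 1
  simp at h1 h2 h3
  exact ⟨Units.ext h1, h2, Units.ext h3⟩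

theorem det_ut (l m : Fˣ) (e : F) : Matrix.GeneralLinearGroup.det (ut l e m) = l * m :=
  Units.ext (by simp)

variable (F) in
/-- The upper triangular matrices. -/
def borel : Subgroup (GLn F 2) where
  carrier := {M | ∃ l e m, M = ut l e m}
  one_mem' := ⟨1, 0, 1, ut_one.symm⟩
  mul_mem' := by
    rintro _ _ ⟨l, e, m, rfl⟩ ⟨l', e', m', rfl⟩
    exact ⟨_, _, _, ut_mul _ _ _ _ _ _⟩
  inv_mem' := by
    rintro _ ⟨l, e, m, rfl⟩
    exact ⟨_, _, _, ut_inv _ _ _⟩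

theorem mem_borel {M : GLn F 2} : M ∈ borel F ↔ M.val 1 0 = 0 := by
  constructor
  · rintro ⟨l, e, m, rfl⟩
    simp
  · exact fun h => eq_ut h

/-- The matrices `(m², e; 0, m)` with `m ∈ D`. -/
def wt (D : Subgroup Fˣ) : Subgroup (GLn F 2) where
  carrier := {M | ∃ m ∈ D, ∃ e, M = ut (m ^ 2) e m}
  one_mem' := ⟨1, one_mem _, 0, by rw [one_pow, ut_one]⟩
  mul_mem' := by
    rintro _ _ ⟨m, hm, e, rfl⟩ ⟨m', hm', e', rfl⟩
    exact ⟨m * m', mul_mem hm hm', _, by rw [ut_mul, mul_pow]⟩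
  inv_mem' := by
    rintro _ ⟨m, hm, e, rfl⟩
    exact ⟨m⁻¹, inv_mem hm, _, by rw [ut_inv, inv_pow]⟩

theorem mem_wt {D : Subgroup Fˣ} {M : GLn F 2} :
    M ∈ wt D ↔ ∃ m ∈ D, ∃ e, M = ut (m ^ 2) e m := Iff.rfl

theorem wt_mono {D E : Subgroup Fˣ} (h : D ≤ E) : wt D ≤ wt E := by
  rintro _ ⟨m, hm, e, rfl⟩
  exact ⟨m, h hm, e, rfl⟩

theorem wt_le_borel (D : Subgroup Fˣ) : wt D ≤ borel F := by
  rintro _ ⟨m, hm, e, rfl⟩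
  exact ⟨_, _, _, rfl⟩

theorem wt_le_detSub (D : Subgroup Fˣ) : wt D ≤ detSub D := by
  rintro _ ⟨m, hm, e, rfl⟩
  rw [mem_detSub, det_ut]
  exact mul_mem (pow_mem hm 2) hm

theorem mem_wt_bot {M : GLn F 2} : M ∈ wt ⊥ ↔ ∃ e, M = ut 1 e 1 := by
  rw [mem_wt]
  simp [Subgroup.mem_bot]

theorem det_frGL (θ : F ≃+* F) (M : GLn F 2) :
    Matrix.GeneralLinearGroup.det (frGL θ M) =
      Units.map (θ : F →* F) (Matrix.GeneralLinearGroup.det M) :=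
  Units.ext (by simp [Matrix.det_fin_two])

theorem frGL_ut (θ : F ≃+* F) (l m : Fˣ) (e : F) :
    frGL θ (ut l e m) = ut (Units.map (θ : F →* F) l) (θ e) (Units.map (θ : F →* F) m) := by
  ext i j
  rw [frGL_val]
  fin_cases i <;> fin_cases j <;> simp

/-- The maps `x ↦ m x` with `m ∈ D`. -/
def mulSub (D : Subgroup Fˣ) : Subgroup (Equiv.Perm F) where
  carrier := {g | ∃ m ∈ D, g = semi m 1}
  one_mem' := ⟨1, one_mem _, semi_one.symm⟩
  mul_mem' := by
    rintro _ _ ⟨m, hm, rfl⟩ ⟨m', hm', rfl⟩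
    exact ⟨m * m', mul_mem hm hm', semi_mul _ _ _ _⟩
  inv_mem' := by
    rintro _ ⟨m, hm, rfl⟩
    refine ⟨m⁻¹, inv_mem hm, ?_⟩
    rw [inv_eq_iff_mul_eq_one, semi_mul, ← semi_one]
    congr 1
    ext
    simp

/-- The group of the multiplications in `Ĵ`, as a group of scalars. -/
def scal (Jh : Subgroup (Equiv.Perm F)) : Subgroup Fˣ where
  carrier := {m | semi m 1 ∈ Jh}
  one_mem' := by
    change semi 1 1 ∈ Jh
    rw [semi_one]
    exact one_mem _
  mul_mem' := by
    intro m m' hm hm'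
    have := mul_mem (S := Subgroup (Equiv.Perm F)) hm hm'
    rw [semi_mul] at this
    exact this
  inv_mem' := by
    intro m hm
    have h : semi m⁻¹ 1 = (semi m 1)⁻¹ := by
      rw [eq_comm, inv_eq_iff_mul_eq_one, semi_mul, ← semi_one]
      congr 1
      ext
      simp
    change semi m⁻¹ 1 ∈ Jh
    rw [h]
    exact inv_mem hm

theorem linSub_wt_le {D E : Subgroup Fˣ} (hD : D ≤ E) :
    linSub (wt D) ≤ linSub (borel F ⊓ detSub E) :=
  linSub_mono (le_inf (wt_le_borel D) ((wt_le_detSub D).trans (detSub_mono hD)))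

variable [Finite F] [CharP F 3]

theorem map_unit_mem {D : Subgroup Fˣ} (θ : F ≃+* F) {m : Fˣ} (hm : m ∈ D) :
    Units.map (θ : F →* F) m ∈ D := by
  obtain ⟨n, rfl⟩ := exists_frobenius_pow F θ
  have h2 : Units.map ((frobeniusEquiv F 3 ^ n : F ≃+* F) : F →* F) m = m ^ 3 ^ n :=
    Units.ext (by simpa using frobeniusEquiv_pow_apply n (m : F))
  rw [h2]
  exact pow_mem hm _

theorem kap_mem_iff {D : Subgroup Fˣ} {M : GLn F 2} : kap M ∈ D ↔ M ∈ detSub D := by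
  rw [mem_detSub]
  constructor
  · intro h
    rw [← kap_cube]
    exact pow_mem h 3
  · exact fun h => pow_mem h _

variable {Jh : Subgroup (Equiv.Perm F)}

theorem inJ_one_iff {M : GLn F 2} : InJ Jh M 1 ↔ M ∈ detSub (scal Jh) := kap_mem_iff (D := scal Jh)

theorem inJ_mulSub {D : Subgroup Fˣ} {M : GLn F 2} {θ : F ≃+* F} :
    InJ (mulSub D) M θ ↔ θ = 1 ∧ M ∈ detSub D := by
  rw [← kap_mem_iff]
  constructor
  · rintro ⟨m, hm, h⟩
    obtain ⟨h1, h2⟩ := semi_injective h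
    exact ⟨h2, h1 ▸ hm⟩
  · rintro ⟨rfl, h⟩
    exact ⟨_, h, rfl⟩

theorem conj_mem_detSub {D : Subgroup Fˣ} (M : GLn F 2) (θ : F ≃+* F) {N : GLn F 2}
    (hN : N ∈ detSub D) : M * frGL θ N * M⁻¹ ∈ detSub D := by
  rw [mem_detSub, map_mul, map_mul, map_inv, mul_comm, inv_mul_cancel_left, det_frGL]
  exact map_unit_mem θ hN

theorem conj_mem_wt {D : Subgroup Fˣ} {M : GLn F 2} (hM : M.val 1 0 = 0) (θ : F ≃+* F)
    {N : GLn F 2} (hN : N ∈ wt D) : M * frGL θ N * M⁻¹ ∈ wt D := by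
  obtain ⟨l, e, m, rfl⟩ := eq_ut hM
  obtain ⟨k, hk, f, rfl⟩ := hN
  rw [frGL_ut, ut_inv, ut_mul, ut_mul, map_pow, mul_inv_cancel_comm, mul_inv_cancel_comm]
  exact ⟨Units.map (θ : F →* F) k, map_unit_mem θ hk, _, rfl⟩

theorem G1J_le_normalizer (D : Subgroup Fˣ) :
    G1J Jh ≤ Subgroup.normalizer (linSub (detSub D) : Set (Equiv.Perm (Om F))) := by
  rw [Subgroup.le_normalizer_iff]
  intro h hh n hn
  obtain ⟨u, v, w, M, θ, -, rfl⟩ := mem_G1J.1 hh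
  rw [conj_mul_left]
  exact mul_mem (mul_mem (al_mem_linSub _ _ _)
    (conj_mem_linSub (fun N hN => conj_mem_detSub M θ hN) hn)) (inv_mem (al_mem_linSub _ _ _))

theorem G2J_le_normalizer (D : Subgroup Fˣ) :
    G2J Jh ≤ Subgroup.normalizer (linSub (wt D) : Set (Equiv.Perm (Om F))) := by
  rw [Subgroup.le_normalizer_iff]
  intro h hh n hn
  obtain ⟨u, v, w, t, M, θ, h0, -, rfl⟩ := mem_G2J.1 hh
  rw [conj_mul_left, conj_mul_left]
  have h1 := conj_mem_linSub (M := M) (θ := θ) (fun N hN => conj_mem_wt h0 θ hN) hn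
  refine mul_mem (mul_mem (al_mem_linSub _ _ _) ?_) (inv_mem (al_mem_linSub _ _ _))
  obtain ⟨x, y, z, N, ⟨m, hm, e, rfl⟩, h2⟩ := h1
  rw [h2, ← mul_assoc, ta_mul_al, mul_assoc _ (ta t), ← lin_mul_ta (t := t) (s := t) (by simp)
    (by simp [mul_comm]), ← mul_assoc, mul_inv_cancel_right, mul_assoc, ← lin_ga, ← map_mul]
  refine al_mul_lin_mem_linSub.2 (mul_mem (wt_mono bot_le ?_) ⟨m, hm, e, rfl⟩)
  exact mem_wt_bot.2 ⟨_, rfl⟩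

theorem linSub_borel_le_normalizer (D : Subgroup Fˣ) :
    linSub (borel F) ≤ Subgroup.normalizer (linSub (wt D) : Set (Equiv.Perm (Om F))) := by
  rw [Subgroup.le_normalizer_iff]
  rintro _ ⟨u, v, w, M, hM, rfl⟩ n hn
  have h := conj_mem_linSub (M := M) (θ := 1) (fun N hN => conj_mem_wt (mem_borel.1 hM) 1 hN) hn
  rw [map_one, mul_one] at h
  rw [conj_mul_left]
  exact mul_mem (mul_mem (al_mem_linSub _ _ _) h) (inv_mem (al_mem_linSub _ _ _))

/-- `K₂FJ` with `J` replaced by a group of multiplications is normal in `G₂(Ĵ)`. -/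
theorem G2J_le_normalizer_G2J (D : Subgroup Fˣ) :
    G2J Jh ≤ Subgroup.normalizer (G2J (mulSub D) : Set (Equiv.Perm (Om F))) := by
  rw [Subgroup.le_normalizer_iff]
  intro h hh n hn
  obtain ⟨u, v, w, t, M, θ, h0, -, rfl⟩ := mem_G2J.1 hh
  rw [conj_mul_left, conj_mul_left]
  refine mul_mem (mul_mem (al_mem_G2J _ _ _) ?_) (inv_mem (al_mem_G2J _ _ _))
  refine mul_mem (mul_mem (ta_mem_G2J _) ?_) (inv_mem (ta_mem_G2J _))
  obtain ⟨x, y, z, s, N, φ, h1, hN, rfl⟩ := mem_G2J.1 hn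
  obtain ⟨rfl, hN'⟩ := inJ_mulSub.1 hN
  obtain ⟨x', y', z', h2⟩ := conj_al M θ x y z
  have h3 : lin M * fr θ * ta s * (lin M * fr θ)⁻¹ ∈ G2J (mulSub D) := by
    rw [lin_fr_mul_ta h0, mul_inv_cancel_right]
    exact ta_mem_G2J _
  rw [map_one, mul_one, ← conj_mul, ← conj_mul, h2, conj_lin]
  refine mul_mem (mul_mem (al_mem_G2J _ _ _) h3) (lin_mem_G2J ?_
    (inJ_mulSub.2 ⟨rfl, conj_mem_detSub M θ hN'⟩))
  rw [← mem_borel]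
  refine mul_mem (mul_mem (mem_borel.2 h0) (mem_borel.2 ?_)) (inv_mem (mem_borel.2 h0))
  rw [frGL_val, h1, map_zero]

theorem linSub_detSub_le_G1J : linSub (detSub (scal Jh)) ≤ G1J Jh :=
  linSub_le al_mem_G1J fun _ hM => lin_mem_G1J (inJ_one_iff.2 hM)

theorem linSub_le_edge : linSub (borel F ⊓ detSub (scal Jh)) ≤ G1J Jh ⊓ G2J Jh :=
  linSub_le (fun u v w => ⟨al_mem_G1J u v w, al_mem_G2J u v w⟩) fun _ hM =>
    ⟨lin_mem_G1J (inJ_one_iff.2 hM.2), lin_mem_G2J (mem_borel.1 hM.1) (inJ_one_iff.2 hM.2)⟩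

/-- The kernel of the action of `G₂(Ĵ)` on the neighbours of the vertex that it fixes. -/
theorem coreIn_G2J : coreIn (G2J Jh) (G1J Jh ⊓ G2J Jh) = linSub (wt (scal Jh)) := by
  refine le_antisymm (fun g hg => ?_) ?_
  · obtain ⟨h1, h2⟩ := mem_coreIn.1 hg
    have h3 := h2 1 (one_mem _)
    rw [one_mul, inv_one, mul_one] at h3
    obtain ⟨u, v, w, M, θ, h0, hM, rfl⟩ := mem_G1J_inf_G2J.1 h3
    obtain ⟨l, e, m, rfl⟩ := eq_ut h0
    have key : ∀ s : F, l * θ s = s * m ^ 2 := by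
      intro s
      have h4 := (mem_G1J_iff_quadCoeff (mul_mem (mul_mem (ta_mem_G2J _) h1)
        (inv_mem (ta_mem_G2J _)))).1 (h2 (ta (-s)) (ta_mem_G2J _)).1
      rw [ta_inv, neg_neg] at h4
      simp [quadCoeff, neg_pow_eps] at h4
      linear_combination h4 + (l * θ s - s * m ^ 2) * three_eq_zero (F := F)
    have hl : (l : F) = m ^ 2 := by simpa using key 1
    obtain rfl : l = m ^ 2 := Units.ext (by simpa using hl)
    obtain rfl : θ = 1 := RingEquiv.ext fun s => by
      have h5 := key s
      rw [hl, mul_comm] at h5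
      exact mul_right_cancel₀ (pow_ne_zero 2 m.ne_zero) h5
    rw [map_one, mul_one]
    refine al_mul_lin_mem_linSub.2 ⟨m, ?_, e, rfl⟩
    have h6 : semi (kap (ut (m ^ 2) e m)) 1 ∈ Jh := hM
    rwa [kap_eq_of_det_eq (N := ut (m ^ 2) 0 m) (by simp), kap_ut_sq] at h6
  · have h := (linSub_wt_le le_rfl).trans (linSub_le_edge (Jh := Jh))
    exact le_coreIn (h.trans inf_le_right) h (G2J_le_normalizer _)

/-- The kernel of the action of `G₁(Ĵ)` on the projective line consists of affine maps with
scalar linear part. -/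
theorem exists_of_mem_coreIn_G1J {g : Equiv.Perm (Om F)}
    (hg : g ∈ coreIn (G1J Jh) (G1J Jh ⊓ G2J Jh)) :
    ∃ u v w l, l * l ∈ scal Jh ∧ g = al u v w * lin (ut l 0 l) := by
  obtain ⟨h1, h2⟩ := mem_coreIn.1 hg
  have h3 := h2 1 (one_mem _)
  rw [one_mul, inv_one, mul_one] at h3
  obtain ⟨u, v, w, M, θ, h0, hM, rfl⟩ := mem_G1J_inf_G2J.1 h3
  obtain ⟨l, e, m, rfl⟩ := eq_ut h0
  have key : ∀ s : F, l * θ s + e = s * m := by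
    intro s
    have hs : (ga s * de F)⁻¹ ∈ G1J Jh := inv_mem (mul_mem (ga_mem_G1J s) de_mem_G1J)
    have h4 := (mem_G2J_iff_lowEntry (mul_mem (mul_mem hs h1) (inv_mem hs))).1 (h2 _ hs).2
    rw [inv_inv, mul_inv_rev, ga_inv] at h4
    simp [lowEntry] at h4
    linear_combination -h4
  have he : e = 0 := by simpa using key 0
  subst he
  have hl : (l : F) = m := by simpa using key 1
  obtain rfl : l = m := Units.ext hl
  obtain rfl : θ = 1 := RingEquiv.ext fun s => by
    have h5 := key s
    rw [add_zero, mul_comm] at h5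
    exact mul_right_cancel₀ l.ne_zero h5
  refine ⟨u, v, w, l, ?_, by rw [map_one, mul_one]⟩
  have := inJ_one_iff.1 hM
  rwa [mem_detSub, det_ut] at this

theorem coreIn_G1J_le : coreIn (G1J Jh) (G1J Jh ⊓ G2J Jh) ≤
    linSub (borel F ⊓ detSub (scal Jh)) := by
  intro g hg
  obtain ⟨u, v, w, l, hl, rfl⟩ := exists_of_mem_coreIn_G1J hg
  exact al_mul_lin_mem_linSub.2 ⟨⟨_, _, _, rfl⟩, mem_detSub.2 (by rwa [det_ut])⟩

theorem eq_one_of_forall_conj {x : Equiv.Perm (Om F)}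
    (h : ∀ a ∈ GJ Jh, a⁻¹ * x * a ∈ G1J Jh ⊓ G2J Jh) : x = 1 := by
  -- the conjugates of `x` are translations, being in the kernels of both local actions
  have key : ∀ a ∈ GJ Jh, ∃ u v w, a⁻¹ * x * a = al u v w := by
    intro a ha
    have h1 : a⁻¹ * x * a ∈ coreIn (G1J Jh) (G1J Jh ⊓ G2J Jh) := by
      refine mem_coreIn.2 ⟨(h a ha).1, fun b hb => ?_⟩
      have := h (a * b⁻¹) (mul_mem ha (inv_mem (Subgroup.mem_sup_left hb)))
      simpa [mul_assoc] using this
    have h2 : a⁻¹ * x * a ∈ coreIn (G2J Jh) (G1J Jh ⊓ G2J Jh) := by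
      refine mem_coreIn.2 ⟨(h a ha).2, fun b hb => ?_⟩
      have := h (a * b⁻¹) (mul_mem ha (inv_mem (Subgroup.mem_sup_right hb)))
      simpa [mul_assoc] using this
    obtain ⟨u, v, w, l, -, e1⟩ := exists_of_mem_coreIn_G1J h1
    rw [coreIn_G2J, e1, al_mul_lin_mem_linSub] at h2
    obtain ⟨m, -, e, e2⟩ := h2
    obtain ⟨h3, -, rfl⟩ := ut_inj e2
    obtain rfl : l = 1 := by
      rw [sq, left_eq_mul] at h3
      exact h3
    refine ⟨u, v, w, by rw [e1, ut_one, map_one, mul_one]⟩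
  have key2 : ∀ a ∈ GJ Jh, ∀ u v w, a⁻¹ * x * a = al u v w → v = 0 := by
    intro a ha u v w e
    obtain ⟨u', v', w', e'⟩ := key (a * ta 1)
      (mul_mem ha (Subgroup.mem_sup_right (ta_mem_G2J 1)))
    have e2 : (ta 1)⁻¹ * al u v w * ta 1 = al u' v' w' := by
      rw [← e, ← e']
      group
    rw [ta_inv] at e2
    have e3 := congrArg (fun g : Equiv.Perm (Om F) => (g (0, 1, 0)).1 - (g (0, 0, 0)).1) e2
    simp [neg_pow_eps] at e3
    linear_combination e3 + v * three_eq_zero (F := F)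
  obtain ⟨u, v, w, e⟩ := key 1 (one_mem _)
  obtain rfl := key2 1 (one_mem _) _ _ _ e
  rw [inv_one, one_mul, mul_one] at e
  have hu : u = 0 := by
    refine key2 (de F) (Subgroup.mem_sup_left de_mem_G1J) 0 u w ?_
    rw [e]
    ext ⟨a, b, c⟩ <;> simp
  subst hu
  have hw : w = 0 := by
    have : w ^ 1 = 0 := by
      refine (pow_eq_zero_iff one_ne_zero).2 ?_
      have := key2 (ta 1 * de F) (mul_mem (Subgroup.mem_sup_right (ta_mem_G2J 1))
        (Subgroup.mem_sup_left de_mem_G1J)) 0 (-w) w (by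
          rw [e, mul_inv_rev, ta_inv]
          ext ⟨a, b, c⟩ <;> simp [neg_pow_eps]
          ring)
      simpa using this
    simpa using this
  rw [e, hw, al_zero]

end Linear

/-! ### Radicals, the core and centralizers of the vertex groups -/

section Linear

variable {F : Type*} [Field F]

theorem exists_pow_al_mul_lin (u v w : F) (M : GLn F 2) (n : ℕ) :
    ∃ u' v' w', (al u v w * lin M) ^ n = al u' v' w' * lin (M ^ n) := by
  induction n with
  | zero => exact ⟨0, 0, 0, by simp [al_zero]⟩
  | succ n ih =>
    obtain ⟨u', v', w', h⟩ := ih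
    rw [pow_succ, h, mul_assoc, ← mul_assoc (lin _), lin_mul_al, mul_assoc, ← map_mul, ← mul_assoc,
      al_mul, pow_succ]
    exact ⟨_, _, _, rfl⟩

theorem exists_ut_pow (l m : Fˣ) (e : F) (n : ℕ) :
    ∃ e', (ut l e m) ^ n = ut (l ^ n) e' (m ^ n) := by
  induction n with
  | zero => exact ⟨0, by simp [ut_one]⟩
  | succ n ih =>
    obtain ⟨e', h⟩ := ih
    rw [pow_succ, h, ut_mul, pow_succ, pow_succ]
    exact ⟨_, rfl⟩

/-- The translations along the third coordinate. -/
def centralTrans : Ele F 1 →* Equiv.Perm (Om F) where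
  toFun z := al 0 0 (Multiplicative.toAdd z 0)
  map_one' := al_zero
  map_mul' y z := by rw [al_mul, add_zero, toAdd_mul, Pi.add_apply]

theorem centralTrans_apply (z : Ele F 1) :
    centralTrans z = al 0 0 (Multiplicative.toAdd z 0) := rfl

theorem mem_range_centralTrans {g : Equiv.Perm (Om F)} :
    g ∈ (centralTrans (F := F)).range ↔ ∃ w, g = al 0 0 w := by
  constructor
  · rintro ⟨z, rfl⟩
    exact ⟨_, rfl⟩
  · rintro ⟨w, rfl⟩
    exact ⟨Multiplicative.ofAdd fun _ => w, rfl⟩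

theorem centralTrans_injective : Function.Injective (centralTrans (F := F)) := by
  intro y z h
  have h1 := congrArg (fun g : Equiv.Perm (Om F) => (g (0, 0, 0)).2.2) h
  simp [centralTrans_apply] at h1
  refine Multiplicative.toAdd.injective (funext fun i => ?_)
  rwa [Subsingleton.elim i 0]

variable (F) in
/-- The scalars `m` with `m² = 1`. -/
def sqrtOne : Subgroup Fˣ := (powMonoidHom 2 : Fˣ →* Fˣ).ker

theorem mem_sqrtOne {m : Fˣ} : m ∈ sqrtOne F ↔ m ^ 2 = 1 := Iff.rfl

/-- A map `x ↦ M x + c` commuting with all translations of the first two coordinates is a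
translation. -/
theorem eq_one_of_commute_al {u v w : F} {M : GLn F 2}
    (h : ∀ x y : F, al x y 0 * (al u v w * lin M) = al u v w * lin M * al x y 0) : M = 1 := by
  have h1 := congrArg (fun g : Equiv.Perm (Om F) => g (0, 0, 0)) (h 1 0)
  have h2 := congrArg (fun g : Equiv.Perm (Om F) => g (0, 0, 0)) (h 0 1)
  simp at h1 h2
  obtain ⟨h3, h4⟩ := h1
  obtain ⟨h5, h6⟩ := h2
  ext i j
  fin_cases i <;> fin_cases j <;> simp
  · linear_combination -h3
  · exact h5
  · exact h4
  · linear_combination -h6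

theorem lin_mul_al_third {M : GLn F 2} (h : M ∈ detSub (sqrtOne F)) (w : F) :
    lin M * al 0 0 w = al 0 0 w * lin M := by
  have h1 : M.val.det ^ 2 = 1 := by
    have := congrArg Units.val (mem_sqrtOne.1 h)
    simpa using this
  rw [lin_mul_al, pow_mul, h1]
  simp

theorem wt_le_borel_inf_detSub (D : Subgroup Fˣ) : wt D ≤ borel F ⊓ detSub D :=
  le_inf (wt_le_borel D) (wt_le_detSub D)

theorem mem_centreOf_linSub_wt_bot {g : Equiv.Perm (Om F)} :
    g ∈ centreOf (linSub (wt (⊥ : Subgroup Fˣ))) ↔ ∃ u w, g = al u 0 w := by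
  rw [mem_centreOf]
  constructor
  · rintro ⟨⟨u, v, w, M, hM, rfl⟩, h⟩
    obtain rfl := eq_one_of_commute_al fun x y => h _ (al_mem_linSub x y 0)
    rw [map_one, mul_one] at h ⊢
    have h1 := h (lin (ut 1 1 1)) (lin_mem_linSub (mem_wt_bot.2 ⟨1, rfl⟩))
    have h2 := congrArg (fun g : Equiv.Perm (Om F) => g (0, 0, 0)) h1
    simp at h2
    exact ⟨u, w, by rw [h2]⟩
  · rintro ⟨u, w, rfl⟩
    refine ⟨al_mem_linSub _ _ _, ?_⟩
    rintro _ ⟨u', v', w', M, hM, rfl⟩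
    obtain ⟨e, rfl⟩ := mem_wt_bot.1 hM
    ext ⟨a, b, c⟩ <;> simp <;> ring

theorem isPGroup_linSub_wt_bot [CharP F 3] : IsPGroup 3 (linSub (wt (⊥ : Subgroup Fˣ))) := by
  rintro ⟨_, u, v, w, M, hM, rfl⟩
  obtain ⟨e, rfl⟩ := mem_wt_bot.1 hM
  have three := three_eq_zero (F := F)
  refine ⟨1, Subtype.ext ?_⟩
  change (al u v w * lin (ut 1 e 1)) ^ 3 ^ 1 = 1
  rw [pow_one, pow_three]
  ext ⟨a, b, c⟩
  · simp
    linear_combination (u + e * (b + v)) * three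
  · simp
    linear_combination v * three
  · simp
    linear_combination w * three

theorem centreOf_linSub_detSub_bot [CharP F 3] :
    centreOf (linSub (detSub (⊥ : Subgroup Fˣ))) = (centralTrans (F := F)).range := by
  ext g
  rw [mem_centreOf, mem_range_centralTrans]
  constructor
  · rintro ⟨⟨u, v, w, M, hM, rfl⟩, h⟩
    obtain rfl := eq_one_of_commute_al fun x y => h _ (al_mem_linSub x y 0)
    rw [map_one, mul_one] at h ⊢
    have h1 := h (lin wy) (lin_mem_linSub (mem_detSub_bot.2 (by simp)))
    have h2 := congrArg (fun g : Equiv.Perm (Om F) => g (0, 0, 0)) h1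
    simp at h2
    obtain ⟨rfl, h2⟩ := h2
    have hv : v = 0 := by linear_combination h2 + v * three_eq_zero (F := F)
    exact ⟨w, by rw [hv]⟩
  · rintro ⟨w, rfl⟩
    refine ⟨al_mem_linSub _ _ _, ?_⟩
    rintro _ ⟨u, v, w', M, hM, rfl⟩
    rw [mul_assoc, lin_mul_al_third (detSub_mono bot_le hM), ← mul_assoc, ← mul_assoc, al_mul,
      al_mul, add_comm u, add_comm v, add_comm w']

variable [Finite F] [CharP F 3]

theorem mem_sqrtOne_iff_pow {m : Fˣ} : m ∈ sqrtOne F ↔ (m : F) ^ (2 * (Nat.card F / 3)) = 1 := by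
  rw [mem_sqrtOne, pow_mul]
  constructor
  · intro h
    have : (m : F) ^ 2 = 1 := by
      rw [← Units.val_pow_eq_pow_val, h, Units.val_one]
    rw [this, one_pow]
  · intro h
    refine Units.ext ?_
    rw [Units.val_pow_eq_pow_val, Units.val_one, ← pow_eps_cube ((m : F) ^ 2), h, one_pow]

theorem mem_linSub_wt_bot_of_pow {g : Equiv.Perm (Om F)} (hg : g ∈ linSub (borel F)) {k : ℕ}
    (hk : g ^ 3 ^ k = 1) : g ∈ linSub (wt ⊥) := by
  obtain ⟨u, v, w, _, ⟨l, e, m, rfl⟩, rfl⟩ := hg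
  obtain ⟨u', v', w', h⟩ := exists_pow_al_mul_lin u v w (ut l e m) (3 ^ k)
  obtain ⟨e', h'⟩ := exists_ut_pow l m e (3 ^ k)
  have h0 : al (0 : F) 0 0 * lin (ut 1 0 1) = 1 := by rw [al_zero, ut_one, map_one, mul_one]
  rw [hk, h', ← h0] at h
  obtain ⟨h1, -, h2⟩ := ut_inj (al_mul_lin_inj h).2.2.2
  have key : ∀ x : Fˣ, 1 = x ^ 3 ^ k → x = 1 := fun x hx =>
    Units.ext (eq_one_of_pow_three_pow (k := k) (by
      rw [← Units.val_pow_eq_pow_val, ← hx, Units.val_one]))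
  rw [key l h1, key m h2]
  exact al_mul_lin_mem_linSub.2 (mem_wt_bot.2 ⟨e, rfl⟩)

theorem pRadical_linSub {X : Subgroup (GLn F 2)} (h1 : wt ⊥ ≤ X) (h2 : X ≤ borel F) :
    pRadical 3 (linSub X) = linSub (wt ⊥) :=
  pRadical_eq (linSub_mono h1) ((linSub_mono h2).trans (linSub_borel_le_normalizer ⊥))
    isPGroup_linSub_wt_bot fun _ hg _ hk => mem_linSub_wt_bot_of_pow (linSub_mono h2 hg) hk

theorem pRadical_linSub_wt (D : Subgroup Fˣ) : pRadical 3 (linSub (wt D)) = linSub (wt ⊥) :=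
  pRadical_linSub (wt_mono bot_le) (wt_le_borel D)

theorem pRadical_linSub_borel (D : Subgroup Fˣ) :
    pRadical 3 (linSub (borel F ⊓ detSub D)) = linSub (wt ⊥) :=
  pRadical_linSub (le_inf (wt_le_borel ⊥) ((wt_le_detSub ⊥).trans (detSub_mono bot_le)))
    inf_le_left

variable {Jh : Subgroup (Equiv.Perm F)}

theorem pRadical_coreIn_G1J_le :
    pRadical 3 (coreIn (G1J Jh) (G1J Jh ⊓ G2J Jh)) ≤ linSub (wt ⊥) :=
  pRadical_le fun _ hg _ hk =>
    mem_linSub_wt_bot_of_pow (linSub_mono inf_le_left (coreIn_G1J_le hg)) hk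

/-- The conjugates under `G₁(Ĵ)` of a group containing the unitriangular matrices generate a group
containing all matrices of determinant 1. -/
theorem linSub_detSub_le_conjClosure {D : Subgroup Fˣ} {X : Subgroup (GLn F 2)} (h1 : wt ⊥ ≤ X)
    (h2 : ∀ m ∈ D, ∃ N ∈ X, Matrix.GeneralLinearGroup.det N = m) :
    linSub (detSub D) ≤ conjClosure (G1J Jh) (linSub X) := by
  have hle := le_conjClosure (G1J Jh) (linSub X)
  have hu : ∀ e : F, lin (ut 1 e 1) ∈ linSub X :=
    fun e => lin_mem_linSub (h1 (mem_wt_bot.2 ⟨e, rfl⟩))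
  have hsl : ∀ N : GLn F 2, N.val.det = 1 → lin N ∈ conjClosure (G1J Jh) (linSub X) := by
    intro N hN
    refine mem_of_det_eq_one (K := (conjClosure (G1J Jh) (linSub X)).comap lin)
      (fun e => hle (hu e)) (fun e => ?_) hN
    rw [Subgroup.mem_comap, map_mul, map_mul, map_inv, lin_wy]
    exact conj_mem_conjClosure de_mem_G1J (hu e)
  refine linSub_le (fun u v w => hle (al_mem_linSub u v w)) fun M hM => ?_
  obtain ⟨N, hN, hd⟩ := h2 _ hM
  have h3 : lin M = lin (M * N⁻¹) * lin N := by rw [← map_mul, inv_mul_cancel_right]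
  rw [Subgroup.mem_comap, h3]
  refine mul_mem (hsl _ (mem_detSub_bot.1 ?_)) (hle (lin_mem_linSub hN))
  rw [mem_detSub, map_mul, map_inv, hd, mul_inv_cancel]
  exact one_mem _

theorem conjClosure_G1J {D : Subgroup Fˣ} {X : Subgroup (GLn F 2)} (h1 : wt ⊥ ≤ X)
    (h2 : ∀ m ∈ D, ∃ N ∈ X, Matrix.GeneralLinearGroup.det N = m) (h3 : X ≤ detSub D) :
    conjClosure (G1J Jh) (linSub X) = linSub (detSub D) :=
  le_antisymm (conjClosure_le (linSub_mono h3) (G1J_le_normalizer D))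
    (linSub_detSub_le_conjClosure h1 h2)

/-- The elements of `D` are the determinants of the matrices in `wt D`, as cubing is bijective. -/
theorem exists_mem_wt_det_eq {D : Subgroup Fˣ} {m : Fˣ} (hm : m ∈ D) :
    ∃ N ∈ wt D, Matrix.GeneralLinearGroup.det N = m :=
  ⟨_, ⟨m ^ (Nat.card F / 3), pow_mem hm _, 0, rfl⟩, by
    rw [det_ut, ← pow_succ, units_pow_eps_cube]⟩

theorem conjClosure_G1J_wt (D : Subgroup Fˣ) :
    conjClosure (G1J Jh) (linSub (wt D)) = linSub (detSub D) :=
  conjClosure_G1J (wt_mono bot_le) (fun _ hm => exists_mem_wt_det_eq hm) (wt_le_detSub D)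

theorem conjClosure_G1J_borel (D : Subgroup Fˣ) :
    conjClosure (G1J Jh) (linSub (borel F ⊓ detSub D)) = linSub (detSub D) :=
  conjClosure_G1J ((wt_mono bot_le).trans (wt_le_borel_inf_detSub D))
    (fun _ hm => (exists_mem_wt_det_eq hm).imp fun _ h => ⟨wt_le_borel_inf_detSub D h.1, h.2⟩)
    inf_le_right

theorem linSub_borel_le_G2J (D : Subgroup Fˣ) :
    linSub (borel F ⊓ detSub D) ≤ G2J (mulSub D) :=
  linSub_le al_mem_G2J fun _ hM =>
    lin_mem_G2J (mem_borel.1 hM.1) (inJ_mulSub.2 ⟨rfl, hM.2⟩)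

/-- Every `ta t` is a commutator of `ta (-t)` and the central involution of `SL₂`. -/
theorem conjClosure_G2J_borel (D : Subgroup Fˣ) :
    conjClosure (G2J Jh) (linSub (borel F ⊓ detSub D)) = G2J (mulSub D) := by
  refine le_antisymm (conjClosure_le (linSub_borel_le_G2J D) (G2J_le_normalizer_G2J D)) ?_
  intro g hg
  have hle := le_conjClosure (G2J Jh) (linSub (borel F ⊓ detSub D))
  obtain ⟨u, v, w, t, M, θ, h0, hM, rfl⟩ := mem_G2J.1 hg
  obtain ⟨rfl, hD⟩ := inJ_mulSub.1 hM
  rw [map_one, mul_one]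
  refine mul_mem (mul_mem (hle (al_mem_linSub _ _ _)) ?_)
    (hle (lin_mem_linSub ⟨mem_borel.2 h0, hD⟩))
  have hN : lin (ut (-1) 0 (-1) : GLn F 2) ∈ linSub (borel F ⊓ detSub D) := by
    refine lin_mem_linSub ⟨⟨_, _, _, rfl⟩, mem_detSub.2 ?_⟩
    rw [det_ut, neg_mul_neg, one_mul]
    exact one_mem _
  have h1 := mul_mem (conj_mem_conjClosure (ta_mem_G2J (Jh := Jh) (-t)) hN) (hle (inv_mem hN))
  rw [ta_inv, neg_neg, mul_assoc (ta _), lin_mul_ta (t := t) (s := -t) (by simp) (by simp),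
    mul_assoc, mul_inv_cancel_right, ta_mul] at h1
  rwa [show -t + -t = t by linear_combination -t * three_eq_zero (F := F)] at h1

theorem G1J_inf_G2J_inf_linSub :
    (G1J Jh ⊓ G2J Jh) ⊓ linSub (detSub (scal Jh)) = linSub (borel F ⊓ detSub (scal Jh)) := by
  refine le_antisymm ?_ (le_inf linSub_le_edge (linSub_mono inf_le_right))
  rintro _ ⟨h1, u, v, w, M, hM, rfl⟩
  refine al_mul_lin_mem_linSub.2 ⟨mem_borel.2 ?_, hM⟩
  have h2 := (mem_G2J_iff_lowEntry h1.1).1 h1.2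
  simpa [lowEntry] using h2

theorem G1J_inf_G2J_inf_G2J :
    (G1J Jh ⊓ G2J Jh) ⊓ G2J (mulSub (scal Jh)) = linSub (borel F ⊓ detSub (scal Jh)) := by
  refine le_antisymm ?_ (le_inf linSub_le_edge (linSub_borel_le_G2J _))
  rintro _ ⟨h1, h2⟩
  obtain ⟨u, v, w, t, M, θ, h0, hM, rfl⟩ := mem_G2J.1 h2
  have h3 := (mem_G1J_iff_quadCoeff h1.2).1 h1.1
  rw [quadCoeff_eq _ _ _ _ _ _ h0] at h3
  obtain ⟨l, e, m, rfl⟩ := eq_ut h0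
  obtain rfl : t = 0 := by simpa using h3
  obtain ⟨rfl, hD⟩ := inJ_mulSub.1 hM
  rw [map_one, mul_one, ta_zero, mul_one]
  exact al_mul_lin_mem_linSub.2 ⟨⟨_, _, _, rfl⟩, hD⟩

/-- The edge group of the core: it is forced to contain the kernel at the second vertex, whose
conjugates already generate all affine maps with determinant in `scal Jh`. -/
theorem coreB_G1J_G2J : coreB (G1J Jh) (G2J Jh) = linSub (borel F ⊓ detSub (scal Jh)) := by
  refine le_antisymm ((coreB_isLeast _ _).2 ⟨linSub_le_edge, ?_, ?_, ?_⟩) ?_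
  · refine sup_le coreIn_G1J_le ?_
    rw [coreIn_G2J]
    exact linSub_wt_le le_rfl
  · rw [conjClosure_G1J_borel, G1J_inf_G2J_inf_linSub]
  · rw [conjClosure_G2J_borel, G1J_inf_G2J_inf_G2J]
  · obtain ⟨-, h1, h2, -⟩ := (coreB_isLeast (G1J Jh) (G2J Jh)).1
    have h3 := le_sup_right.trans h1
    rw [coreIn_G2J] at h3
    rw [h2, ← G1J_inf_G2J_inf_linSub, ← conjClosure_G1J_wt]
    exact inf_le_inf_left _ (conjClosure_mono _ h3)

theorem centralizerIn_linSub_detSub (D : Subgroup Fˣ) :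
    centralizerIn (linSub (detSub D)) (centralTrans (F := F)).range =
      linSub (detSub (D ⊓ sqrtOne F)) := by
  ext g
  rw [mem_centralizerIn]
  constructor
  · rintro ⟨⟨u, v, w, M, hM, rfl⟩, h⟩
    refine al_mul_lin_mem_linSub.2 ⟨hM, mem_sqrtOne_iff_pow.2 ?_⟩
    have h1 := congrArg (fun g : Equiv.Perm (Om F) => g (0, 0, 0))
      (h _ (mem_range_centralTrans.2 ⟨1, rfl⟩))
    simp [← Matrix.det_fin_two] at h1
    have h2 : (1 : F) = M.val.det ^ (2 * (Nat.card F / 3)) := by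
      linear_combination h1
    exact h2.symm
  · rintro ⟨u, v, w, M, hM, rfl⟩
    refine ⟨al_mul_lin_mem_linSub.2 hM.1, fun x hx => ?_⟩
    obtain ⟨w', rfl⟩ := mem_range_centralTrans.1 hx
    rw [mul_assoc, lin_mul_al_third hM.2, ← mul_assoc, ← mul_assoc, al_mul, al_mul, add_comm u,
      add_comm v, add_comm w]

theorem centralizerIn_G2J (D : Subgroup Fˣ) :
    centralizerIn (G2J (mulSub D)) (centreOf (linSub (wt (⊥ : Subgroup Fˣ)))) =
      linSub (wt (D ⊓ sqrtOne F)) := by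
  ext g
  rw [mem_centralizerIn]
  constructor
  · rintro ⟨hg, h⟩
    obtain ⟨u, v, w, t, M, θ, h0, hM, rfl⟩ := mem_G2J.1 hg
    obtain ⟨l, e, m, rfl⟩ := eq_ut h0
    obtain ⟨rfl, hD⟩ := inJ_mulSub.1 hM
    have h1 := congrArg (fun g : Equiv.Perm (Om F) => g (0, 0, 0))
      (h _ (mem_centreOf_linSub_wt_bot.2 ⟨0, 1, rfl⟩))
    have h2 := congrArg (fun g : Equiv.Perm (Om F) => g (0, 0, 0))
      (h _ (mem_centreOf_linSub_wt_bot.2 ⟨1, 0, rfl⟩))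
    simp at h1 h2
    have hl : l = 1 := Units.ext (by
      rw [Units.val_one]
      linear_combination -h2)
    subst hl
    have hm : m ^ 2 = 1 := by
      refine mem_sqrtOne.1 (mem_sqrtOne_iff_pow.2 ?_)
      have := h1.2
      rw [Units.val_one, one_mul] at this
      linear_combination -this
    have ht : t = 0 := h1.1.1
    rw [mem_detSub, det_ut, one_mul] at hD
    rw [map_one, mul_one, ht, ta_zero, mul_one]
    exact al_mul_lin_mem_linSub.2 ⟨m, ⟨hD, hm⟩, e, by rw [hm]⟩
  · rintro ⟨u, v, w, M, ⟨m, hm, e, rfl⟩, rfl⟩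
    refine ⟨linSub_borel_le_G2J D (linSub_wt_le inf_le_left (al_mul_lin_mem_linSub.2
      ⟨m, hm, e, rfl⟩)), fun x hx => ?_⟩
    obtain ⟨u', w', rfl⟩ := mem_centreOf_linSub_wt_bot.1 hx
    have h1 : m ^ 2 = 1 := hm.2
    have h2 := mem_sqrtOne_iff_pow.1 hm.2
    rw [h1]
    ext ⟨a, b, c⟩
    · simp
      ring
    · simp
    · simp [h2]
      ring

end Linear

/-! ### Affine groups inside `Perm (F³)` -/

section Affine

variable {F : Type*} [Field F]

/-- The action of `GL₂(F)` on `F³` through `lin`, as an action by group automorphisms. -/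
noncomputable def act3 : GLn F 2 →* MulAut (Ele F 3) where
  toFun M :=
    AddEquiv.toMultiplicative
      { toFun := fun v => ![M.val 0 0 * v 0 + M.val 0 1 * v 1, M.val 1 0 * v 0 + M.val 1 1 * v 1,
          M.val.det ^ (2 * (Nat.card F / 3)) * v 2]
        invFun := fun v => ![(M⁻¹).val 0 0 * v 0 + (M⁻¹).val 0 1 * v 1,
          (M⁻¹).val 1 0 * v 0 + (M⁻¹).val 1 1 * v 1, (M⁻¹).val.det ^ (2 * (Nat.card F / 3)) * v 2]
        left_inv := fun v => by
          have h := congrArg (fun g : Equiv.Perm (Om F) => g (v 0, v 1, v 2))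
            (show lin M⁻¹ * lin M = 1 by rw [← map_mul, inv_mul_cancel, map_one])
          simp only [Equiv.Perm.mul_apply, lin_apply, Equiv.Perm.one_apply, Prod.mk.injEq,
            ← Matrix.det_fin_two] at h
          funext i
          fin_cases i
          · exact h.1
          · exact h.2.1
          · exact h.2.2
        right_inv := fun v => by
          have h := congrArg (fun g : Equiv.Perm (Om F) => g (v 0, v 1, v 2))
            (show lin M * lin M⁻¹ = 1 by rw [← map_mul, mul_inv_cancel, map_one])
          simp only [Equiv.Perm.mul_apply, lin_apply, Equiv.Perm.one_apply, Prod.mk.injEq,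
            ← Matrix.det_fin_two] at h
          funext i
          fin_cases i
          · exact h.1
          · exact h.2.1
          · exact h.2.2
        map_add' := fun v w => by
          funext i
          fin_cases i <;> simp <;> ring }
  map_one' := by
    refine MulEquiv.ext fun v => Multiplicative.toAdd.injective (funext fun i => ?_)
    fin_cases i <;> simp
  map_mul' M N := by
    refine MulEquiv.ext fun v => Multiplicative.toAdd.injective (funext fun i => ?_)
    have h := congrArg (fun g : Equiv.Perm (Om F) =>
      g (Multiplicative.toAdd v 0, Multiplicative.toAdd v 1, Multiplicative.toAdd v 2))
      (map_mul lin M N)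
    simp only [Equiv.Perm.mul_apply, lin_apply, Prod.mk.injEq, ← Matrix.det_fin_two] at h
    fin_cases i
    · exact h.1
    · exact h.2.1
    · exact h.2.2

theorem act3_apply (M : GLn F 2) (v : Ele F 3) : Multiplicative.toAdd (act3 M v) =
    ![M.val 0 0 * Multiplicative.toAdd v 0 + M.val 0 1 * Multiplicative.toAdd v 1,
      M.val 1 0 * Multiplicative.toAdd v 0 + M.val 1 1 * Multiplicative.toAdd v 1,
      M.val.det ^ (2 * (Nat.card F / 3)) * Multiplicative.toAdd v 2] := rfl

/-- The translations of `F³`. -/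
def trans3 : Ele F 3 →* Equiv.Perm (Om F) where
  toFun v := al (Multiplicative.toAdd v 0) (Multiplicative.toAdd v 1) (Multiplicative.toAdd v 2)
  map_one' := al_zero
  map_mul' v w := by rw [al_mul]; rfl

theorem trans3_apply (v : Ele F 3) : trans3 v =
    al (Multiplicative.toAdd v 0) (Multiplicative.toAdd v 1) (Multiplicative.toAdd v 2) := rfl

/-- The affine maps `v ↦ M v + c` of `F³`. -/
noncomputable def affLin : Ele F 3 ⋊[act3] GLn F 2 →* Equiv.Perm (Om F) :=
  SemidirectProduct.lift trans3 lin fun M => MonoidHom.ext fun v => by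
    change trans3 (act3 M v) = lin M * trans3 v * (lin M)⁻¹
    rw [eq_mul_inv_iff_mul_eq, trans3_apply, trans3_apply, lin_mul_al, act3_apply]
    rfl

theorem affLin_apply (x : Ele F 3 ⋊[act3] GLn F 2) :
    affLin x = trans3 x.left * lin x.right := rfl

theorem affLin_injective : Function.Injective (affLin (F := F)) := by
  intro x y h
  rw [affLin_apply, affLin_apply, trans3_apply, trans3_apply] at h
  obtain ⟨h0, h1, h2, h3⟩ := al_mul_lin_inj h
  refine SemidirectProduct.ext (Multiplicative.toAdd.injective (funext fun i => ?_)) h3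
  fin_cases i
  · exact h0
  · exact h1
  · exact h2

theorem map_affLin (X : Subgroup (GLn F 2)) :
    (X.comap (SemidirectProduct.rightHom (φ := act3 (F := F)))).map affLin = linSub X := by
  ext g
  constructor
  · rintro ⟨x, hx, rfl⟩
    exact al_mul_lin_mem_linSub.2 hx
  · rintro ⟨u, v, w, M, hM, rfl⟩
    exact ⟨⟨Multiplicative.ofAdd ![u, v, w], M⟩, hM, rfl⟩

theorem relIndex_linSub (X Y : Subgroup (GLn F 2)) :
    (linSub X).relIndex (linSub Y) = X.relIndex Y := by
  rw [← map_affLin, ← map_affLin, Subgroup.relIndex_map_map_of_injective _ _ affLin_injective,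
    Subgroup.relIndex_comap, Subgroup.map_comap_eq_self_of_surjective
      SemidirectProduct.rightHom_surjective]

theorem isoSemidirect_linSub (X : Subgroup (GLn F 2)) :
    IsoSemidirect (linSub X) (Ele F 3) X := by
  refine ⟨act3.comp X.subtype, ⟨?_⟩⟩
  let f : Ele F 3 ⋊[act3.comp X.subtype] X →* Ele F 3 ⋊[act3] GLn F 2 :=
    SemidirectProduct.map (MonoidHom.id _) X.subtype fun g => rfl
  have hf : Function.Injective (affLin.comp f) := by
    refine affLin_injective.comp fun x y h => ?_
    have h1 : x.left = y.left := congrArg (fun z => z.left) h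
    have h2 : (x.right : GLn F 2) = y.right := congrArg (fun z => z.right) h
    exact SemidirectProduct.ext h1 (Subtype.ext h2)
  refine ((MonoidHom.ofInjective hf).trans (MulEquiv.subgroupCongr ?_)).symm
  ext g
  constructor
  · rintro ⟨x, rfl⟩
    exact al_mul_lin_mem_linSub.2 x.right.2
  · rintro ⟨u, v, w, M, hM, rfl⟩
    exact ⟨⟨Multiplicative.ofAdd ![u, v, w], ⟨M, hM⟩⟩, rfl⟩

/-- The affine maps of the first two coordinates. -/
noncomputable def aff : AGL F 2 →* Equiv.Perm (Om F) where
  toFun x := al (Multiplicative.toAdd x.left 0) (Multiplicative.toAdd x.left 1) 0 * lin x.right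
  map_one' := by
    rw [SemidirectProduct.one_right, map_one, mul_one]
    exact al_zero
  map_mul' x y := by
    rw [mul_assoc, ← mul_assoc (lin _), lin_mul_al, mul_assoc, ← map_mul, ← mul_assoc, al_mul,
      SemidirectProduct.mul_right, SemidirectProduct.mul_left, mul_zero, add_zero]
    have h : ∀ v : Ele F 2, ∀ i, Multiplicative.toAdd (natAction F 2 x.right v) i =
        x.right.val i 0 * Multiplicative.toAdd v 0 + x.right.val i 1 * Multiplicative.toAdd v 1 :=
      fun v i => by
        change x.right.val.mulVec (Multiplicative.toAdd v) i = _
        simp [Matrix.mulVec, dotProduct, Fin.sum_univ_two]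
    rw [toAdd_mul, Pi.add_apply, Pi.add_apply, h, h]

theorem toAdd_mul_left (x y : AGL F 2) (i : Fin 2) :
    Multiplicative.toAdd (x * y).left i = Multiplicative.toAdd x.left i +
      (x.right.val i 0 * Multiplicative.toAdd y.left 0 +
        x.right.val i 1 * Multiplicative.toAdd y.left 1) := by
  change _ + x.right.val.mulVec (Multiplicative.toAdd y.left) i = _
  simp [Matrix.mulVec, dotProduct, Fin.sum_univ_two]

/-- The affine maps of the plane with linear part in `X`. -/
def affSub (X : Subgroup (GLn F 2)) : Subgroup (AGL F 2) := X.comap SemidirectProduct.rightHom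

theorem mem_affSub {X : Subgroup (GLn F 2)} {x : AGL F 2} : x ∈ affSub X ↔ x.right ∈ X := Iff.rfl

/-- For linear parts of determinant `±1`, the third coordinate splits off. -/
theorem nonempty_linSub_mulEquiv {X : Subgroup (GLn F 2)} (hX : X ≤ detSub (sqrtOne F)) :
    Nonempty (linSub X ≃* Ele F 1 × affSub X) := by
  refine nonempty_mulEquiv_prod centralTrans (aff.comp (affSub X).subtype) ?_ ?_ ?_
  · rintro z ⟨x, hx⟩
    change al 0 0 _ * (al _ _ 0 * lin x.right) = al _ _ 0 * lin x.right * al 0 0 _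
    rw [mul_assoc, lin_mul_al_third (hX (mem_affSub.1 hx)), ← mul_assoc, ← mul_assoc, al_mul,
      al_mul]
    simp only [zero_add, add_zero]
  · rintro z ⟨x, hx⟩ h
    change al 0 0 _ * (al _ _ 0 * lin x.right) = 1 at h
    rw [← mul_assoc, al_mul, ← al_zero, ← mul_one (al (0 : F) 0 0), ← map_one lin] at h
    obtain ⟨h0, h1, h2, h3⟩ := al_mul_lin_inj h
    rw [zero_add] at h0 h1
    rw [add_zero] at h2
    refine ⟨Multiplicative.toAdd.injective (funext fun i => ?_), Subtype.ext
      (SemidirectProduct.ext (Multiplicative.toAdd.injective (funext fun i => ?_)) h3)⟩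
    · rw [Subsingleton.elim i 0]
      exact h2
    · fin_cases i
      · exact h0
      · exact h1
  · intro g
    constructor
    · rintro ⟨u, v, w, M, hM, rfl⟩
      refine ⟨Multiplicative.ofAdd fun _ => w, ⟨⟨Multiplicative.ofAdd ![u, v], M⟩, hM⟩, ?_⟩
      change al u v w * lin M = al 0 0 w * (al u v 0 * lin M)
      rw [← mul_assoc, al_mul, zero_add, zero_add, add_zero]
    · rintro ⟨z, ⟨x, hx⟩, rfl⟩
      change al 0 0 _ * (al _ _ 0 * lin x.right) ∈ _
      rw [← mul_assoc, al_mul]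
      exact al_mul_lin_mem_linSub.2 hx

theorem card_wt_bot : Nat.card (wt (⊥ : Subgroup Fˣ)) = Nat.card F := by
  refine (Nat.card_congr (Equiv.ofBijective
    (fun e : F => (⟨ut 1 e 1, mem_wt_bot.2 ⟨e, rfl⟩⟩ : wt (⊥ : Subgroup Fˣ))) ⟨?_, ?_⟩)).symm
  · intro e e' h
    exact (ut_inj (congrArg Subtype.val h)).2.1
  · rintro ⟨M, hM⟩
    obtain ⟨e, rfl⟩ := mem_wt_bot.1 hM
    exact ⟨e, rfl⟩

theorem det_surjective : Function.Surjective
    (Matrix.GeneralLinearGroup.det : GLn F 2 →* Fˣ) := fun m =>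
  ⟨ut m 0 1, by rw [det_ut, mul_one]⟩

variable [Finite F]

theorem card_detSub_bot :
    Nat.card (detSub (⊥ : Subgroup Fˣ)) = (Nat.card F ^ 2 - 1) * Nat.card F := by
  have := Fintype.ofFinite F
  have h1 := (detSub (⊥ : Subgroup Fˣ)).card_mul_index
  rw [detSub, Subgroup.index_comap_of_surjective _ det_surjective, Subgroup.index_bot,
    Nat.card_units, Matrix.card_GL_field, Fin.prod_univ_two, ← Nat.card_eq_fintype_card] at h1
  have h2 : 1 < Nat.card F := Finite.one_lt_card
  refine Nat.eq_of_mul_eq_mul_right (Nat.sub_pos_of_lt h2) (h1.trans ?_)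
  simp only [Fin.val_zero, Fin.val_one, pow_zero, pow_one, mul_assoc, Nat.mul_sub, mul_one, sq]

theorem relIndex_wt_bot :
    (wt (⊥ : Subgroup Fˣ)).relIndex (detSub ⊥) = Nat.card F ^ 2 - 1 := by
  have h := ((wt (⊥ : Subgroup Fˣ)).subgroupOf (detSub ⊥)).card_mul_index
  rw [Nat.card_congr (Subgroup.subgroupOfEquivOfLe (wt_le_detSub ⊥)).toEquiv, card_wt_bot,
    card_detSub_bot, mul_comm] at h
  exact Nat.eq_of_mul_eq_mul_right Nat.card_pos h

variable [CharP F 3]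

theorem not_dvd_relIndex_wt_bot : ¬ 3 ∣ (wt (⊥ : Subgroup Fˣ)).relIndex (detSub ⊥) := by
  rw [relIndex_wt_bot]
  have h := (three_dvd_card F).mul_right (Nat.card F)
  rw [← sq] at h
  have : 0 < Nat.card F ^ 2 := pow_pos Nat.card_pos 2
  omega

theorem isSylowIn_linSub :
    IsSylowIn 3 (linSub (wt (⊥ : Subgroup Fˣ))) (linSub (detSub ⊥)) := by
  have : Fact (Nat.Prime 3) := ⟨Nat.prime_three⟩
  refine isSylowIn_of_not_dvd (linSub_mono (wt_le_detSub ⊥)) isPGroup_linSub_wt_bot ?_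
  rw [relIndex_linSub]
  exact not_dvd_relIndex_wt_bot

end Affine

/-! ### Sylow subgroups of `ASL₂(F)` and the groups attached to them -/

section Sylow

variable {F : Type*} [Field F]

theorem conj_right {x y : AGL F 2} {m : Fˣ} {l : Fˣ} {e f : F} (hx : x.right = ut l e m)
    (hy : y.right = ut 1 f 1) : (x * y * x⁻¹).right = ut 1 (l * f * (m⁻¹ : Fˣ)) 1 := by
  rw [SemidirectProduct.mul_right, SemidirectProduct.mul_right, SemidirectProduct.inv_right, hx,
    hy, ut_inv, ut_mul, ut_mul]
  ext i j
  fin_cases i <;> fin_cases j <;> simp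
  field_simp
  ring

theorem toAdd_conj_left_one {x y : AGL F 2} {m : Fˣ} {l : Fˣ} {e f : F} (hx : x.right = ut l e m)
    (hy : y.right = ut 1 f 1) : Multiplicative.toAdd (x * y * x⁻¹).left 1 =
      m * Multiplicative.toAdd y.left 1 := by
  have h : x * y * x⁻¹ * x = x * y := inv_mul_cancel_right _ _
  have h1 := (toAdd_mul_left (x * y * x⁻¹) x 1).symm.trans
    ((congrArg (fun z : AGL F 2 => Multiplicative.toAdd z.left 1) h).trans (toAdd_mul_left x y 1))
  rw [conj_right hx hy, hx] at h1
  simp only [coe_ut, Matrix.of_apply, Matrix.cons_val', Matrix.cons_val_zero, Matrix.cons_val_one,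
    Matrix.cons_val_fin_one, Units.val_one] at h1
  linear_combination h1

theorem mem_borel_of_conj {M : GLn F 2} (h : M * ut 1 1 1 * M⁻¹ ∈ borel F) : M ∈ borel F := by
  obtain ⟨l, e, m, h⟩ := h
  rw [mul_inv_eq_iff_eq_mul] at h
  have h0 := congrArg (fun N : GLn F 2 => N.val 1 0) h
  have h1 := congrArg (fun N : GLn F 2 => N.val 1 1) h
  simp [Matrix.mul_apply, Fin.sum_univ_two] at h0 h1
  refine mem_borel.2 (pow_eq_zero_iff two_ne_zero |>.1 ?_)
  linear_combination M.val 1 0 * h1 - M.val 1 1 * h0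

theorem ASL_eq : ASL F 2 = affSub (detSub ⊥) := by
  ext x
  rw [mem_affSub, mem_detSub]
  rfl

theorem affSub_mono {X Y : Subgroup (GLn F 2)} (h : X ≤ Y) : affSub X ≤ affSub Y :=
  Subgroup.comap_mono h

theorem affSub_wt_bot_le : affSub (wt (⊥ : Subgroup Fˣ)) ≤ ASL F 2 := by
  rw [ASL_eq]
  exact affSub_mono (wt_le_detSub ⊥)

theorem pow_three_of_mem_wt_bot [CharP F 3] {x : AGL F 2} (hx : x ∈ affSub (wt (⊥ : Subgroup Fˣ))) :
    x ^ 3 = 1 := by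
  obtain ⟨e, he⟩ := mem_wt_bot.1 (mem_affSub.1 hx)
  have three := three_eq_zero (F := F)
  rw [pow_three]
  refine SemidirectProduct.ext (Multiplicative.toAdd.injective (funext fun i => ?_)) ?_
  · rw [SemidirectProduct.one_left, toAdd_one, Pi.zero_apply]
    fin_cases i
    · simp [toAdd_mul_left, he, -SemidirectProduct.mul_left]
      linear_combination (Multiplicative.toAdd x.left 0 + e * Multiplicative.toAdd x.left 1) * three
    · simp [toAdd_mul_left, he, -SemidirectProduct.mul_left]
      linear_combination (Multiplicative.toAdd x.left 1) * three
  · rw [SemidirectProduct.mul_right, SemidirectProduct.mul_right, he, ut_mul, ut_mul,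
      SemidirectProduct.one_right, ← ut_one]
    ext i j
    fin_cases i <;> fin_cases j <;> simp
    linear_combination e * three

theorem affSub_wt_le_normalizer :
    affSub (wt (⊤ : Subgroup Fˣ)) ≤
      Subgroup.normalizer (affSub (wt (⊥ : Subgroup Fˣ)) : Set (AGL F 2)) := by
  rw [Subgroup.le_normalizer_iff]
  intro x hx y hy
  obtain ⟨m, -, e, h⟩ := mem_affSub.1 hx
  obtain ⟨f, h'⟩ := mem_wt_bot.1 (mem_affSub.1 hy)
  exact mem_wt_bot.2 ⟨_, conj_right h h'⟩

theorem affSub_borel_le_normalizer :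
    affSub (borel F) ≤
      Subgroup.normalizer (affSub (wt (⊥ : Subgroup Fˣ)) : Set (AGL F 2)) := by
  rw [Subgroup.le_normalizer_iff]
  intro x hx y hy
  obtain ⟨l, e, m, h⟩ := mem_affSub.1 hx
  obtain ⟨f, h'⟩ := mem_wt_bot.1 (mem_affSub.1 hy)
  exact mem_wt_bot.2 ⟨_, conj_right h h'⟩

theorem mem_borel_of_mem_normalizer {x : AGL F 2}
    (hx : x ∈ Subgroup.normalizer (affSub (wt (⊥ : Subgroup Fˣ)) : Set (AGL F 2))) :
    x.right ∈ borel F := by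
  have h := (Subgroup.mem_normalizer_iff.1 hx ⟨1, ut 1 1 1⟩).1 (mem_wt_bot.2 ⟨1, rfl⟩)
  exact mem_borel_of_conj (wt_le_borel ⊥ (mem_affSub.1 h))

/-- The pairs `(e, v₁)` of a transvection entry and a translation coordinate that determine an
element of the standard Sylow subgroup modulo its centre commute iff they are proportional. -/
theorem mul_eq_mul_of_commute {x y : AGL F 2} {e f : F} (hx : x.right = ut 1 e 1)
    (hy : y.right = ut 1 f 1) (h : x * y = y * x) :
    e * Multiplicative.toAdd y.left 1 = f * Multiplicative.toAdd x.left 1 := by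
  have h1 := congrArg (fun z : AGL F 2 => Multiplicative.toAdd z.left 0) h
  simp only [toAdd_mul_left] at h1
  rw [hx, hy] at h1
  simp at h1
  linear_combination h1

/-- An elementary abelian subgroup of order `q²` of the standard Sylow subgroup. -/
def diagAb : Subgroup (AGL F 2) where
  carrier := {x | x.right = ut 1 (Multiplicative.toAdd x.left 1) 1}
  one_mem' := ut_one.symm
  mul_mem' := by
    intro x y hx hy
    rw [Set.mem_ofPred_eq] at hx hy ⊢
    rw [toAdd_mul_left, SemidirectProduct.mul_right, hx, hy, ut_mul]
    ext i j
    fin_cases i <;> fin_cases j <;> simp [add_comm]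
  inv_mem' := by
    intro x hx
    rw [Set.mem_ofPred_eq] at hx ⊢
    have h := congrArg (fun z : AGL F 2 => Multiplicative.toAdd z.left 1) (mul_inv_cancel x)
    simp only [toAdd_mul_left] at h
    rw [hx] at h
    simp at h
    rw [SemidirectProduct.inv_right, hx, ut_inv]
    ext i j
    fin_cases i <;> fin_cases j <;> simp
    linear_combination h

theorem mem_diagAb {x : AGL F 2} :
    x ∈ diagAb ↔ x.right = ut 1 (Multiplicative.toAdd x.left 1) 1 := Iff.rfl

/-- The elements of the standard Sylow subgroup whose coordinates `(e, v₁)` lie on a given line. -/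
def lineSet (a b : F) : Set (AGL F 2) :=
  {x | ∃ e, x.right = ut 1 e 1 ∧ e * b = Multiplicative.toAdd x.left 1 * a}

theorem ncard_lineSet_le [Finite F] {a b : F} (h : a ≠ 0 ∨ b ≠ 0) :
    (lineSet a b).ncard ≤ Nat.card F ^ 2 := by
  rw [sq, ← Nat.card_prod, ← Set.ncard_univ]
  rcases h with ha | hb
  · refine Set.ncard_le_ncard_of_injOn (fun x : AGL F 2 =>
      (Multiplicative.toAdd x.left 0, x.right.val 0 1)) (fun _ _ => Set.mem_univ _) ?_
    rintro x ⟨e, hx, hx'⟩ y ⟨f, hy, hy'⟩ h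
    simp [hx, hy] at h
    obtain ⟨h0, rfl⟩ := h
    have h1 : Multiplicative.toAdd x.left 1 = Multiplicative.toAdd y.left 1 :=
      mul_right_cancel₀ ha (hx'.symm.trans hy')
    refine SemidirectProduct.ext (Multiplicative.toAdd.injective (funext fun i => ?_))
      (hx.trans hy.symm)
    fin_cases i
    · exact h0
    · exact h1
  · refine Set.ncard_le_ncard_of_injOn (fun x : AGL F 2 =>
      (Multiplicative.toAdd x.left 0, Multiplicative.toAdd x.left 1))
      (fun _ _ => Set.mem_univ _) ?_
    rintro x ⟨e, hx, hx'⟩ y ⟨f, hy, hy'⟩ h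
    simp at h
    obtain ⟨h0, h1⟩ := h
    have h2 : e = f := mul_right_cancel₀ hb (by rw [hx', hy', h1])
    refine SemidirectProduct.ext (Multiplicative.toAdd.injective (funext fun i => ?_))
      (by rw [hx, hy, h2])
    fin_cases i
    · exact h0
    · exact h1

theorem map_K2S {S S' : Sylow 3 (ASL F 2)} (e : AGL F 2 ≃* AGL F 2)
    (h : sylowInAGL S' = (sylowInAGL S).map e.toMonoidHom) :
    K2S S' ≤ (K2S S).map e.toMonoidHom := by
  have hn : ∀ A : Subgroup (AGL F 2), ∀ y,
      e y ∈ Subgroup.normalizer (A.map e.toMonoidHom : Set (AGL F 2)) →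
        y ∈ Subgroup.normalizer (A : Set (AGL F 2)) := by
    intro A y hy
    have h1 := Subgroup.map_equiv_normalizer_eq A e
    have h2 : e y ∈ (Subgroup.normalizer (A : Set (AGL F 2))).map e.toMonoidHom := by
      rw [h1]
      exact hy
    obtain ⟨z, hz, hzy⟩ := h2
    rwa [← e.injective hzy]
  rintro x ⟨h1, h2⟩
  obtain ⟨y, rfl⟩ := e.surjective x
  refine ⟨y, ⟨hn _ _ (h ▸ h1), Subgroup.mem_iInf.2 fun A => Subgroup.mem_iInf.2 fun hA =>
    hn _ _ (Subgroup.mem_iInf.1 (Subgroup.mem_iInf.1 h2 _) ?_)⟩, rfl⟩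
  obtain ⟨a1, a2, a3, a4⟩ := hA
  refine ⟨?_, ?_, ?_, ?_⟩
  · rw [h]
    exact Subgroup.map_mono a1
  · rintro _ ⟨x, hx, rfl⟩ _ ⟨y, hy, rfl⟩
    rw [← map_mul, a2 x hx y hy, map_mul]
  · rintro _ ⟨x, hx, rfl⟩
    rw [← map_pow, a3 x hx, map_one]
  · rw [← a4]
    exact (Nat.card_congr (A.equivMapOfInjective e.toMonoidHom e.injective).toEquiv).symm

variable [Finite F] [CharP F 3]

instance : Finite (AGL F 2) := Finite.of_injective
  (fun x : AGL F 2 => (x.left, x.right)) fun x y h => by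
    rw [Prod.mk.injEq] at h
    exact SemidirectProduct.ext h.1 h.2

variable (F) in
/-- The group of affine maps with unitriangular linear part, as a Sylow subgroup. -/
noncomputable def stdSylow : Sylow 3 (ASL F 2) :=
  have : Fact (Nat.Prime 3) := ⟨Nat.prime_three⟩
  IsPGroup.toSylow (P := (affSub (wt (⊥ : Subgroup Fˣ))).subgroupOf (ASL F 2))
    (fun x => ⟨1, Subtype.ext (Subtype.ext (pow_three_of_mem_wt_bot x.2))⟩) (by
      rw [← Subgroup.relIndex, ASL_eq, affSub, affSub, Subgroup.relIndex_comap,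
        Subgroup.map_comap_eq_self_of_surjective SemidirectProduct.rightHom_surjective]
      exact not_dvd_relIndex_wt_bot)

theorem coe_stdSylow : (stdSylow F : Subgroup (ASL F 2)) =
    (affSub (wt (⊥ : Subgroup Fˣ))).subgroupOf (ASL F 2) := rfl

theorem sylowInAGL_stdSylow : sylowInAGL (stdSylow F) = affSub (wt (⊥ : Subgroup Fˣ)) := by
  rw [sylowInAGL, coe_stdSylow, Subgroup.subgroupOf_map_subtype, inf_eq_left]
  exact affSub_wt_bot_le

theorem diagAb_mem_elemAb : diagAb ∈ elemAb (stdSylow F) := by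
  have hle : (diagAb : Subgroup (AGL F 2)) ≤ affSub (wt ⊥) := fun x hx =>
    mem_affSub.2 (mem_wt_bot.2 ⟨_, hx⟩)
  refine ⟨by rwa [sylowInAGL_stdSylow], fun x hx y hy => ?_,
    fun x hx => pow_three_of_mem_wt_bot (hle hx), ?_⟩
  · rw [mem_diagAb] at hx hy
    refine SemidirectProduct.ext (Multiplicative.toAdd.injective (funext fun i => ?_)) ?_
    · rw [toAdd_mul_left, toAdd_mul_left, hx, hy]
      fin_cases i
      · simp
        ring
      · simp
        ring
    · rw [SemidirectProduct.mul_right, SemidirectProduct.mul_right, hx, hy, ut_mul, ut_mul]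
      ext i j
      fin_cases i <;> fin_cases j <;> simp [add_comm]
  · have := Fintype.ofFinite F
    rw [Nat.card_congr (Equiv.ofBijective
      (fun x : diagAb (F := F) => (Multiplicative.toAdd x.1.left : Fin 2 → F)) ⟨?_, ?_⟩)]
    · simp
    · rintro ⟨x, hx⟩ ⟨y, hy⟩ h
      have h' : x.left = y.left := h
      exact Subtype.ext (SemidirectProduct.ext h'
        (by rw [mem_diagAb.1 hx, mem_diagAb.1 hy, h']))
    · exact fun v => ⟨⟨⟨Multiplicative.ofAdd v, ut 1 (v 1) 1⟩, rfl⟩, rfl⟩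

/-- Every elementary abelian subgroup of order `q²` of the standard Sylow subgroup is the preimage
of a line. -/
theorem exists_eq_lineSet {A : Subgroup (AGL F 2)} (hA : A ∈ elemAb (stdSylow F)) :
    ∃ a b : F, (A : Set (AGL F 2)) = lineSet a b := by
  obtain ⟨h1, h2, -, h4⟩ := hA
  rw [sylowInAGL_stdSylow] at h1
  have hcard : (A : Set (AGL F 2)).ncard = Nat.card F ^ 2 := h4
  have hU : ∀ x ∈ A, ∃ e, x.right = ut 1 e 1 := fun x hx => mem_wt_bot.1 (mem_affSub.1 (h1 hx))
  -- an element of `A` outside the centre of the Sylow subgroup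
  obtain ⟨x, hx, a, hxa, hne⟩ : ∃ x ∈ A, ∃ a, x.right = ut 1 a 1 ∧
      (a ≠ 0 ∨ Multiplicative.toAdd x.left 1 ≠ 0) := by
    by_contra! hcon
    have h5 : (A : Set (AGL F 2)).ncard ≤ Nat.card F := by
      rw [← Set.ncard_univ]
      refine Set.ncard_le_ncard_of_injOn (fun x : AGL F 2 => Multiplicative.toAdd x.left 0)
        (fun _ _ => Set.mem_univ _) ?_
      intro x hx y hy h
      obtain ⟨e, he⟩ := hU x hx
      obtain ⟨f, hf⟩ := hU y hy
      obtain ⟨rfl, hx1⟩ := hcon x hx e he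
      obtain ⟨rfl, hy1⟩ := hcon y hy f hf
      refine SemidirectProduct.ext (Multiplicative.toAdd.injective (funext fun i => ?_))
        (he.trans hf.symm)
      fin_cases i
      · exact h
      · exact hx1.trans hy1.symm
    have h6 : 1 < Nat.card F := Finite.one_lt_card
    rw [hcard, sq] at h5
    nlinarith
  refine ⟨a, Multiplicative.toAdd x.left 1, Set.eq_of_subset_of_ncard_le (fun y hy => ?_)
    ((ncard_lineSet_le hne).trans hcard.ge) (Set.toFinite _)⟩
  obtain ⟨e, he⟩ := hU y hy
  refine ⟨e, he, ?_⟩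
  rw [mul_eq_mul_of_commute he hxa (h2 y hy x hx), mul_comm]

theorem K2S_stdSylow : K2S (stdSylow F) = affSub (wt (⊤ : Subgroup Fˣ)) := by
  rw [K2S, sylowInAGL_stdSylow]
  apply le_antisymm
  · rintro x ⟨h1, h2⟩
    obtain ⟨l, e, m, hx⟩ := mem_borel_of_mem_normalizer h1
    have h3 : x ∈ Subgroup.normalizer (diagAb (F := F) : Set (AGL F 2)) :=
      Subgroup.mem_iInf.1 (Subgroup.mem_iInf.1 h2 _) diagAb_mem_elemAb
    have h4 := (Subgroup.mem_normalizer_iff.1 h3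
      ⟨Multiplicative.ofAdd ![0, 1], ut 1 1 1⟩).1 rfl
    have h5 := (mem_diagAb.1 h4).symm.trans (conj_right hx rfl)
    rw [toAdd_conj_left_one hx rfl] at h5
    have h6 := (ut_inj h5).2.1
    simp at h6
    have h7 : l = m ^ 2 := Units.ext (by
      rw [Units.val_pow_eq_pow_val, sq]
      field_simp at h6
      linear_combination -h6)
    exact mem_affSub.2 ⟨m, Subgroup.mem_top _, e, by rw [hx, h7]⟩
  · refine le_inf affSub_wt_le_normalizer (le_iInf₂ fun A hA => ?_)
    rw [Subgroup.le_normalizer_iff]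
    intro x hx y hy
    obtain ⟨a, b, hab⟩ := exists_eq_lineSet hA
    rw [← SetLike.mem_coe, hab] at hy ⊢
    obtain ⟨m, -, f, hx⟩ := mem_affSub.1 hx
    obtain ⟨e, he, hl⟩ := hy
    refine ⟨_, conj_right hx he, ?_⟩
    rw [toAdd_conj_left_one hx he]
    simp
    field_simp
    linear_combination hl

theorem map_ASL2S_stdSylow :
    (ASL2S (stdSylow F)).map (ASL F 2).subtype = affSub (borel F ⊓ detSub ⊥) := by
  ext x
  constructor
  · rintro ⟨⟨x, hx⟩, h, rfl⟩
    have hd : x.right ∈ detSub ⊥ := by rwa [ASL_eq] at hx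
    refine ⟨?_, hd⟩
    have hu : (⟨1, ut 1 1 1⟩ : AGL F 2) ∈ affSub (wt (⊥ : Subgroup Fˣ)) := mem_wt_bot.2 ⟨1, rfl⟩
    have h1 : x.right * ut 1 1 1 * x.right⁻¹ ∈ wt ⊥ :=
      (Subgroup.mem_normalizer_iff.1 h ⟨_, affSub_wt_bot_le hu⟩).1 hu
    exact mem_borel_of_conj (wt_le_borel ⊥ h1)
  · intro hx
    have hA : x ∈ ASL F 2 := by
      rw [ASL_eq]
      exact affSub_mono inf_le_right hx
    refine ⟨⟨x, hA⟩, Subgroup.mem_normalizer_iff.2 fun y => ?_, rfl⟩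
    exact Subgroup.mem_normalizer_iff.1 (affSub_borel_le_normalizer (affSub_mono inf_le_left hx)) y

/-! ### Arbitrary Sylow subgroups of `ASL₂(F)` -/

theorem exists_conj_stdSylow (S : Sylow 3 (ASL F 2)) : ∃ g : ASL F 2,
    (S : Subgroup (ASL F 2)) =
      (stdSylow F : Subgroup (ASL F 2)).map (MulAut.conj g).toMonoidHom := by
  have : Fact (Nat.Prime 3) := ⟨Nat.prime_three⟩
  obtain ⟨g, hg⟩ := MulAction.exists_smul_eq (ASL F 2) (stdSylow F) S
  exact ⟨g, by rw [← hg]; rfl⟩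

theorem nonempty_ASL2S_mulEquiv (S : Sylow 3 (ASL F 2)) :
    Nonempty (ASL2S S ≃* affSub (borel F ⊓ detSub (⊥ : Subgroup Fˣ))) := by
  obtain ⟨g, hg⟩ := exists_conj_stdSylow S
  have h1 : ASL2S S = (ASL2S (stdSylow F)).map (MulAut.conj g).toMonoidHom := by
    rw [ASL2S, hg]
    exact (Subgroup.map_equiv_normalizer_eq _ (MulAut.conj g)).symm
  have h2 := (MulEquiv.subgroupMap (MulAut.conj g) (ASL2S (stdSylow F)))
  have h3 := (ASL2S (stdSylow F)).equivMapOfInjective (ASL F 2).subtype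
    (Subgroup.subtype_injective _)
  exact ⟨(MulEquiv.subgroupCongr h1).trans (h2.symm.trans (h3.trans
    (MulEquiv.subgroupCongr map_ASL2S_stdSylow)))⟩

theorem nonempty_K2S_mulEquiv (S : Sylow 3 (ASL F 2)) :
    Nonempty (K2S S ≃* affSub (wt (⊤ : Subgroup Fˣ))) := by
  obtain ⟨g, hg⟩ := exists_conj_stdSylow S
  let e : AGL F 2 ≃* AGL F 2 := MulAut.conj (g : AGL F 2)
  have h1 : sylowInAGL S = (sylowInAGL (stdSylow F)).map e.toMonoidHom := by
    rw [sylowInAGL, sylowInAGL, hg, Subgroup.map_map, Subgroup.map_map]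
    rfl
  have h2 : sylowInAGL (stdSylow F) = (sylowInAGL S).map e.symm.toMonoidHom := by
    rw [h1, Subgroup.map_map]
    convert (Subgroup.map_id _).symm
    exact MonoidHom.ext fun x => e.symm_apply_apply x
  have h3 : K2S S = (K2S (stdSylow F)).map e.toMonoidHom := by
    refine le_antisymm (map_K2S e h1) ?_
    rintro _ ⟨x, hx, rfl⟩
    obtain ⟨y, hy, hyx⟩ := map_K2S e.symm h2 hx
    rw [← hyx]
    simpa using hy
  exact ⟨(MulEquiv.subgroupCongr h3).trans ((e.subgroupMap _).symm.trans
    (MulEquiv.subgroupCongr K2S_stdSylow))⟩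

end Sylow

/-! ### Normal subgroups of index prime to 3 -/

section Index

variable {F : Type*} [Field F]

theorem ut_pow_three [CharP F 3] (e : F) : ut 1 e 1 ^ 3 = (1 : GLn F 2) := by
  rw [pow_three, ut_mul, ut_mul, ← ut_one]
  have three := three_eq_zero (F := F)
  ext i j
  fin_cases i <;> fin_cases j <;> simp
  linear_combination e * three

theorem conj_pow_three [CharP F 3] (e : F) : (wy * ut 1 e 1 * wy⁻¹) ^ 3 = (1 : GLn F 2) := by
  rw [conj_pow, ut_pow_three, mul_one, mul_inv_cancel]

theorem det_one_surjective : Function.Surjective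
    (Matrix.GeneralLinearGroup.det : GLn F 1 →* Fˣ) := fun m =>
  ⟨Matrix.GeneralLinearGroup.mkOfDetNeZero !![(m : F)] (by simp), Units.ext (by
    simp [Matrix.GeneralLinearGroup.mkOfDetNeZero])⟩

theorem det_one_injective : Function.Injective
    (Matrix.GeneralLinearGroup.det : GLn F 1 →* Fˣ) := by
  intro M N h
  have h1 := congrArg Units.val h
  rw [Matrix.GeneralLinearGroup.val_det_apply, Matrix.GeneralLinearGroup.val_det_apply,
    Matrix.det_fin_one, Matrix.det_fin_one] at h1
  ext i j
  rw [Subsingleton.elim i 0, Subsingleton.elim j 0]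
  exact h1

variable [Finite F] [CharP F 3]

theorem indexSub_GL_two (D : Subgroup Fˣ) : indexSub (GLn F 2) D.index = detSub D := by
  refine indexSub_eq_comap _ det_surjective (three_not_dvd_card_units F) ?_ D
  intro N hN hi M hM
  refine mem_of_det_eq_one (fun e => ?_) (fun e => ?_) (mem_detSub_bot.1 hM)
  · exact mem_of_pow_eq_one Nat.prime_three hN hi (ut_pow_three e)
  · exact mem_of_pow_eq_one Nat.prime_three hN hi (conj_pow_three e)

theorem indexSub_GL_one (D : Subgroup Fˣ) : indexSub (GLn F 1) D.index =
    D.comap Matrix.GeneralLinearGroup.det := by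
  refine indexSub_eq_comap _ det_one_surjective (three_not_dvd_card_units F) ?_ D
  intro N _ _
  rw [(MonoidHom.ker_eq_bot_iff _).2 det_one_injective]
  exact bot_le

theorem indexSub_AGL_two (D : Subgroup Fˣ) : indexSub (AGL F 2) D.index = affSub (detSub D) := by
  let χ : AGL F 2 →* Fˣ :=
    (Matrix.GeneralLinearGroup.det : GLn F 2 →* Fˣ).comp SemidirectProduct.rightHom
  have hχ : Function.Surjective χ := fun m =>
    ⟨⟨1, (det_surjective m).choose⟩, (det_surjective m).choose_spec⟩
  refine indexSub_eq_comap χ hχ (three_not_dvd_card_units F) ?_ D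
  intro N hN hi x hx
  rw [← SemidirectProduct.inl_left_mul_inr_right x]
  refine mul_mem (mem_of_pow_eq_one Nat.prime_three hN hi ?_) ?_
  · have h : x.left ^ 3 = 1 := Multiplicative.toAdd.injective (funext fun i => by
      rw [toAdd_pow, Pi.smul_apply, nsmul_eq_mul, Nat.cast_ofNat, three_eq_zero, zero_mul]
      rfl)
    rw [← map_pow, h, map_one]
  · refine mem_of_det_eq_one (K := N.comap SemidirectProduct.inr) (fun e => ?_) (fun e => ?_)
      (mem_detSub_bot.1 hx)
    · exact mem_of_pow_eq_one Nat.prime_three hN hi (by rw [← map_pow, ut_pow_three, map_one])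
    · exact mem_of_pow_eq_one Nat.prime_three hN hi (by rw [← map_pow, conj_pow_three, map_one])

theorem kap_ut (m : Fˣ) (e : F) : kap (ut (m ^ 2) e m) = m :=
  (kap_eq_of_det_eq (by simp)).trans (kap_ut_sq m)

theorem indexSub_affSub_wt (D : Subgroup Fˣ) :
    indexSub (affSub (wt (⊤ : Subgroup Fˣ))) D.index =
      (affSub (wt D)).subgroupOf (affSub (wt ⊤)) := by
  let χ : affSub (wt (⊤ : Subgroup Fˣ)) →* Fˣ :=
    (kap.comp SemidirectProduct.rightHom).comp (affSub (wt ⊤)).subtype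
  have hχ : ∀ x m e, x.1.right = ut (m ^ 2) e m → χ x = m := fun x m e h =>
    (congrArg kap h).trans (kap_ut m e)
  have hs : Function.Surjective χ := fun m =>
    ⟨⟨⟨1, ut (m ^ 2) 0 m⟩, m, Subgroup.mem_top _, 0, rfl⟩, hχ _ m 0 rfl⟩
  rw [indexSub_eq_comap χ hs (three_not_dvd_card_units F) ?_ D]
  · ext x
    rw [Subgroup.mem_comap, Subgroup.mem_subgroupOf]
    obtain ⟨m, -, e, hx⟩ := mem_affSub.1 x.2
    rw [hχ x m e hx]
    constructor
    · exact fun h => mem_affSub.2 ⟨m, h, e, hx⟩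
    · intro h
      obtain ⟨m', hm', e', hx'⟩ := mem_affSub.1 h
      rwa [(ut_inj (hx.symm.trans hx')).2.2]
  · intro N hN hi x hx
    obtain ⟨m, -, e, h⟩ := mem_affSub.1 x.2
    have hm : m = 1 := (hχ x m e h).symm.trans hx
    refine mem_of_pow_eq_one Nat.prime_three hN hi (Subtype.ext (pow_three_of_mem_wt_bot ?_))
    exact mem_wt_bot.2 ⟨e, h.trans (by rw [hm, one_pow])⟩

theorem nonempty_indexSub_K2S_mulEquiv (S : Sylow 3 (ASL F 2)) (D : Subgroup Fˣ) :
    Nonempty (affSub (wt D) ≃* indexSub (K2S S) D.index) := by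
  obtain ⟨e⟩ := nonempty_K2S_mulEquiv S
  obtain ⟨e'⟩ := indexSub_congr e D.index
  rw [indexSub_affSub_wt] at e'
  exact ⟨(e'.trans (Subgroup.subgroupOfEquivOfLe
    (Subgroup.comap_mono (wt_mono le_top)))).symm⟩

end Index

/-! ### Complements and quotients -/

section Quotients

variable {F : Type*} [Field F]

theorem quotientIso_linSub_wt [Finite F] [CharP F 3] (D : Subgroup Fˣ) :
    QuotientIso (linSub (wt D)) (centralTrans (F := F)).range (affSub (wt D)) := by
  refine quotientIso_of_complement ?_ ?_ (aff.comp (affSub (wt D)).subtype) ?_ ?_ ?_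
  · intro g hg
    obtain ⟨w, rfl⟩ := mem_range_centralTrans.1 hg
    exact al_mem_linSub _ _ _
  · rw [Subgroup.le_normalizer_iff]
    rintro _ ⟨u, v, w, M, hM, rfl⟩ g hg
    obtain ⟨z, rfl⟩ := mem_range_centralTrans.1 hg
    rw [mem_range_centralTrans, conj_mul_left, lin_mul_al, mul_inv_cancel_right, al_inv, al_mul,
      al_mul]
    exact ⟨M.val.det ^ (2 * (Nat.card F / 3)) * z, by congr 1 <;> simp⟩
  · exact fun x => al_mul_lin_mem_linSub.2 x.2
  · rintro ⟨x, hx⟩ h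
    obtain ⟨w, h⟩ := mem_range_centralTrans.1 h
    change al _ _ 0 * lin x.right = al 0 0 w at h
    rw [← mul_one (al 0 0 w), ← map_one lin] at h
    obtain ⟨h0, h1, -, h2⟩ := al_mul_lin_inj h
    refine Subtype.ext (SemidirectProduct.ext (Multiplicative.toAdd.injective (funext fun i => ?_))
      h2)
    fin_cases i
    · exact h0
    · exact h1
  · rintro _ ⟨u, v, w, M, hM, rfl⟩
    obtain ⟨m, -, e, rfl⟩ := id hM
    refine ⟨⟨⟨Multiplicative.ofAdd ![u, v], ut (m ^ 2) e m⟩, hM⟩, mem_range_centralTrans.2 ?_⟩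
    change ∃ z, (al u v 0 * lin (ut (m ^ 2) e m))⁻¹ * (al u v w * lin (ut (m ^ 2) e m)) = al 0 0 z
    refine ⟨(ut (m ^ 2) e m)⁻¹.val.det ^ (2 * (Nat.card F / 3)) * w, ?_⟩
    have h : (al u v 0)⁻¹ * al u v w = al 0 0 w := by rw [al_inv, al_mul]; simp
    rw [mul_inv_rev, mul_assoc, ← mul_assoc (al u v 0)⁻¹, h, ← map_inv, ← mul_assoc, lin_mul_al,
      mul_assoc, ← map_mul, inv_mul_cancel, map_one, mul_one]
    simp

/-- The matrices `diag(m², m)`; they centralize all `ta t`. -/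
def weightHom : Fˣ →* GLn F 2 where
  toFun m := ut (m ^ 2) 0 m
  map_one' := by rw [one_pow, ut_one]
  map_mul' m n := by rw [ut_mul, mul_pow, mul_zero, zero_mul, add_zero]

/-- The diagonal matrices of determinant 1. -/
def torusHom : Fˣ →* GLn F 2 where
  toFun m := ut m 0 m⁻¹
  map_one' := by rw [inv_one, ut_one]
  map_mul' m n := by rw [ut_mul, mul_inv, mul_zero, zero_mul, add_zero]

variable {Jh : Subgroup (Equiv.Perm F)}

/-- Elements of `G₁(Ĵ)` in `linSub X` have no field automorphism part. -/
theorem eq_one_of_lin_fr_mem_linSub {X : Subgroup (GLn F 2)} {k : Fˣ} {θ : F ≃+* F}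
    (h : lin (ut (k ^ 2) 0 k) * fr θ ∈ linSub X) : θ = 1 ∧ ut (k ^ 2) 0 k ∈ X := by
  obtain ⟨u, v, w, M, hM, h⟩ := h
  have key : ∀ x : F, u = 0 ∧ (k : F) ^ 2 * θ x = M.val 0 0 * x := by
    intro x
    have h0 := congrArg (fun g : Equiv.Perm (Om F) => g (0, 0, 0)) h
    have h1 := congrArg (fun g : Equiv.Perm (Om F) => g (x, 0, 0)) h
    simp at h0 h1
    refine ⟨h0.1.symm, ?_⟩
    rw [h1.1, ← h0.1, add_zero]
  have hθ : θ = 1 := RingEquiv.ext fun x => by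
    have h1 := (key 1).2
    have h2 := (key x).2
    rw [map_one, mul_one, mul_one] at h1
    rw [← h1] at h2
    exact mul_left_cancel₀ (pow_ne_zero 2 k.ne_zero) h2
  subst hθ
  rw [map_one, mul_one, ← one_mul (lin _), ← al_zero] at h
  exact ⟨rfl, (al_mul_lin_inj h).2.2.2 ▸ hM⟩

theorem exists_stabilizer_semi (hJh : Jh ≤ AGammaL1 F) (x : MulAction.stabilizer Jh (0 : F)) :
    ∃ p : Fˣ × (F ≃+* F), (x : Jh).1 = semi p.1 p.2 := by
  obtain ⟨k, θ, h⟩ := exists_semi (hJh x.1.2) x.2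
  exact ⟨(k, θ), h⟩

/-- The isomorphism from the stabilizer of `0` in `Ĵ` to `J`. -/
noncomputable def stabilizerHom (hJh : Jh ≤ AGammaL1 F) :
    MulAction.stabilizer Jh (0 : F) →* Equiv.Perm (Om F) :=
  MonoidHom.mk' (fun x => lin (weightHom (exists_stabilizer_semi hJh x).choose.1) *
    fr (exists_stabilizer_semi hJh x).choose.2) fun x y => by
    have hx := (exists_stabilizer_semi hJh x).choose_spec
    have hy := (exists_stabilizer_semi hJh y).choose_spec
    have hxy := (exists_stabilizer_semi hJh (x * y)).choose_spec
    have h : semi _ _ = semi _ _ := (hxy.symm.trans (congrArg₂ (· * ·) hx hy)).trans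
      (semi_mul _ _ _ _)
    obtain ⟨h1, h2⟩ := semi_injective h
    rw [h1, h2, lin_fr_mul]
    congr 2
    change ut _ _ _ = ut _ _ _ * frGL _ (ut _ _ _)
    rw [frGL_ut, ut_mul, map_pow, map_zero, mul_zero, zero_mul, add_zero, mul_pow]

theorem stabilizerHom_apply (hJh : Jh ≤ AGammaL1 F) {x : MulAction.stabilizer Jh (0 : F)}
    {k : Fˣ} {θ : F ≃+* F} (h : (x : Jh).1 = semi k θ) :
    stabilizerHom hJh x = lin (ut (k ^ 2) 0 k) * fr θ := by
  obtain ⟨h1, h2⟩ := semi_injective (h.symm.trans (exists_stabilizer_semi hJh x).choose_spec)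
  rw [h1, h2]
  rfl

variable [Finite F] [CharP F 3]

/-- The group of the `ta t`. -/
noncomputable def taHom : Ele F 1 →* Equiv.Perm (Om F) where
  toFun z := ta (Multiplicative.toAdd z 0)
  map_one' := ta_zero
  map_mul' y z := by rw [ta_mul, toAdd_mul, Pi.add_apply]

variable (F) in
/-- The copy of `AGL₁(F)` whose translations are the `ta t`: the diagonal matrix
`diag(κ, κ⁻¹)` acts on them as the scalar `κ³`, so `m ∈ GL₁(F)` is sent to the one with
`κ = m ^ ε`. -/
noncomputable def affOne : AGL F 1 →* Equiv.Perm (Om F) :=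
  SemidirectProduct.lift taHom ((lin.comp torusHom).comp
    ((powMonoidHom (Nat.card F / 3)).comp Matrix.GeneralLinearGroup.det)) fun M =>
    MonoidHom.ext fun z => by
      change ta (M.val.mulVec (Multiplicative.toAdd z) 0) =
        lin (ut _ 0 _⁻¹) * ta (Multiplicative.toAdd z 0) * (lin (ut _ 0 _⁻¹))⁻¹
      rw [eq_mul_inv_iff_mul_eq]
      refine (lin_mul_ta (by simp) ?_).symm
      have h : M.val.mulVec (Multiplicative.toAdd z) 0 =
          (Matrix.GeneralLinearGroup.det M : F) * Multiplicative.toAdd z 0 := by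
        simp [Matrix.mulVec, dotProduct]
      rw [h, ← pow_eps_cube (Matrix.GeneralLinearGroup.det M : F)]
      simp
      field_simp

/-- The complement of `linSub (wt ⊥)` in `G2J (mulSub D)` has a direct factor of matrices
`diag(m², m)` and a direct factor isomorphic to `AGL₁(F)`. -/
theorem isSplitBy_G2J (D : Subgroup Fˣ) :
    IsSplitBy (G2J (mulSub D)) (linSub (wt ⊥)) (indexSub (GLn F 1) D.index × AGL F 1) := by
  rw [indexSub_GL_one]
  let f : D.comap (Matrix.GeneralLinearGroup.det : GLn F 1 →* Fˣ) →* Equiv.Perm (Om F) :=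
    (lin.comp weightHom).comp (Matrix.GeneralLinearGroup.det.comp (Subgroup.subtype _))
  have hw : ∀ (m : Fˣ) (t : F), lin (weightHom m) * ta t = ta t * lin (weightHom m) := fun m t =>
    lin_mul_ta (M := ut (m ^ 2) 0 m) (by simp) (by simp [mul_comm])
  have hc : ∀ x y, Commute (f x) (affOne F y) := by
    intro x y
    change lin (weightHom _) * (ta _ * lin (torusHom _)) =
      ta _ * lin (torusHom _) * lin (weightHom _)
    rw [← mul_assoc, hw, mul_assoc, mul_assoc, ← map_mul, ← map_mul]
    congr 2
    change ut _ _ _ * ut _ _ _ = ut _ _ _ * ut _ _ _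
    rw [ut_mul, ut_mul]
    congr 1
    · exact mul_comm _ _
    · simp
    · exact mul_comm _ _
  let φ := f.noncommCoprod (affOne F) hc
  have hv : ∀ x y, φ (x, y) = ta (Multiplicative.toAdd y.left 0) *
      lin (ut (Matrix.GeneralLinearGroup.det x.1 ^ 2 *
        Matrix.GeneralLinearGroup.det y.right ^ (Nat.card F / 3)) 0
        (Matrix.GeneralLinearGroup.det x.1 *
        (Matrix.GeneralLinearGroup.det y.right ^ (Nat.card F / 3))⁻¹)) := by
    intro x y
    change lin (weightHom _) * (ta _ * lin (torusHom _)) = _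
    rw [← mul_assoc, hw, mul_assoc, ← map_mul]
    change ta _ * lin (ut _ _ _ * ut _ _ _) = _
    rw [ut_mul, mul_zero, zero_mul, add_zero]
    rfl
  have hi : ∀ p, φ p ∈ linSub (wt (⊥ : Subgroup Fˣ)) → p = 1 := by
    rintro ⟨x, y⟩ h
    rw [hv] at h
    obtain ⟨u, v, w, M, hM, h⟩ := h
    obtain ⟨e, rfl⟩ := mem_wt_bot.1 hM
    have h1 := congrArg quadCoeff h
    have h2 := quadCoeff_eq 0 0 0 (Multiplicative.toAdd y.left 0)
      (ut (Matrix.GeneralLinearGroup.det x.1 ^ 2 *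
        Matrix.GeneralLinearGroup.det y.right ^ (Nat.card F / 3)) 0
        (Matrix.GeneralLinearGroup.det x.1 *
        (Matrix.GeneralLinearGroup.det y.right ^ (Nat.card F / 3))⁻¹)) 1 (by simp)
    have h3 := quadCoeff_eq u v w 0 (ut 1 e 1) 1 (by simp)
    rw [al_zero, one_mul, map_one, mul_one] at h2
    rw [ta_zero, mul_one, map_one, mul_one] at h3
    rw [h2, h3, zero_mul] at h1
    have ht : Multiplicative.toAdd y.left 0 = 0 :=
      (mul_eq_zero.1 h1).resolve_right (pow_ne_zero 2 (Units.ne_zero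
        (Matrix.GeneralLinearGroup.det x.1 *
          (Matrix.GeneralLinearGroup.det y.right ^ (Nat.card F / 3))⁻¹)))
    rw [ht, ta_zero, ← al_zero] at h
    obtain ⟨h4, -, h5⟩ := ut_inj (al_mul_lin_inj h).2.2.2
    have h6 := mul_inv_eq_one.1 h5
    rw [← h6, ← pow_succ] at h4
    have h7 : Matrix.GeneralLinearGroup.det x.1 = 1 :=
      Units.ext (eq_one_of_pow_three_pow (k := 1) (by
        rw [← Units.val_pow_eq_pow_val, pow_one, h4, Units.val_one]))
    have h8 : Matrix.GeneralLinearGroup.det y.right = 1 := by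
      rw [← units_pow_eps_cube (Matrix.GeneralLinearGroup.det y.right), ← h6, h7, one_pow]
    refine Prod.ext (Subtype.ext (det_one_injective (h7.trans (map_one _).symm)))
      (SemidirectProduct.ext (Multiplicative.toAdd.injective (funext fun i => ?_))
      (det_one_injective (h8.trans (map_one _).symm)))
    rw [Subsingleton.elim i 0]
    exact ht
  have hle : linSub (wt (⊥ : Subgroup Fˣ)) ≤ G2J (mulSub D) :=
    (linSub_wt_le bot_le).trans (linSub_borel_le_G2J D)
  have hφ : Function.Injective φ := (injective_iff_map_eq_one _).2 fun p hp =>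
    hi p (hp ▸ one_mem _)
  refine ⟨hle, (Subgroup.normal_subgroupOf_iff_le_normalizer hle).2 (G2J_le_normalizer ⊥),
    φ.range, ?_, ?_, ⟨(MonoidHom.ofInjective hφ).symm⟩⟩
  · rw [eq_bot_iff]
    rintro _ ⟨⟨p, rfl⟩, h⟩
    rw [hi p h, map_one]
    exact one_mem _
  · refine le_antisymm (sup_le ?_ hle) fun g hg => ?_
    · rintro _ ⟨⟨x, y⟩, rfl⟩
      rw [hv]
      refine mul_mem (ta_mem_G2J _) (lin_mem_G2J (by simp) (inJ_mulSub.2 ⟨rfl, mem_detSub.2 ?_⟩))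
      rw [det_ut, mul_mul_mul_comm, mul_inv_cancel, mul_one]
      have hx : Matrix.GeneralLinearGroup.det x.1 ∈ D := x.2
      exact mul_mem (pow_mem hx 2) hx
    · obtain ⟨u, v, w, t, M, θ, h0, hM, rfl⟩ := mem_G2J.1 hg
      obtain ⟨l, e, m, rfl⟩ := eq_ut h0
      obtain ⟨rfl, hD⟩ := inJ_mulSub.1 hM
      rw [mem_detSub, det_ut] at hD
      have hu : ut l e m = ut l 0 m * ut 1 ((l⁻¹ : Fˣ) * e) 1 := by
        rw [ut_mul]
        simp
      rw [map_one, mul_one, hu, map_mul, mul_assoc, ← mul_assoc (ta t)]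
      refine mul_mem (Subgroup.mem_sup_right (al_mem_linSub _ _ _)) (mul_mem
        (Subgroup.mem_sup_left ?_)
        (Subgroup.mem_sup_right (lin_mem_linSub (mem_wt_bot.2 ⟨_, rfl⟩))))
      -- the two components are the cube root `μ` of the determinant `l m` and `l μ⁻²`
      set μ : Fˣ := (l * m) ^ (Nat.card F / 3) with hμ
      have hμ3 : μ ^ 3 = l * m := units_pow_eps_cube _
      obtain ⟨X, hX⟩ := det_one_surjective μ
      obtain ⟨Y, hY⟩ := det_one_surjective ((l * (μ ^ 2)⁻¹) ^ 3)
      refine ⟨(⟨X, ?_⟩, ⟨Multiplicative.ofAdd fun _ => t, Y⟩), ?_⟩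
      · rw [Subgroup.mem_comap, hX]
        exact pow_mem hD _
      · rw [hv]
        change ta t * lin (ut (Matrix.GeneralLinearGroup.det X ^ 2 *
          Matrix.GeneralLinearGroup.det Y ^ (Nat.card F / 3)) 0
          (Matrix.GeneralLinearGroup.det X *
          (Matrix.GeneralLinearGroup.det Y ^ (Nat.card F / 3))⁻¹)) = _
        rw [hX, hY, units_cube_pow_eps, mul_inv_rev, inv_inv, mul_comm l, mul_inv_cancel_left,
          ← mul_assoc, ← pow_succ', hμ3, mul_comm l, mul_inv_cancel_right]

theorem quotientIso_G1J (hJh : Jh ≤ AGammaL1 F) :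
    QuotientIso (G1J Jh) (linSub (detSub ⊥)) (MulAction.stabilizer Jh (0 : F)) := by
  have hle : linSub (detSub ⊥) ≤ G1J Jh := (linSub_mono (detSub_mono bot_le)).trans
    linSub_detSub_le_G1J
  refine quotientIso_of_complement hle (G1J_le_normalizer ⊥) (stabilizerHom hJh) ?_ ?_ ?_
  · intro x
    obtain ⟨⟨k, θ⟩, h⟩ := exists_stabilizer_semi hJh x
    rw [stabilizerHom_apply hJh h]
    refine lin_fr_mem_G1J ?_
    rw [InJ, kap_ut_sq, ← h]
    exact x.1.2
  · intro x hx
    obtain ⟨⟨k, θ⟩, h⟩ := exists_stabilizer_semi hJh x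
    rw [stabilizerHom_apply hJh h] at hx
    obtain ⟨h1, h2⟩ := eq_one_of_lin_fr_mem_linSub hx
    have h3 : k = 1 := by
      rw [← kap_ut_sq k]
      exact kap_one_of_det (mem_detSub_bot.1 h2)
    refine Subtype.ext (Subtype.ext (h.trans ?_))
    change semi k θ = 1
    rw [show θ = 1 from h1, h3, semi_one]
  · intro g hg
    obtain ⟨u, v, w, M, θ, hM, rfl⟩ := mem_G1J.1 hg
    let x : MulAction.stabilizer Jh (0 : F) := ⟨⟨semi (kap M) θ, hM⟩, by
      change semi (kap M) θ 0 = 0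
      simp⟩
    obtain ⟨N, hN, hMN⟩ := exists_eq_mul_ut M
    have hx : stabilizerHom hJh x = lin (ut (kap M ^ 2) 0 (kap M)) * fr θ :=
      stabilizerHom_apply hJh rfl
    have hxG : stabilizerHom hJh x ∈ G1J Jh := by
      rw [hx]
      refine lin_fr_mem_G1J ?_
      rwa [InJ, kap_ut_sq]
    have h : al u v w * (lin M * fr θ) = al u v w * lin N * stabilizerHom hJh x := by
      rw [hx, mul_assoc, ← mul_assoc (lin N), ← map_mul, ← hMN]
    refine ⟨x, ?_⟩
    have h1 := Subgroup.le_normalizer_iff.1 (G1J_le_normalizer (Jh := Jh) ⊥) _ (inv_mem hxG)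
      (al u v w * lin N) (al_mul_lin_mem_linSub.2 (mem_detSub_bot.2 hN))
    rwa [inv_inv, mul_assoc, ← h] at h1

end Quotients

/-! ### The scalars in a 2-transitive group -/

section Arithmetic

theorem two_pow_dvd_three_pow_sub_one (k : ℕ) : 2 ^ (k + 1) ∣ 3 ^ 2 ^ k - 1 := by
  induction k with
  | zero => norm_num
  | succ k ih =>
    have h1 : 3 ^ 2 ^ (k + 1) - 1 = (3 ^ 2 ^ k + 1) * (3 ^ 2 ^ k - 1) := by
      rw [pow_succ 2 k, pow_mul, ← Nat.sq_sub_sq, one_pow]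
    have h2 : 2 ∣ 3 ^ 2 ^ k + 1 := by
      have : Odd (3 ^ 2 ^ k) := Odd.pow (by decide)
      exact this.add_one.two_dvd
    rw [h1, pow_succ' 2 (k + 1)]
    exact mul_dvd_mul h2 ih

/-- If `3ʳ - 1 = n d` with `d ∣ r`, then `n` is even: `3ʳ - 1` is divisible by a higher power of 2
than `r`. -/
theorem two_dvd_of_mul_eq {n d r : ℕ} (hr : r ≠ 0) (h : n * d = 3 ^ r - 1) (hd : d ∣ r) :
    2 ∣ n := by
  by_contra hn
  obtain ⟨k, m, hm, rfl⟩ := Nat.exists_eq_two_pow_mul_odd hr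
  have h1 : 2 ^ (k + 1) ∣ n * d := by
    rw [h, pow_mul]
    exact (two_pow_dvd_three_pow_sub_one k).trans (by
      simpa using Nat.sub_dvd_pow_sub_pow (3 ^ 2 ^ k) 1 m)
  have h2 : 2 ^ (k + 1) ∣ 2 ^ k * m :=
    (Nat.Coprime.dvd_of_dvd_mul_left
      (Nat.Coprime.pow_left _ ((Nat.Prime.coprime_iff_not_dvd Nat.prime_two).2 hn)) h1).trans hd
  rw [pow_succ] at h2
  have h3 := Nat.dvd_of_mul_dvd_mul_left (pow_pos two_pos k) h2
  exact (Nat.not_even_iff_odd.2 hm) (even_iff_two_dvd.2 h3)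

variable {F : Type*} [Field F]

theorem eq_one_or_neg_one_of_mem_sqrtOne {m : Fˣ} (h : m ∈ sqrtOne F) : m = 1 ∨ m = -1 := by
  have h1 : (m : F) * m = 1 := by
    rw [← sq, ← Units.val_pow_eq_pow_val, mem_sqrtOne.1 h, Units.val_one]
  rcases mul_self_eq_one_iff.1 h1 with h2 | h2
  · exact Or.inl (Units.ext h2)
  · exact Or.inr (Units.ext (by simpa using h2))

theorem neg_one_ne_one_units [CharP F 3] : (-1 : Fˣ) ≠ 1 := fun h => by
  have h1 : (-1 : F) = 1 := by simpa using congrArg Units.val h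
  exact two_ne_zero_of_char_three (F := F) (by linear_combination -h1)

variable {Jh : Subgroup (Equiv.Perm F)}

/-- The field automorphism part of an element of `Ĵ` fixing `0`. -/
noncomputable def autPart (hJh : Jh ≤ AGammaL1 F) :
    MulAction.stabilizer Jh (0 : F) →* (F ≃+* F) :=
  MonoidHom.mk' (fun x => (exists_stabilizer_semi hJh x).choose.2) fun x y => by
    have hx := (exists_stabilizer_semi hJh x).choose_spec
    have hy := (exists_stabilizer_semi hJh y).choose_spec
    have hxy := (exists_stabilizer_semi hJh (x * y)).choose_spec
    have h : semi _ _ = semi _ _ := (hxy.symm.trans (congrArg₂ (· * ·) hx hy)).trans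
      (semi_mul _ _ _ _)
    exact (semi_injective h).2

theorem eq_semi_autPart (hJh : Jh ≤ AGammaL1 F) (x : MulAction.stabilizer Jh (0 : F)) :
    ∃ k, (x : Jh).1 = semi k (autPart hJh x) :=
  ⟨_, (exists_stabilizer_semi hJh x).choose_spec⟩

variable [Finite F] [CharP F 3]

variable (F) in
theorem exists_card_eq_three_pow : ∃ r, r ≠ 0 ∧ Nat.card F = 3 ^ r := by
  have := Fintype.ofFinite F
  obtain ⟨r, -, h⟩ := FiniteField.card F 3
  exact ⟨r, r.ne_zero, by rw [Nat.card_eq_fintype_card, h]⟩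

theorem index_sqrtOne : (sqrtOne F).index = (Nat.card F - 1) / 2 := by
  have := Fintype.ofFinite F
  have h1 : Nat.card (sqrtOne F) = 2 := by
    rw [Nat.card_eq_two_iff]
    refine ⟨1, ⟨-1, mem_sqrtOne.2 (by simp)⟩, fun h => neg_one_ne_one_units
      (congrArg Subtype.val h).symm, ?_⟩
    rw [Set.eq_univ_iff_forall]
    rintro ⟨m, hm⟩
    rcases eq_one_or_neg_one_of_mem_sqrtOne hm with rfl | rfl
    · exact Or.inl rfl
    · exact Or.inr rfl
  have h2 := (sqrtOne F).card_mul_index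
  rw [h1, Nat.card_units] at h2
  omega

/-- The order of the automorphism group of a field of order `3ʳ` divides `r`. -/
theorem card_ringAut_dvd {r : ℕ} (h : Nat.card F = 3 ^ r) : Nat.card (F ≃+* F) ∣ r := by
  have := Fintype.ofFinite F
  have h1 : Subgroup.zpowers (frobeniusEquiv F 3 : F ≃+* F) = ⊤ := by
    rw [eq_top_iff]
    intro θ _
    obtain ⟨n, rfl⟩ := exists_frobenius_pow F θ
    exact pow_mem (Subgroup.mem_zpowers _) n
  rw [← Subgroup.card_top, ← h1, Nat.card_zpowers]
  refine orderOf_dvd_of_pow_eq_one (RingEquiv.ext fun x => ?_)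
  rw [frobeniusEquiv_pow_apply, ← h, Nat.card_eq_fintype_card, FiniteField.pow_card]
  rfl

/-- As `Ĵ` is 2-transitive, the stabilizer of `0` is transitive on `Fˣ`. Its subgroup `scal Jh` of
multiplications has index dividing the order of the automorphism group of `F`, and this forces it to
contain `-1`. -/
theorem sqrtOne_le_scal (hJh : IsTwoTransSub F Jh) : sqrtOne F ≤ scal Jh := by
  obtain ⟨r, hr, hq⟩ := exists_card_eq_three_pow F
  have := Fintype.ofFinite F
  have : Finite (Equiv.Perm F) := inferInstance
  -- the order of the kernel of `autPart`
  have h1 : Nat.card (autPart hJh.1).ker ∣ Nat.card (scal Jh) := by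
    let f : (autPart hJh.1).ker →* Equiv.Perm F :=
      Jh.subtype.comp ((Subgroup.subtype _).comp (Subgroup.subtype _))
    have hf : Function.Injective f := fun x y h => Subtype.ext (Subtype.ext (Subtype.ext h))
    have hr : f.range ≤ mulSub (scal Jh) := by
      rintro _ ⟨⟨x, hx⟩, rfl⟩
      obtain ⟨k, hk⟩ := eq_semi_autPart hJh.1 x
      rw [MonoidHom.mem_ker.1 hx] at hk
      refine ⟨k, ?_, hk⟩
      change semi k 1 ∈ Jh
      rw [← hk]
      exact x.1.2
    have hs : Nat.card (mulSub (scal Jh)) = Nat.card (scal Jh) := by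
      refine (Nat.card_congr (Equiv.ofBijective
        (fun m : scal Jh => (⟨semi m 1, m, m.2, rfl⟩ : mulSub (scal Jh))) ⟨?_, ?_⟩)).symm
      · exact fun m n h => Subtype.ext (semi_injective (congrArg Subtype.val h)).1
      · rintro ⟨_, m, hm, rfl⟩
        exact ⟨⟨m, hm⟩, rfl⟩
    rw [← hs, Nat.card_congr (MonoidHom.ofInjective hf).toEquiv]
    exact Subgroup.card_dvd_of_le hr
  have h2 : Nat.card (autPart hJh.1).range ∣ r :=
    (Subgroup.card_subgroup_dvd_card _).trans (card_ringAut_dvd hq)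
  -- the orbit of `1` under the stabilizer of `0`
  have h3 : MulAction.orbit (MulAction.stabilizer Jh (0 : F)) (1 : F) = {0}ᶜ := by
    ext y
    rw [Set.mem_compl_iff, Set.mem_singleton_iff]
    constructor
    · rintro ⟨x, rfl⟩ h
      have h4 : (x : Jh) • (0 : F) = (x : Jh) • (1 : F) := x.2.trans h.symm
      exact zero_ne_one (MulAction.injective _ h4)
    · intro hy
      obtain ⟨g, h0, h1⟩ := MulAction.is_two_pretransitive_iff.1 hJh.2 (zero_ne_one (α := F))
        (Ne.symm hy)
      exact ⟨⟨g, h0⟩, h1⟩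
  have h4 : Nat.card F - 1 ∣ Nat.card (MulAction.stabilizer Jh (0 : F)) := by
    have h5 : Nat.card (MulAction.orbit (MulAction.stabilizer Jh (0 : F)) (1 : F)) =
        Nat.card F - 1 := by
      rw [h3, Nat.card_coe_set_eq, Set.ncard_compl, Set.ncard_singleton]
    rw [← h5, Nat.card_congr (MulAction.orbitEquivQuotientStabilizer _ (1 : F))]
    exact Subgroup.card_quotient_dvd_card _
  have h6 : Nat.card (MulAction.stabilizer Jh (0 : F)) ∣ Nat.card (scal Jh) * r := by
    rw [← (autPart hJh.1).ker.card_mul_index, Subgroup.index_ker]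
    exact mul_dvd_mul h1 h2
  have h7 : Nat.card (scal Jh) * (scal Jh).index = Nat.card F - 1 := by
    rw [Subgroup.card_mul_index, Nat.card_units]
  have h8 : (scal Jh).index ∣ r :=
    Nat.dvd_of_mul_dvd_mul_left Nat.card_pos (h7 ▸ h4.trans h6)
  have : Fact (Nat.Prime 2) := ⟨Nat.prime_two⟩
  obtain ⟨x, hx⟩ := exists_prime_orderOf_dvd_card' 2 (two_dvd_of_mul_eq hr (hq ▸ h7) h8)
  have h9 : (x : Fˣ) ∈ sqrtOne F := mem_sqrtOne.2 (by
    have := pow_orderOf_eq_one x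
    rw [hx] at this
    exact congrArg Subtype.val this)
  have h10 : (x : Fˣ) = -1 := (eq_one_or_neg_one_of_mem_sqrtOne h9).resolve_left fun h => by
    have h11 : x = 1 := Subtype.ext h
    rw [h11, orderOf_one] at hx
    omega
  intro m hm
  rcases eq_one_or_neg_one_of_mem_sqrtOne hm with rfl | rfl
  · exact one_mem _
  · exact h10 ▸ x.2

end Arithmetic

/-! ### The core of the amalgam -/

section Core

variable {F : Type*} [Field F]

theorem linSub_detSub_bot_inf (D : Subgroup Fˣ) :
    linSub (detSub ⊥) ⊓ linSub (borel F ⊓ detSub D) = linSub (borel F ⊓ detSub ⊥) := by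
  rw [linSub_inf]
  congr 1
  refine le_antisymm (le_inf (inf_le_right.trans inf_le_left) inf_le_left)
    (le_inf inf_le_right (inf_le_inf_left _ (detSub_mono bot_le)))

theorem nonempty_mulEquiv_of_map {G P : Type*} [Group G] [Group P] {ψ : G →* P}
    (hψ : Function.Injective ψ) {A : Subgroup G} {X : Subgroup P} (h : A.map ψ = X) :
    Nonempty (A ≃* X) :=
  ⟨(A.equivMapOfInjective ψ hψ).trans (MulEquiv.subgroupCongr h)⟩

variable [Finite F] [CharP F 3] {Jh : Subgroup (Equiv.Perm F)}

theorem exists_mul_of_mem_linSub_borel {D : Subgroup Fˣ} {g : Equiv.Perm (Om F)}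
    (hg : g ∈ linSub (borel F ⊓ detSub D)) :
    ∃ x ∈ linSub (borel F ⊓ detSub ⊥), ∃ y ∈ linSub (wt D), g = x * y := by
  obtain ⟨u, v, w, M, ⟨h1, h2⟩, rfl⟩ := hg
  obtain ⟨N, hN, hM⟩ := exists_eq_mul_ut M
  have hk : ut (kap M ^ 2) 0 (kap M) ∈ wt D := ⟨_, kap_mem_iff.2 h2, 0, rfl⟩
  have hNb : N ∈ borel F := by
    rw [eq_mul_inv_of_mul_eq hM.symm]
    exact mul_mem h1 (inv_mem (wt_le_borel D hk))
  refine ⟨al u v w * lin N, al_mul_lin_mem_linSub.2 ⟨hNb, mem_detSub_bot.2 hN⟩, _,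
    lin_mem_linSub hk, ?_⟩
  rw [mul_assoc, ← map_mul, ← hM]

variable {G : Type*} [Group G] {ψ : G →* Equiv.Perm (Om F)}

/-- The structure of the core, for an amalgam in any group that is carried to the amalgam
`(G₁(Ĵ), G₂(Ĵ))` by an injective homomorphism. -/
theorem core_structure (hJh : IsTwoTransSub F Jh) (hψ : Function.Injective ψ)
    {H₁ H₂ L₁ T₂ B H₁s H₂s Z₁ R₂ : Subgroup G} (h₁ : H₁.map ψ = G1J Jh) (h₂ : H₂.map ψ = G2J Jh)
    (hL : L₁.map ψ = linSub (detSub ⊥)) (hT : T₂ = coreIn H₂ (H₁ ⊓ H₂)) (hB : B = coreB H₁ H₂)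
    (hH₁ : H₁s = conjClosure H₁ B) (hH₂ : H₂s = conjClosure H₂ B) (hZ : Z₁ = centreOf L₁)
    (hR : R₂ = pRadical 3 T₂) (S : Sylow 3 (ASL F 2)) :
    (Nonempty (L₁ ≃* Ele F 1 × ASL F 2) ∧ Nonempty (Z₁ ≃* Ele F 1) ∧
      pRadical 3 B = pRadical 3 (L₁ ⊓ B) ∧ pRadical 3 (L₁ ⊓ B) = R₂ ∧ IsSylowIn 3 R₂ L₁) ∧
    ((B : Set G) = {g | ∃ x ∈ L₁ ⊓ B, ∃ y ∈ T₂, g = x * y} ∧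
      Nonempty (↥(L₁ ⊓ B) ≃* Ele F 1 × ASL2S S) ∧
      QuotientIso T₂ Z₁ (indexSub (K2S S) (scal Jh).index)) ∧
    (IsoSemidirect H₁s (Ele F 3) (indexSub (GLn F 2) (scal Jh).index) ∧
      Nonempty (centralizerIn H₁s Z₁ ≃*
        Ele F 1 × indexSub (AGL F 2) ((Nat.card F - 1) / 2))) ∧
    (IsSplitBy H₂s R₂ (indexSub (GLn F 1) (scal Jh).index × AGL F 1) ∧
      Nonempty (centralizerIn H₂s (centreOf R₂) ≃*
        Ele F 1 × indexSub (K2S S) ((Nat.card F - 1) / 2))) ∧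
    QuotientIso H₁ L₁ (MulAction.stabilizer Jh (0 : F)) := by
  have hD : scal Jh ⊓ sqrtOne F = sqrtOne F := inf_eq_right.2 (sqrtOne_le_scal hJh)
  -- the images of all these groups under `ψ`
  have iT : T₂.map ψ = linSub (wt (scal Jh)) := by
    rw [hT, map_coreIn hψ, Subgroup.map_inf _ _ _ hψ, h₁, h₂, coreIn_G2J]
  have iB : B.map ψ = linSub (borel F ⊓ detSub (scal Jh)) := by
    rw [hB, map_coreB hψ, h₁, h₂, coreB_G1J_G2J]
  have iH₁ : H₁s.map ψ = linSub (detSub (scal Jh)) := by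
    rw [hH₁, map_conjClosure, h₁, iB, conjClosure_G1J_borel]
  have iH₂ : H₂s.map ψ = G2J (mulSub (scal Jh)) := by
    rw [hH₂, map_conjClosure, h₂, iB, conjClosure_G2J_borel]
  have iZ : Z₁.map ψ = (centralTrans (F := F)).range := by
    rw [hZ, map_centreOf hψ, hL, centreOf_linSub_detSub_bot]
  have iR : R₂.map ψ = linSub (wt ⊥) := by
    rw [hR, map_pRadical 3 hψ, iT, pRadical_linSub_wt]
  have iLB : (L₁ ⊓ B).map ψ = linSub (borel F ⊓ detSub ⊥) := by
    rw [Subgroup.map_inf _ _ _ hψ, hL, iB, linSub_detSub_bot_inf]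
  have iC₁ : (centralizerIn H₁s Z₁).map ψ = linSub (detSub (sqrtOne F)) := by
    rw [map_centralizerIn hψ, iH₁, iZ, centralizerIn_linSub_detSub, hD]
  have iC₂ : (centralizerIn H₂s (centreOf R₂)).map ψ = linSub (wt (sqrtOne F)) := by
    rw [map_centralizerIn hψ, iH₂, map_centreOf hψ, iR, centralizerIn_G2J, hD]
  have hTB : T₂ ≤ B := by
    rw [← Subgroup.map_le_map_iff_of_injective hψ, iT, iB]
    exact linSub_wt_le le_rfl
  refine ⟨⟨?_, ?_, ?_, ?_, ?_⟩, ⟨?_, ?_, ?_⟩, ⟨?_, ?_⟩, ⟨?_, ?_⟩, ?_⟩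
  · obtain ⟨e⟩ := nonempty_mulEquiv_of_map hψ hL
    obtain ⟨e'⟩ := nonempty_linSub_mulEquiv (F := F) (detSub_mono bot_le)
    rw [ASL_eq]
    exact ⟨e.trans e'⟩
  · obtain ⟨e⟩ := nonempty_mulEquiv_of_map hψ iZ
    exact ⟨e.trans (MonoidHom.ofInjective centralTrans_injective).symm⟩
  · apply Subgroup.map_injective hψ
    rw [map_pRadical 3 hψ, map_pRadical 3 hψ, iB, iLB, pRadical_linSub_borel,
      pRadical_linSub_borel]
  · apply Subgroup.map_injective hψ
    rw [map_pRadical 3 hψ, iLB, iR, pRadical_linSub_borel]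
  · have : Fact (Nat.Prime 3) := ⟨Nat.prime_three⟩
    refine isSylowIn_of_map hψ ?_
    rw [iR, hL]
    exact isSylowIn_linSub
  · ext g
    constructor
    · intro hg
      have hg' : ψ g ∈ linSub (borel F ⊓ detSub (scal Jh)) := iB ▸ Subgroup.mem_map_of_mem ψ hg
      obtain ⟨x, hx, y, hy, hxy⟩ := exists_mul_of_mem_linSub_borel hg'
      rw [← iLB] at hx
      rw [← iT] at hy
      obtain ⟨x, hx, rfl⟩ := hx
      obtain ⟨y, hy, rfl⟩ := hy
      exact ⟨x, hx, y, hy, hψ (by rw [hxy, map_mul])⟩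
    · rintro ⟨x, hx, y, hy, rfl⟩
      exact mul_mem hx.2 (hTB hy)
  · obtain ⟨e⟩ := nonempty_mulEquiv_of_map hψ iLB
    obtain ⟨e'⟩ := nonempty_linSub_mulEquiv (F := F) (X := borel F ⊓ detSub ⊥)
      (inf_le_right.trans (detSub_mono bot_le))
    obtain ⟨e''⟩ := nonempty_ASL2S_mulEquiv S
    exact ⟨e.trans (e'.trans ((MulEquiv.refl _).prodCongr e''.symm))⟩
  · obtain ⟨e⟩ := nonempty_indexSub_K2S_mulEquiv S (scal Jh)
    refine QuotientIso.congr (QuotientIso.of_map hψ ?_) e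
    rw [iT, iZ]
    exact quotientIso_linSub_wt _
  · obtain ⟨e⟩ := nonempty_mulEquiv_of_map hψ iH₁
    obtain ⟨φ, ⟨e'⟩⟩ := isoSemidirect_linSub (detSub (scal Jh))
    rw [indexSub_GL_two]
    exact ⟨φ, ⟨e.trans e'⟩⟩
  · obtain ⟨e⟩ := nonempty_mulEquiv_of_map hψ iC₁
    obtain ⟨e'⟩ := nonempty_linSub_mulEquiv (F := F) (X := detSub (sqrtOne F)) le_rfl
    rw [← index_sqrtOne, indexSub_AGL_two]
    exact ⟨e.trans e'⟩
  · refine IsSplitBy.of_map hψ ?_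
    rw [iH₂, iR]
    exact isSplitBy_G2J _
  · obtain ⟨e⟩ := nonempty_mulEquiv_of_map hψ iC₂
    obtain ⟨e'⟩ := nonempty_linSub_mulEquiv (F := F) (wt_le_detSub (sqrtOne F))
    obtain ⟨e''⟩ := nonempty_indexSub_K2S_mulEquiv S (sqrtOne F)
    rw [← index_sqrtOne]
    exact ⟨e.trans (e'.trans ((MulEquiv.refl _).prodCongr e''))⟩
  · refine QuotientIso.of_map hψ ?_
    rw [h₁, hL]
    exact quotientIso_G1J hJh.1

end Core

/-! ### The vertex stabilizers of `Δ_J` -/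

section CosetGraph

variable {G : Type*} [Group G] {H K : Subgroup G}

theorem exists_smul_inr_eq {a : G} {v : (G ⧸ H) ⊕ (G ⧸ K)}
    (hv : (cosetGraph H K).Adj (a • Sum.inl ((1 : G) : G ⧸ H)) v) :
    ∃ g : G, g • (a • Sum.inl ((1 : G) : G ⧸ H) : (G ⧸ H) ⊕ (G ⧸ K)) =
        a • Sum.inl ((1 : G) : G ⧸ H) ∧
      g • (a • Sum.inr ((1 : G) : G ⧸ K) : (G ⧸ H) ⊕ (G ⧸ K)) = v := by
  rw [Sum.smul_inl, MulAction.Quotient.smul_coe, smul_eq_mul, mul_one] at hv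
  obtain ⟨h, hh, rfl⟩ := cosetGraph_adj_inl.1 hv
  refine ⟨a * h * a⁻¹, ?_, ?_⟩
  · rw [← MulAction.mem_stabilizer_iff, mem_stabilizer_inl]
    simpa [mul_assoc] using hh
  · rw [smul_smul, inv_mul_cancel_right, Sum.smul_inr, MulAction.Quotient.smul_coe, smul_eq_mul,
      mul_one]

theorem exists_smul_inl_eq {a : G} {v : (G ⧸ H) ⊕ (G ⧸ K)}
    (hv : (cosetGraph H K).Adj (a • Sum.inr ((1 : G) : G ⧸ K)) v) :
    ∃ g : G, g • (a • Sum.inr ((1 : G) : G ⧸ K) : (G ⧸ H) ⊕ (G ⧸ K)) =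
        a • Sum.inr ((1 : G) : G ⧸ K) ∧
      g • (a • Sum.inl ((1 : G) : G ⧸ H) : (G ⧸ H) ⊕ (G ⧸ K)) = v := by
  rw [Sum.smul_inr, MulAction.Quotient.smul_coe, smul_eq_mul, mul_one] at hv
  obtain ⟨h, hh, rfl⟩ := cosetGraph_adj_inr.1 hv
  refine ⟨a * h * a⁻¹, ?_, ?_⟩
  · rw [← MulAction.mem_stabilizer_iff, mem_stabilizer_inr]
    simpa [mul_assoc] using hh
  · rw [smul_smul, inv_mul_cancel_right, Sum.smul_inl, MulAction.Quotient.smul_coe, smul_eq_mul,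
      mul_one]

end CosetGraph

section Vertices

variable {F : Type*} [Field F] [Finite F] [CharP F 3] {Jh : Subgroup (Equiv.Perm F)}

theorem ncard_neighborSet_graphDeltaJ_inl (x : GJ Jh ⧸ (G1J Jh).subgroupOf (GJ Jh)) :
    ((graphDeltaJ Jh).neighborSet (Sum.inl x)).ncard = Nat.card F + 1 := by
  have := Fintype.ofFinite F
  obtain ⟨a, rfl⟩ := QuotientGroup.mk_surjective x
  rw [ncard_neighborSet_inl a (fun i : Option F => (⟨transversal₁ i,
    Subgroup.mem_sup_left (transversal₁_mem i)⟩ : GJ Jh)) (fun i => transversal₁_mem i)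
    (fun h hh => exists_transversal₁ hh) (fun i j h => transversal₁_inj h)]
  simp

theorem ncard_neighborSet_graphDeltaJ_inr (x : GJ Jh ⧸ (G2J Jh).subgroupOf (GJ Jh)) :
    ((graphDeltaJ Jh).neighborSet (Sum.inr x)).ncard = Nat.card F := by
  obtain ⟨a, rfl⟩ := QuotientGroup.mk_surjective x
  exact ncard_neighborSet_inr a (fun t : F => (⟨ta t,
    Subgroup.mem_sup_right (ta_mem_G2J t)⟩ : GJ Jh)) (fun t => ta_mem_G2J t)
    (fun h hh => exists_transversal₂ hh) (fun i j h => transversal₂_inj h)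

variable (Jh) in
theorem isGGraph_graphDeltaJ : IsGGraph (graphDeltaJ Jh) (GJ Jh) := by
  have : Finite (Equiv.Perm (Om F)) := inferInstance
  refine isGGraph_cosetGraph ?_ fun x hx => Subtype.ext (eq_one_of_forall_conj (Jh := Jh)
    fun a ha => hx ⟨a, ha⟩)
  rw [← Subgroup.subgroupOf_sup le_sup_left le_sup_right, Subgroup.subgroupOf_self]

variable (Jh) in
/-- Conjugation by `g⁻¹`, as a homomorphism from `G(Ĵ)` to the permutations of `F³`. -/
def conjHom (g : GJ Jh) : GJ Jh →* Equiv.Perm (Om F) :=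
  (GJ Jh).subtype.comp (MulAut.conj g⁻¹).toMonoidHom

theorem conjHom_apply (g y : GJ Jh) : conjHom Jh g y = ((g⁻¹ * y * g : GJ Jh) : _) := by
  change ((g⁻¹ * y * g⁻¹⁻¹ : GJ Jh) : Equiv.Perm (Om F)) = _
  rw [inv_inv]

theorem conjHom_injective (g : GJ Jh) : Function.Injective (conjHom Jh g) :=
  (Subgroup.subtype_injective _).comp (MulAut.conj g⁻¹).injective

theorem map_conjHom {g : GJ Jh} {A : Subgroup (GJ Jh)} {K : Subgroup (Equiv.Perm (Om F))}
    (hK : K ≤ GJ Jh) (h : ∀ y, y ∈ A ↔ g⁻¹ * y * g ∈ K.subgroupOf (GJ Jh)) :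
    A.map (conjHom Jh g) = K := by
  ext x
  constructor
  · rintro ⟨y, hy, rfl⟩
    rw [conjHom_apply]
    exact (h y).1 hy
  · intro hx
    have e : g⁻¹ * (g * ⟨x, hK hx⟩ * g⁻¹) * g = ⟨x, hK hx⟩ := by group
    refine ⟨g * ⟨x, hK hx⟩ * g⁻¹, (h _).2 ?_, ?_⟩
    · rw [e]
      exact hx
    · rw [conjHom_apply, e]

end Vertices

end LocArc

theorem theorem1p2 {F : Type*} [Field F] [Finite F] [CharP F 3]
    (Jh : Subgroup (Equiv.Perm F)) (hJh : LocArc.IsTwoTransSub F Jh)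
    (htrans : ∀ b : F, Equiv.addRight b ∈ Jh) :
    -- `Δ_J` is a locally 5-arc transitive `G(Ĵ)`-graph covering `Δ`
    LocArc.IsGGraph (LocArc.graphDeltaJ Jh) (LocArc.GJ Jh) ∧
    LocArc.IsCoverOf (LocArc.graphDeltaJ Jh) (LocArc.graphDelta F) ∧
    LocArc.IsLocallyArcTransitive (LocArc.graphDeltaJ Jh) (LocArc.GJ Jh) 5 ∧
    -- it has 1-arcs `(x₁, x₂)` with `q + 1` and `q` neighbours at the two ends
    (∃ x₁ x₂ : LocArc.VJ Jh, (LocArc.graphDeltaJ Jh).Adj x₁ x₂ ∧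
      ((LocArc.graphDeltaJ Jh).neighborSet x₁).ncard = Nat.card F + 1 ∧
      ((LocArc.graphDeltaJ Jh).neighborSet x₂).ncard = Nat.card F) ∧
    -- and for each of them the core has the following structure
    ∀ x₁ x₂ : LocArc.VJ Jh, (LocArc.graphDeltaJ Jh).Adj x₁ x₂ →
      ((LocArc.graphDeltaJ Jh).neighborSet x₁).ncard = Nat.card F + 1 →
      ((LocArc.graphDeltaJ Jh).neighborSet x₂).ncard = Nat.card F →
      ∀ H₁ H₂ L₁ T₂ B H₁s H₂s Z₁ R₂ : Subgroup (LocArc.GJ Jh),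
      H₁ = MulAction.stabilizer (LocArc.GJ Jh) x₁ →
      H₂ = MulAction.stabilizer (LocArc.GJ Jh) x₂ →
      L₁ = LocArc.vertexL (LocArc.graphDeltaJ Jh) (LocArc.GJ Jh) x₁ →
      T₂ = LocArc.coreIn H₂ (H₁ ⊓ H₂) →
      B = LocArc.coreB H₁ H₂ →
      H₁s = LocArc.conjClosure H₁ B →
      H₂s = LocArc.conjClosure H₂ B →
      Z₁ = LocArc.centreOf L₁ →
      R₂ = LocArc.pRadical 3 T₂ →
      ∃ d : ℕ, d ∣ Nat.card F - 1 ∧ ∀ S : Sylow 3 (LocArc.ASL F 2),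
        -- (i)
        (Nonempty (L₁ ≃* LocArc.Ele F 1 × LocArc.ASL F 2) ∧ Nonempty (Z₁ ≃* LocArc.Ele F 1) ∧
          LocArc.pRadical 3 B = LocArc.pRadical 3 (L₁ ⊓ B) ∧
          LocArc.pRadical 3 (L₁ ⊓ B) = R₂ ∧ LocArc.IsSylowIn 3 R₂ L₁) ∧
        -- (ii)
        ((B : Set (LocArc.GJ Jh)) = {g | ∃ x ∈ L₁ ⊓ B, ∃ y ∈ T₂, g = x * y} ∧
          Nonempty (↥(L₁ ⊓ B) ≃* LocArc.Ele F 1 × LocArc.ASL2S S) ∧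
          LocArc.QuotientIso T₂ Z₁ (LocArc.indexSub (LocArc.K2S S) d)) ∧
        -- (iii)
        (LocArc.IsoSemidirect H₁s (LocArc.Ele F 3) (LocArc.indexSub (LocArc.GLn F 2) d) ∧
          Nonempty (LocArc.centralizerIn H₁s Z₁ ≃*
            LocArc.Ele F 1 × LocArc.indexSub (LocArc.AGL F 2) ((Nat.card F - 1) / 2))) ∧
        -- (iv)
        (LocArc.IsSplitBy H₂s R₂
            (LocArc.indexSub (LocArc.GLn F 1) d × LocArc.AGL F 1) ∧
          Nonempty (LocArc.centralizerIn H₂s (LocArc.centreOf R₂) ≃*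
            LocArc.Ele F 1 × LocArc.indexSub (LocArc.K2S S) ((Nat.card F - 1) / 2))) ∧
        -- `H₁ / L₁` is a point stabilizer in a 2-transitive subgroup of `AΓL₁(q)`
        ∃ (I : Subgroup (Equiv.Perm F)) (p : F), LocArc.IsTwoTransSub F I ∧
          LocArc.QuotientIso H₁ L₁ (MulAction.stabilizer I p) := by
  open LocArc in
  refine ⟨isGGraph_graphDeltaJ Jh, isCoverOf_graphDelta Jh,
    isLocallyArcTransitive_cosetGraph ((movesToStandardArc hJh).subgroupOf le_sup_left
      (Subgroup.mem_sup_left de_mem_G1J) (Subgroup.mem_sup_right (ta_mem_G2J 1))),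
    ⟨Sum.inl ((1 : GJ Jh) : _), Sum.inr ((1 : GJ Jh) : _), ⟨1, rfl, rfl⟩,
      ncard_neighborSet_graphDeltaJ_inl _, ncard_neighborSet_graphDeltaJ_inr _⟩, ?_⟩
  intro x₁ x₂ hadj hc₁ hc₂ H₁ H₂ L₁ T₂ B H₁s H₂s Z₁ R₂ e₁ e₂ eL eT eB eH₁ eH₂ eZ eR
  -- the valencies tell the two kinds of vertices apart
  obtain ⟨x, rfl⟩ : ∃ x, x₁ = Sum.inl x := by
    rcases x₁ with x | x
    · exact ⟨x, rfl⟩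
    · rw [ncard_neighborSet_graphDeltaJ_inr] at hc₁
      omega
  obtain ⟨y, rfl⟩ : ∃ y, x₂ = Sum.inr y := by
    rcases x₂ with y | y
    · exact hadj.elim
    · exact ⟨y, rfl⟩
  obtain ⟨g, hx, hy⟩ := exists_smul_of_adj hadj
  rw [hx] at hadj e₁ eL
  rw [hy] at hadj e₂
  have hψ := conjHom_injective g
  have i₁ : H₁.map (conjHom Jh g) = G1J Jh := by
    rw [e₁]
    exact map_conjHom le_sup_left fun _ => mem_stabilizer_inl
  have i₂ : H₂.map (conjHom Jh g) = G2J Jh := by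
    rw [e₂]
    exact map_conjHom le_sup_right fun _ => mem_stabilizer_inr
  have hsmul := (isGGraph_graphDeltaJ Jh).adj_smul
  have iL : L₁.map (conjHom Jh g) = linSub (detSub ⊥) := by
    rw [eL, vertexL_eq hsmul hadj fun _ => exists_smul_inr_eq, vertexQ, vertexQ,
      localKernel_eq_coreIn hsmul hadj fun _ => exists_smul_inr_eq,
      localKernel_eq_coreIn hsmul hadj.symm fun _ => exists_smul_inl_eq, ← e₁, ← e₂,
      inf_comm H₂, Subgroup.map_sup, map_conjClosure, map_pRadical 3 hψ, map_pRadical 3 hψ,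
      map_coreIn hψ, map_coreIn hψ, Subgroup.map_inf _ _ _ hψ, i₁, i₂, coreIn_G2J,
      pRadical_linSub_wt, conjClosure_G1J_wt]
    exact sup_eq_left.2 (pRadical_coreIn_G1J_le.trans (linSub_mono (wt_le_detSub ⊥)))
  refine ⟨(scal Jh).index, ?_, fun S => ?_⟩
  · rw [← Nat.card_units]
    exact (scal Jh).index_dvd_card
  · obtain ⟨p1, p2, p3, p4, p5⟩ :=
      core_structure hJh hψ i₁ i₂ iL eT eB eH₁ eH₂ eZ eR S
    exact ⟨p1, p2, p3, p4, Jh, 0, hJh, p5⟩
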